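/- Let $T$ be a tree whose edges are segments of positive length, and let $d(p,q)$ be the length of the simple path between two points $p,q$ of $T$. Let $\mathcal P=\{P_1,\dots,P_n\}$ be uncertain points on $T$: each $P_i$ has a weight $w_i\ge 0$ and locations $p_{i1},\dots,p_{im_i}$, where $p_{ij}$ has probability $f_{ij}\ge 0$ and $\sum_j f_{ij}=1$. Put $M=\sum_i m_i$ and, for a point $x$ of $T$, $$\mathrm{Ed}(x,P_i)=w_i\sum_{j=1}^{m_i} f_{ij}\,d(x,p_{ij}).$$ Assume that all locations are at vertices of $T$ and that every vertex of $T$ holds at least one location (it may hold several). Then a data structure $\mathcal A_3$ can be built in $O(M\log M)$ time that, for any point $x$ of $T$ and any $P_i\in\mathcal P$, computes $\mathrm{Ed}(x,P_i)$ in $O(\log M)$ time. If $x$ is specified by an edge $e$ that contains it and the distance of $x$ from a fixed incident vertex $u$ of $e$, the same query also computes coefficients $\alpha,\beta$ with $\mathrm{Ed}(y,P_i)=\alpha+\beta\, d(u,y)$ for all points $y$ of $e$. Precisely: on a real RAM (unit-cost exact arithmetic $+,-,\cdot,/$ and comparisons on reals, no rounding of reals to integers; words of $b$ bits for integers and addresses)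 there are a building program, a query program and constants $C,c$, all independent of the input and of $b$, such that for every input and every $b$ with $2^b\ge (M+2)^c$, building takes at most $C\,M\log(M+1)$ steps, and each query, also after any sequence of earlier queries, takes at most $C\log(M+1)$ steps and is answered correctly. -/

import Mathlib

noncomputable section

namespace UncertainTree

/-! ## The problem: uncertain points on a tree

Everything is in the vertex-constrained setting: all locations are at vertices, and every vertex
holds at least one location. A vertex may hold several locations. -/

/-- `n` uncertain points with `M` locations altogether on a tree with `N` vertices and `E` edges. -/
structure Instance where
  /-- number of vertices of the tree -/
  N : ℕ
  /-- number of edges of the tree -/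
  E : ℕ
  /-- number of uncertain points -/
  n : ℕ
  /-- total number of locations of all uncertain points -/
  M : ℕ
  /-- the combinatorial tree -/
  G : SimpleGraph (Fin N)
  isTree : G.IsTree
  /-- the two incident vertices of every edge, the edges being listed in an arbitrary order -/
  src : Fin E → Fin N
  tgt : Fin E → Fin N
  edges_bijOn : Set.BijOn (fun e => s(src e, tgt e)) Set.univ G.edgeSet
  /-- the edge lengths -/
  len : Fin E → ℝ
  len_pos : ∀ e, 0 < len e
  /-- the `k`-th location is at vertex `loc k`, it is a location of the uncertain point number
  `owner k`, which appears there with probability `prob k` -/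
  loc : Fin M → Fin N
  owner : Fin M → Fin n
  prob : Fin M → ℝ
  prob_nonneg : ∀ k, 0 ≤ prob k
  prob_sum : ∀ i, ∑ k with owner k = i, prob k = 1
  /-- every vertex holds a location -/
  loc_surjective : Function.Surjective loc
  /-- the weights of the uncertain points -/
  weight : Fin n → ℝ
  weight_nonneg : ∀ i, 0 ≤ weight i

namespace Instance

variable (I : Instance)

/-- The edge `e` is on the simple path between the vertices `u` and `v`. -/
def OnPath (e : Fin I.E) (u v : Fin I.N) : Prop :=
  ∃ p : I.G.Walk u v, p.IsPath ∧ s(I.src e, I.tgt e) ∈ p.edges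

open Classical in
/-- The distance of two vertices: the sum of the lengths of the edges on the simple path. -/
def vdist (u v : Fin I.N) : ℝ :=
  ∑ e with I.OnPath e u v, I.len e

/-- A point of the tree, specified by a vertex, or by an edge `e` that contains the point and the
distance `δ` of the point from the incident vertex `src e`. -/
inductive Point where
  | vertex (v : Fin I.N)
  | onEdge (e : Fin I.E) (δ : ℝ) (hδ : δ ∈ Set.Icc 0 (I.len e))

open Classical in
/-- The length of the simple path from a point `x` to a vertex `v`. If `x` is on the edge `e` and
the path from `src e` to `v` uses `e`, then `x` is on this path, and the part of it before `x` has
length `δ`; otherwise the path from `x` to `v` first goes to `src e`. -/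
def dist : I.Point → Fin I.N → ℝ
  | .vertex u, v => I.vdist u v
  | .onEdge e δ _, v =>
      if I.OnPath e (I.src e) v then I.vdist (I.src e) v - δ else I.vdist (I.src e) v + δ

/-- The weighted expected distance from `x` to the uncertain point number `i`. -/
def Ed (x : I.Point) (i : Fin I.n) : ℝ :=
  I.weight i * ∑ k with I.owner k = i, I.prob k * I.dist x (I.loc k)

end Instance

/-! ## The machine: a RAM with integer words and real numbers

The memory consists of arrays of `w`-bit words (natural numbers, arithmetic is modulo `2 ^ w`) and
of arrays of exact real numbers; arrays are indexed by words. A program is a fixed finite piece of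
syntax, whose only constants are natural numbers. Every memory access, constant, operation,
comparison and test counts as one step. There is no conversion of reals to words. -/

/-- The contents of the memory: cell `j` of the word array `a` is `word a j`, cell `j` of the real
array `a` is `real a j`. -/
structure Store where
  word : ℕ → ℕ → ℕ
  real : ℕ → ℕ → ℝ

/-- Write the value `v` into cell `j` of the array `a`. -/
def write {α : Type} (f : ℕ → ℕ → α) (a j : ℕ) (v : α) : ℕ → ℕ → α :=
  Function.update f a (Function.update (f a) j v)

/-- Word expressions. -/
inductive WExp where
  | const (c : ℕ)
  | cell (a : ℕ) (j : WExp)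
  | add (x y : WExp)
  | sub (x y : WExp)
  | mul (x y : WExp)
  | div (x y : WExp)

/-- The value of a word expression, for words of `w` bits. Subtraction is truncated at `0`. -/
def WExp.eval (w : ℕ) (s : Store) : WExp → ℕ
  | .const c => c % 2 ^ w
  | .cell a j => s.word a (j.eval w s)
  | .add x y => (x.eval w s + y.eval w s) % 2 ^ w
  | .sub x y => x.eval w s - y.eval w s
  | .mul x y => (x.eval w s * y.eval w s) % 2 ^ w
  | .div x y => x.eval w s / y.eval w s

/-- The number of steps for evaluating a word expression. -/
def WExp.cost : WExp → ℕ
  | .const _ => 1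
  | .cell _ j => j.cost + 1
  | .add x y | .sub x y | .mul x y | .div x y => x.cost + y.cost + 1

/-- Real expressions. -/
inductive RExp where
  | const (c : ℕ)
  | cell (a : ℕ) (j : WExp)
  | add (x y : RExp)
  | sub (x y : RExp)
  | mul (x y : RExp)
  | div (x y : RExp)

/-- The value of a real expression. -/
def RExp.eval (w : ℕ) (s : Store) : RExp → ℝ
  | .const c => c
  | .cell a j => s.real a (j.eval w s)
  | .add x y => x.eval w s + y.eval w s
  | .sub x y => x.eval w s - y.eval w s
  | .mul x y => x.eval w s * y.eval w s
  | .div x y => x.eval w s / y.eval w s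

/-- The number of steps for evaluating a real expression. -/
def RExp.cost : RExp → ℕ
  | .const _ => 1
  | .cell _ j => j.cost + 1
  | .add x y | .sub x y | .mul x y | .div x y => x.cost + y.cost + 1

/-- Tests. -/
inductive Test where
  | wle (x y : WExp)
  | rle (x y : RExp)
  | not (b : Test)
  | and (b c : Test)

/-- The test is passed. -/
def Test.Holds (w : ℕ) (s : Store) : Test → Prop
  | .wle x y => x.eval w s ≤ y.eval w s
  | .rle x y => x.eval w s ≤ y.eval w s
  | .not b => ¬ b.Holds w s
  | .and b c => b.Holds w s ∧ c.Holds w s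

/-- The number of steps for evaluating a test. -/
def Test.cost : Test → ℕ
  | .wle x y => x.cost + y.cost + 1
  | .rle x y => x.cost + y.cost + 1
  | .not b => b.cost + 1
  | .and b c => b.cost + c.cost + 1

/-- Programs. -/
inductive Prog where
  | skip
  | setWord (a : ℕ) (j : WExp) (x : WExp)
  | setReal (a : ℕ) (j : WExp) (x : RExp)
  | seq (p q : Prog)
  | ite (b : Test) (p q : Prog)
  | loop (b : Test) (p : Prog)

/-- `Exec w p s t s'`: on a machine with `w`-bit words, the program `p` started with memory `s`
halts after exactly `t` steps with memory `s'`. The program `loop b p` repeats `p` while `b`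
holds. -/
inductive Exec (w : ℕ) : Prog → Store → ℕ → Store → Prop where
  | skip (s : Store) : Exec w .skip s 1 s
  | setWord (a : ℕ) (j x : WExp) (s : Store) :
      Exec w (.setWord a j x) s (j.cost + x.cost + 1)
        { s with word := write s.word a (j.eval w s) (x.eval w s) }
  | setReal (a : ℕ) (j : WExp) (x : RExp) (s : Store) :
      Exec w (.setReal a j x) s (j.cost + x.cost + 1)
        { s with real := write s.real a (j.eval w s) (x.eval w s) }
  | seq {p q : Prog} {s s₁ s₂ : Store} {t₁ t₂ : ℕ} :
      Exec w p s t₁ s₁ → Exec w q s₁ t₂ s₂ → Exec w (.seq p q) s (t₁ + t₂) s₂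
  | iteTrue {b : Test} {p q : Prog} {s s' : Store} {t : ℕ} :
      b.Holds w s → Exec w p s t s' → Exec w (.ite b p q) s (b.cost + 1 + t) s'
  | iteFalse {b : Test} {p q : Prog} {s s' : Store} {t : ℕ} :
      ¬ b.Holds w s → Exec w q s t s' → Exec w (.ite b p q) s (b.cost + 1 + t) s'
  | loopDone {b : Test} {p : Prog} {s : Store} :
      ¬ b.Holds w s → Exec w (.loop b p) s (b.cost + 1) s
  | loopStep {b : Test} {p : Prog} {s s₁ s₂ : Store} {t₁ t₂ : ℕ} :
      b.Holds w s → Exec w p s t₁ s₁ → Exec w (.loop b p) s₁ t₂ s₂ →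
      Exec w (.loop b p) s (b.cost + 1 + t₁ + t₂) s₂

/-! ## Input, queries and output -/

/-- The array with entries `f 0, f 1, …, f (m - 1), 0, 0, …`. -/
def arrayOf {α : Type} [Zero α] {m : ℕ} (f : Fin m → α) (j : ℕ) : α :=
  if h : j < m then f ⟨j, h⟩ else 0

namespace Instance

variable (I : Instance)

/-- The initial memory: the four sizes, the two ends of every edge, the vertex and the uncertain
point of every location, the edge lengths, the probabilities and the weights, zero elsewhere. -/
def input : Store where
  word a := match a with
    | 0 => arrayOf ![I.N, I.E, I.n, I.M]
    | 1 => arrayOf fun e => (I.src e : ℕ)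
    | 2 => arrayOf fun e => (I.tgt e : ℕ)
    | 3 => arrayOf fun k => (I.loc k : ℕ)
    | 4 => arrayOf fun k => (I.owner k : ℕ)
    | _ => fun _ => 0
  real a := match a with
    | 0 => arrayOf I.len
    | 1 => arrayOf I.prob
    | 2 => arrayOf I.weight
    | _ => fun _ => 0

/-- Pose the query `(x, i)`: the word array `5` is set to `0, v, i` if `x` is the vertex `v`, and to
`1, e, i` if `x` is on the edge `e` at distance `δ` from `src e`, where `δ` is written into cell `0`
of the real array `3`. Nothing else in the memory changes. -/
def ask (x : I.Point) (i : Fin I.n) (s : Store) : Store :=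
  match x with
  | .vertex v =>
      { s with word := write (write (write s.word 5 0 0) 5 1 v) 5 2 i }
  | .onEdge e δ _ =>
      { word := write (write (write s.word 5 0 1) 5 1 e) 5 2 i
        real := write s.real 3 0 δ }

/-- The memory holds the answer to the query `(x, i)`: cell `0` of the real array `4` is the expected
distance, and if `x` is specified by an edge `e`, then cells `1` and `2` are the coefficients `α`,
`β` of the linear function `δ ↦ α + β * δ` that gives the expected distance to the uncertain point
from the point of `e` at distance `δ` from `src e`. -/
def Answered (x : I.Point) (i : Fin I.n) (s : Store) : Prop :=
  s.real 4 0 = I.Ed x i ∧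
  match x with
  | .vertex _ => True
  | .onEdge e _ _ => ∀ (δ : ℝ) (hδ : δ ∈ Set.Icc 0 (I.len e)),
      I.Ed (.onEdge e δ hδ) i = s.real 4 1 + s.real 4 2 * δ

/-- The memory states between queries: the one that `build` leaves on the input, and those after
any further sequence of queries, each of them answered by running `query`. -/
inductive Ready (w : ℕ) (build query : Prog) : Store → Prop where
  | built {t : ℕ} {s : Store} : Exec w build I.input t s → Ready w build query s
  | step {x : I.Point} {i : Fin I.n} {t : ℕ} {s s' : Store} :
      Ready w build query s → Exec w query (I.ask x i s) t s' → Ready w build query s'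

end Instance

end UncertainTree

end

/-! Root the tree at the vertex `0` and measure depths by edge length. If `a` is the lowest common
ancestor (lca) of `u` and `v`, then d(u,v) = depth u + depth v - 2 depth a
(`Instance.Numbered.vdist_eq`). As the probabilities of an uncertain point sum to 1, its expected
distance from `v` is its weight times A + depth v - 2B, where A is the sum of f * depth over its
locations and B is the sum of f * depth of the lca with `v` (`Index.Complete.Ed_vertex`). Number the
vertices in preorder and sort all locations by the key owner * N + number. The locations of one
uncertain point then form a block of consecutive positions, and A is a difference of two prefix
sums. Only B needs an idea.

Split B at the position of `v` in the block. Let `a` be the lca of `v` and the nearest location to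
the left. All locations of the block from `a` up to `v` lie in the subtree of `a` and have lca
exactly `a` with `v`; together they contribute depth a times a difference of prefix sums of
probabilities. A location before `a` has the same lca with `v` as with the first location at or
after `a`, and for the latter the left sum is stored in a table. This is `leftSum_step`;
`rightSum_step` is the mirror image, with the end of the subtree of `a` in place of `a`. So one lca,
one binary search and constant arithmetic answer each half of a query, and the same recursion fills
the two tables while building. The lca is a range minimum over the parents' numbers
(`PreTree.meet_iff`), found in a binary tree of minima.

Along an edge, the distance grows at unit rate to the locations on the side of `src e` and shrinks
at unit rate to the others. The slope is therefore determined by the probability of the subtree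
below the edge, again a difference of prefix sums (`Index.Ed_onEdge`, `Index.below_eq`).

The numbering needs no adjacency lists. Leaves are removed one after the other, while every vertex
keeps its degree and the sum of the numbers of its remaining edges; at a leaf this sum is the one
remaining edge. The reversed order of removal lists parents before children, and the subtree sizes
then determine a preorder (`Peel`, `Numbering`, `IsNumbering`). The keys are less than n * N ≤ M ^
2, so a binary radix sort takes about 2 log M linear passes. All words that occur are O(M ^ 2),
which is why a fixed exponent `c` excludes overflow. -/

namespace UncertainTree

/-! ## Running time and frame rules for programs -/

theorem write_apply {α : Type} (f : ℕ → ℕ → α) (a j : ℕ) (v : α) (b : ℕ) :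
    write f a j v b = if b = a then Function.update (f a) j v else f b := by
  unfold write
  by_cases h : b = a
  · subst h; simp
  · simp [h]

namespace Prog

/-- The word arrays that a program writes to. -/
def wordMods : Prog → List ℕ
  | skip => []
  | setWord a _ _ => [a]
  | setReal _ _ _ => []
  | seq p q => p.wordMods ++ q.wordMods
  | ite _ p q => p.wordMods ++ q.wordMods
  | loop _ p => p.wordMods

/-- The real arrays that a program writes to. -/
def realMods : Prog → List ℕ
  | skip => []
  | setWord _ _ _ => []
  | setReal a _ _ => [a]
  | seq p q => p.realMods ++ q.realMods
  | ite _ p q => p.realMods ++ q.realMods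
  | loop _ p => p.realMods

/-- Programs without loops. -/
def straight : Prog → Bool
  | seq p q => p.straight && q.straight
  | ite _ p q => p.straight && q.straight
  | loop _ _ => false
  | _ => true

open Classical in
/-- The effect of a program without loops. -/
noncomputable def run (w : ℕ) : Prog → Store → Store
  | skip, s => s
  | setWord a j x, s => { s with word := write s.word a (j.eval w s) (x.eval w s) }
  | setReal a j x, s => { s with real := write s.real a (j.eval w s) (x.eval w s) }
  | seq p q, s => q.run w (p.run w s)
  | ite b p q, s => if b.Holds w s then p.run w s else q.run w s
  | loop _ _, s => s

/-- An upper bound for the number of steps of a program without loops. -/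
def stepBound : Prog → ℕ
  | skip => 1
  | setWord _ j x => j.cost + x.cost + 1
  | setReal _ j x => j.cost + x.cost + 1
  | seq p q => p.stepBound + q.stepBound
  | ite b p q => b.cost + 1 + max p.stepBound q.stepBound
  | loop _ _ => 0

/-- The memories `s` and `s'` agree outside the arrays that `p` writes to. -/
def Same (p : Prog) (s s' : Store) : Prop :=
  (∀ a, a ∉ p.wordMods → s'.word a = s.word a) ∧ ∀ a, a ∉ p.realMods → s'.real a = s.real a

theorem Same.refl (p : Prog) (s : Store) : p.Same s s := ⟨fun _ _ => rfl, fun _ _ => rfl⟩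

theorem Same.trans {p : Prog} {s s' s'' : Store} (h : p.Same s s') (h' : p.Same s' s'') :
    p.Same s s'' :=
  ⟨fun a ha => (h'.1 a ha).trans (h.1 a ha), fun a ha => (h'.2 a ha).trans (h.2 a ha)⟩

theorem Same.mono {p q : Prog} {s s' : Store} (h : p.Same s s')
    (hw : p.wordMods ⊆ q.wordMods) (hr : p.realMods ⊆ q.realMods) : q.Same s s' :=
  ⟨fun a ha => h.1 a fun h' => ha (hw h'), fun a ha => h.2 a fun h' => ha (hr h')⟩

end Prog

theorem Exec.same {w : ℕ} {p : Prog} {s s' : Store} {t : ℕ} (h : Exec w p s t s') :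
    p.Same s s' := by
  induction h with
  | skip s => exact Prog.Same.refl _ _
  | setWord a j x s =>
    refine ⟨fun b hb => ?_, fun _ _ => rfl⟩
    have : b ≠ a := by simpa [Prog.wordMods] using hb
    simp [write_apply, this]
  | setReal a j x s =>
    refine ⟨fun _ _ => rfl, fun b hb => ?_⟩
    have : b ≠ a := by simpa [Prog.realMods] using hb
    simp [write_apply, this]
  | seq _ _ ih₁ ih₂ =>
    exact (ih₁.mono (by simp [Prog.wordMods]) (by simp [Prog.realMods])).trans
      (ih₂.mono (by simp [Prog.wordMods]) (by simp [Prog.realMods]))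
  | iteTrue _ _ ih => exact ih.mono (by simp [Prog.wordMods]) (by simp [Prog.realMods])
  | iteFalse _ _ ih => exact ih.mono (by simp [Prog.wordMods]) (by simp [Prog.realMods])
  | loopDone _ => exact Prog.Same.refl _ _
  | loopStep _ _ _ ih₁ ih₂ =>
    exact (ih₁.mono (by simp [Prog.wordMods]) (by simp [Prog.realMods])).trans ih₂

/-- `Ready` speaks of arbitrary executions, while the correctness proofs construct a particular one;
determinism identifies the final memories of the two. -/
theorem Exec.deterministic {w : ℕ} {p : Prog} {s s₁ : Store} {t₁ : ℕ} (h₁ : Exec w p s t₁ s₁) :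
    ∀ {t₂ : ℕ} {s₂ : Store}, Exec w p s t₂ s₂ → s₁ = s₂ := by
  induction h₁ with
  | skip s => intro _ _ h; cases h; rfl
  | setWord a j x s => intro _ _ h; cases h; rfl
  | setReal a j x s => intro _ _ h; cases h; rfl
  | seq _ _ ih₁ ih₂ =>
    intro _ _ h
    cases h with
    | seq ha hb => cases ih₁ ha; exact ih₂ hb
  | iteTrue hb _ ih =>
    intro _ _ h
    cases h with
    | iteTrue _ h => exact ih h
    | iteFalse hb' _ => exact absurd hb hb'
  | iteFalse hb _ ih =>
    intro _ _ h
    cases h with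
    | iteTrue hb' _ => exact absurd hb' hb
    | iteFalse _ h => exact ih h
  | loopDone hb =>
    intro _ _ h
    cases h with
    | loopDone _ => rfl
    | loopStep hb' _ _ => exact absurd hb' hb
  | loopStep hb _ _ ih₁ ih₂ =>
    intro _ _ h
    cases h with
    | loopDone hb' => exact absurd hb hb'
    | loopStep _ ha hc => cases ih₁ ha; exact ih₂ hc

theorem Prog.exec_run {w : ℕ} (p : Prog) (hp : p.straight = true) (s : Store) :
    ∃ t, Exec w p s t (p.run w s) ∧ t ≤ p.stepBound := by
  induction p generalizing s with
  | skip => exact ⟨_, .skip s, le_rfl⟩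
  | setWord a j x => exact ⟨_, .setWord a j x s, le_rfl⟩
  | setReal a j x => exact ⟨_, .setReal a j x s, le_rfl⟩
  | seq p q ihp ihq =>
    simp only [Prog.straight, Bool.and_eq_true] at hp
    obtain ⟨t₁, h₁, ht₁⟩ := ihp hp.1 s
    obtain ⟨t₂, h₂, ht₂⟩ := ihq hp.2 (p.run w s)
    exact ⟨_, .seq h₁ h₂, Nat.add_le_add ht₁ ht₂⟩
  | ite b p q ihp ihq =>
    simp only [Prog.straight, Bool.and_eq_true] at hp
    by_cases hb : b.Holds w s
    · obtain ⟨t, h, ht⟩ := ihp hp.1 s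
      refine ⟨_, by simpa [Prog.run, hb] using Exec.iteTrue (q := q) hb h, ?_⟩
      simp only [Prog.stepBound]; omega
    · obtain ⟨t, h, ht⟩ := ihq hp.2 s
      refine ⟨_, by simpa [Prog.run, hb] using Exec.iteFalse (p := p) hb h, ?_⟩
      simp only [Prog.stepBound]; omega
  | loop b p => simp [Prog.straight] at hp

/-- The program `p` started with memory `s` halts within `T` steps; the final memory satisfies `Q`
and differs from `s` only in the arrays that `p` writes to. -/
def Runs (w : ℕ) (p : Prog) (s : Store) (T : ℕ) (Q : Store → Prop) : Prop :=
  ∃ t s', Exec w p s t s' ∧ t ≤ T ∧ p.Same s s' ∧ Q s'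

namespace Runs

variable {w : ℕ} {p q : Prog} {s : Store} {T T' T₁ T₂ : ℕ} {Q Q' : Store → Prop}

theorem mono (h : Runs w p s T Q) (hT : T ≤ T') (hQ : ∀ s', p.Same s s' → Q s' → Q' s') :
    Runs w p s T' Q' :=
  let ⟨t, s', h₁, h₂, h₃, h₄⟩ := h
  ⟨t, s', h₁, h₂.trans hT, h₃, hQ s' h₃ h₄⟩

theorem straight (hp : p.straight = true) (hQ : Q (p.run w s)) : Runs w p s p.stepBound Q :=
  let ⟨t, h₁, h₂⟩ := p.exec_run (w := w) hp s
  ⟨t, _, h₁, h₂, h₁.same, hQ⟩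

theorem seq (hp : Runs w p s T₁ Q) (hq : ∀ s', p.Same s s' → Q s' → Runs w q s' T₂ Q') :
    Runs w (p.seq q) s (T₁ + T₂) Q' :=
  let ⟨_, s₁, h₁, h₂, h₃, h₄⟩ := hp
  let ⟨_, _, h₁', h₂', _, h₄'⟩ := hq s₁ h₃ h₄
  ⟨_, _, h₁.seq h₁', Nat.add_le_add h₂ h₂', (h₁.seq h₁').same, h₄'⟩

theorem ite {b : Test} (hp : b.Holds w s → Runs w p s T Q) (hq : ¬ b.Holds w s → Runs w q s T Q) :
    Runs w (.ite b p q) s (b.cost + 1 + T) Q := by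
  by_cases hb : b.Holds w s
  · obtain ⟨t, s', h₁, h₂, _, h₄⟩ := hp hb
    exact ⟨_, s', .iteTrue hb h₁, by omega, (Exec.iteTrue (q := q) hb h₁).same, h₄⟩
  · obtain ⟨t, s', h₁, h₂, _, h₄⟩ := hq hb
    exact ⟨_, s', .iteFalse hb h₁, by omega, (Exec.iteFalse (p := p) hb h₁).same, h₄⟩

/-- The rule for loops: the number of rounds is bounded by a natural number that decreases. -/
theorem loop {b : Test} (Inv : ℕ → Store → Prop)
    (step : ∀ m s', p.Same s s' → Inv m s' → b.Holds w s' →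
      Runs w p s' T fun s'' => ∃ m' < m, Inv m' s'') {m : ℕ} (init : Inv m s) :
    Runs w (.loop b p) s (m * (b.cost + 1 + T) + (b.cost + 1))
      fun s' => ¬ b.Holds w s' ∧ ∃ m', Inv m' s' := by
  -- Strong induction on the bound `m`: a round may lower it by more than one, and the loop may stop
  -- before it reaches `0`.
  have key : ∀ m s', p.Same s s' → Inv m s' → ∃ t s'', Exec w (.loop b p) s' t s'' ∧
      t ≤ m * (b.cost + 1 + T) + (b.cost + 1) ∧ ¬ b.Holds w s'' ∧ ∃ m', Inv m' s'' := by
    intro m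
    induction m using Nat.strong_induction_on with
    | _ m ih =>
      intro s' hs' hi
      by_cases hb : b.Holds w s'
      · obtain ⟨t, s₁, h₁, ht, h₃, m', hm', hi'⟩ := step m s' hs' hi hb
        obtain ⟨t₂, s₂, h₂, ht₂, h₄⟩ := ih m' hm' s₁ (hs'.trans h₃) hi'
        refine ⟨_, s₂, .loopStep hb h₁ h₂, ?_, h₄⟩
        have : (m' + 1) * (b.cost + 1 + T) ≤ m * (b.cost + 1 + T) := Nat.mul_le_mul_right _ hm'
        rw [Nat.add_mul] at this
        omega
      · exact ⟨_, s', .loopDone hb, by omega, hb, m, hi⟩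
  obtain ⟨t, s', h₁, h₂, h₃⟩ := key m s (.refl _ _) init
  exact ⟨t, s', h₁, h₂, h₁.same, h₃⟩

/-- The rule for loops with exactly `n` rounds. -/
theorem forLoop {b : Test} {n : ℕ} (Inv : ℕ → Store → Prop) (init : Inv 0 s)
    (test : ∀ i s', i ≤ n → p.Same s s' → Inv i s' → (b.Holds w s' ↔ i < n))
    (step : ∀ i s', i < n → p.Same s s' → Inv i s' → Runs w p s' T (Inv (i + 1))) :
    Runs w (.loop b p) s (n * (b.cost + 1 + T) + (b.cost + 1)) (Inv n) := by
  have h := loop (w := w) (p := p) (b := b) (s := s) (T := T)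
    (fun m s' => ∃ i, i ≤ n ∧ m = n - i ∧ p.Same s s' ∧ Inv i s')
    (by
      rintro m s' hs ⟨i, hi, rfl, -, h⟩ hb
      have hi' := (test i s' hi hs h).1 hb
      refine (step i s' hi' hs h).mono le_rfl fun s'' hs'' h'' => ?_
      exact ⟨n - (i + 1), by omega, i + 1, hi', rfl, hs.trans hs'', h''⟩)
    (m := n) ⟨0, Nat.zero_le _, rfl, .refl _ _, init⟩
  refine h.mono le_rfl ?_
  rintro s' - ⟨hb, m, i, hi, -, hs, h'⟩
  have := (test i s' hi hs h').not.1 hb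
  rwa [show n = i by omega]

end Runs

/-! ## Rooted trees with vertices numbered in preorder -/

/-- A rooted tree whose vertices are numbered in preorder: `par w` is the parent of `w ≠ 0`, and the
descendants of `z` are the numbers `z, …, en z - 1`. -/
structure PreTree (N : ℕ) (par en : ℕ → ℕ) : Prop where
  par_lt : ∀ w, 0 < w → w < N → par w < w
  lt_en : ∀ z, z < N → z < en z
  en_le : ∀ z, z < N → en z ≤ N
  cut : ∀ w z, 0 < w → w < N → z < N → w ≠ z → ((z ≤ w ∧ w < en z) ↔ (z ≤ par w ∧ par w < en z))

/-- The number `a` is the minimum of `u` and the parents of `u + 1, …, v`. -/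
def IsMeet (par : ℕ → ℕ) (u v a : ℕ) : Prop :=
  ∀ z, z ≤ a ↔ z ≤ u ∧ ∀ w, u < w → w ≤ v → z ≤ par w

theorem IsMeet.le_left {par : ℕ → ℕ} {u v a : ℕ} (h : IsMeet par u v a) : a ≤ u :=
  ((h a).1 le_rfl).1

namespace PreTree

variable {N : ℕ} {par en : ℕ → ℕ}

/-- Otherwise the number `en y` lies in the interval of `z`. By `cut` its parent is at least `z`,
and it is less than `en y`, hence in the interval of `y`; then `cut` for `y` puts `en y` into its
own half-open interval. -/
theorem nested (hT : PreTree N par en) {y z : ℕ} (hy : y < N) (hyz : y ≤ z) (hz : z < en y) :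
    en z ≤ en y := by
  by_contra! h
  have hzN : z < N := hz.trans_le (hT.en_le y hy)
  have hwN : en y < N := h.trans_le (hT.en_le z hzN)
  have h₁ := (hT.cut (en y) z (by omega) hwN hzN (by omega)).1 ⟨by omega, h⟩
  have h₂ := hT.par_lt (en y) (by omega) hwN
  have := hT.lt_en y hy
  have h₃ := (hT.cut (en y) y (by omega) hwN hy (by omega)).2 ⟨by omega, h₂⟩
  omega

/-- The meet of two vertices is their lowest common ancestor. -/
theorem meet_iff (hT : PreTree N par en) {u v a z : ℕ} (huv : u ≤ v) (hv : v < N)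
    (ha : IsMeet par u v a) (hz : z < N) : (z ≤ a ∧ a < en z) ↔ (z ≤ u ∧ v < en z) := by
  constructor
  · rintro ⟨h₁, h₂⟩
    have hzu : z ≤ u := h₁.trans ha.le_left
    refine ⟨hzu, ?_⟩
    by_contra! hlt
    have hpar := ((ha z).1 h₁).2
    -- Suppose the interval of `z` ends at or before `v`. If it ends after `u`, then `en z` is one
    -- of the vertices whose parents are bounded below by `a`, so its parent lies in the interval of
    -- `z`, and by `cut` so would `en z`.
    by_cases hu : u < en z
    · have h₃ := hpar (en z) hu hlt
      have h₄ := hT.par_lt (en z) (by omega) (by omega)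
      have := (hT.cut (en z) z (by omega) (by omega) hz (by omega)).2 ⟨h₃, h₄⟩
      omega
    -- Here `a < en z ≤ u`, so the minimum is not `u` but the parent of some `w` in `(u, v]`. This
    -- parent is in the interval of `z`, while `w` is beyond its end.
    · obtain ⟨w, hw₁, hw₂, hw₃⟩ : ∃ w, u < w ∧ w ≤ v ∧ par w ≤ a := by
        by_contra! hcon
        have := (ha (a + 1)).2 ⟨by omega, fun w h h' => hcon w h h'⟩
        omega
      have := (hT.cut w z (by omega) (by omega) hz (by omega)).2
        ⟨hpar w hw₁ hw₂, by omega⟩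
      omega
  · rintro ⟨h₁, h₂⟩
    have h₃ : z ≤ a := (ha z).2 ⟨h₁, fun w hw hw' =>
      ((hT.cut w z (by omega) (by omega) hz (by omega)).1 ⟨by omega, by omega⟩).1⟩
    exact ⟨h₃, by have := ha.le_left; omega⟩

end PreTree

/-! ### Sums of depths of lowest common ancestors over sorted keys -/

section Sums

variable {ι : Type} [Fintype ι] (ln : ι → ℝ) (z : ι → ℕ) (en : ℕ → ℕ)

/-- The depth of `x` if the edge `e` above the vertex `z e` has length `ln e`. -/
noncomputable def depth (x : ℕ) : ℝ :=
  ∑ e, if z e ≤ x ∧ x < en (z e) then ln e else 0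

/-- The depth of the lowest common ancestor. -/
noncomputable def common (x y : ℕ) : ℝ :=
  ∑ e, if (z e ≤ x ∧ x < en (z e)) ∧ (z e ≤ y ∧ y < en (z e)) then ln e else 0

/-- The sum of `f j * common (K j - b) x` over those `j < l` with `b ≤ K j`. -/
noncomputable def leftSum (K : ℕ → ℕ) (f : ℕ → ℝ) (b x l : ℕ) : ℝ :=
  ∑ j ∈ Finset.range l, if b ≤ K j then f j * common ln z en (K j - b) x else 0

/-- The sum of `f j * common x (K j - b)` over those `j` with `l ≤ j < M` and `K j < b + N`. -/
noncomputable def rightSum (N M : ℕ) (K : ℕ → ℕ) (f : ℕ → ℝ) (b x l : ℕ) : ℝ :=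
  ∑ j ∈ Finset.Ico l M, if K j < b + N then f j * common ln z en x (K j - b) else 0

/-- The number `t` is the position of the first `K j` with `q ≤ K j`. -/
def IsLowerBound (M : ℕ) (K : ℕ → ℕ) (q t : ℕ) : Prop :=
  t ≤ M ∧ (∀ j, j < t → K j < q) ∧ ∀ j, t ≤ j → j < M → q ≤ K j

variable {ln z en} {N M : ℕ} {par K : ℕ → ℕ} {f F : ℕ → ℝ} {b x l a t : ℕ}

/-- For `t ≤ j < l` the vertex `K j - b` lies between `a` and `K (l - 1) - b`, so an interval
contains it and `x` exactly if it contains `a`; the common depth is `depth a`. For `j < t` the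
vertex precedes `a`, and an interval that starts at or before it reaches `x` exactly if it reaches
`K t - b`, so `x` may be replaced by `K t - b`. What remains is the left sum belonging to the
position `t` itself, hence a table entry. -/
theorem leftSum_step (hT : PreTree N par en) (hz : ∀ e, z e < N)
    (hK : ∀ i j, i ≤ j → j < M → K i ≤ K j) (hF : ∀ j ≤ M, F j = ∑ i ∈ Finset.range j, f i)
    (hl : 0 < l) (hlM : l ≤ M) (hb : b ≤ K (l - 1)) (hx : K (l - 1) ≤ b + x) (hxN : x < N)
    (ha : IsMeet par (K (l - 1) - b) x a) (ht : IsLowerBound M K (b + a) t) :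
    t < l ∧ leftSum ln z en K f b x l =
      leftSum ln z en K f b (K t - b) t + depth ln z en a * (F l - F t) := by
  obtain ⟨-, ht₁, ht₂⟩ := ht
  have hal := ha.le_left
  have htl : t < l := by
    by_contra! h
    have := ht₁ (l - 1) (by omega)
    omega
  refine ⟨htl, ?_⟩
  have hKt := hK t (l - 1) (by omega) (by omega)
  have hat := ht₂ t le_rfl (by omega)
  have hm : ∀ e, (z e ≤ a ∧ a < en (z e)) ↔ (z e ≤ K (l - 1) - b ∧ x < en (z e)) := fun e =>
    hT.meet_iff (by omega) hxN ha (hz e)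
  unfold leftSum
  rw [← Finset.sum_range_add_sum_Ico _ htl.le]
  congr 1
  · refine Finset.sum_congr rfl fun j hj => ?_
    rw [Finset.mem_range] at hj
    have hj' := ht₁ j hj
    split_ifs with hbj
    · congr 1
      refine Finset.sum_congr rfl fun e _ => if_congr ?_ rfl rfl
      have := hm e
      constructor
      · rintro ⟨⟨h₁, h₂⟩, h₃, h₄⟩
        exact ⟨⟨h₁, h₂⟩, by omega, by omega⟩
      · rintro ⟨⟨h₁, h₂⟩, h₃, h₄⟩
        have := this.1 ⟨by omega, by omega⟩
        exact ⟨⟨h₁, h₂⟩, by omega, by omega⟩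
    · rfl
  · rw [hF l hlM, hF t (by omega), ← Finset.sum_Ico_eq_sub _ htl.le, Finset.mul_sum]
    refine Finset.sum_congr rfl fun j hj => ?_
    rw [Finset.mem_Ico] at hj
    have hj₁ := ht₂ j hj.1 (by omega)
    have hj₂ := hK j (l - 1) (by omega) (by omega)
    rw [if_pos (by omega), mul_comm]
    congr 1
    refine Finset.sum_congr rfl fun e _ => if_congr ?_ rfl rfl
    have := hm e
    constructor
    · rintro ⟨⟨h₁, h₂⟩, h₃, h₄⟩
      exact this.2 ⟨by omega, by omega⟩
    · intro h
      have := this.1 h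
      exact ⟨⟨by omega, by omega⟩, by omega, by omega⟩

/-- Mirror image of `leftSum_step`. The locations at positions from `l` to `t - 1` are in the
subtree of `a` and have common depth `depth a` with `x`; for those from `t` on, which are beyond the
subtree, `x` may be replaced by the last location `K (t - 1) - b` inside it. -/
theorem rightSum_step (hT : PreTree N par en) (hz : ∀ e, z e < N)
    (hK : ∀ i j, i ≤ j → j < M → K i ≤ K j) (hF : ∀ j ≤ M, F j = ∑ i ∈ Finset.range j, f i)
    (hlM : l < M) (hb : K l < b + N) (hx : b + x ≤ K l)
    (ha : IsMeet par x (K l - b) a) (ht : IsLowerBound M K (b + en a) t) :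
    l < t ∧ rightSum ln z en N M K f b x l =
      rightSum ln z en N M K f b (K (t - 1) - b) t + depth ln z en a * (F t - F l) := by
  obtain ⟨htM, ht₁, ht₂⟩ := ht
  have hal := ha.le_left
  have hm : ∀ y < N, (y ≤ a ∧ a < en y) ↔ (y ≤ x ∧ K l - b < en y) := fun y hy =>
    hT.meet_iff (by omega) (by omega) ha hy
  have haN : a < N := by omega
  have haa := (hm a haN).1 ⟨le_rfl, hT.lt_en a haN⟩
  have htl : l < t := by
    by_contra! h
    have := ht₂ l h hlM
    omega
  refine ⟨htl, ?_⟩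
  have hKt := hK l (t - 1) (by omega) (by omega)
  have hat := ht₁ (t - 1) (by omega)
  have hen := hT.en_le a haN
  unfold rightSum
  rw [← Finset.sum_Ico_consecutive _ htl.le htM, add_comm]
  congr 1
  · refine Finset.sum_congr rfl fun j hj => ?_
    rw [Finset.mem_Ico] at hj
    have hj' := ht₂ j hj.1 hj.2
    split_ifs with hbj
    · congr 1
      refine Finset.sum_congr rfl fun e _ => if_congr ?_ rfl rfl
      constructor
      · rintro ⟨⟨h₁, h₂⟩, h₃, h₄⟩
        exact ⟨⟨by omega, by omega⟩, h₃, h₄⟩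
      · rintro ⟨⟨h₁, h₂⟩, h₃, h₄⟩
        -- An interval that starts after `a` but at or before `K (t - 1) - b` is nested in that of
        -- `a`, so it cannot reach `K j - b`.
        have hza : z e ≤ a := by
          by_contra! h
          have := hT.nested (z := z e) haN h.le (by omega)
          omega
        exact ⟨⟨by omega, by omega⟩, h₃, h₄⟩
    · rfl
  · rw [hF t htM, hF l (by omega), ← Finset.sum_Ico_eq_sub _ htl.le, Finset.mul_sum]
    refine Finset.sum_congr rfl fun j hj => ?_
    rw [Finset.mem_Ico] at hj
    have hj₁ := ht₁ j hj.2
    have hj₂ := hK l j (by omega) (by omega)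
    rw [if_pos (by omega), mul_comm]
    congr 1
    refine Finset.sum_congr rfl fun e _ => if_congr ?_ rfl rfl
    have := hm (z e) (hz e)
    constructor
    · rintro ⟨⟨h₁, h₂⟩, h₃, h₄⟩
      exact this.2 ⟨by omega, by omega⟩
    · intro h
      have h' := this.1 h
      have := hT.nested (hz e) h.1 h.2
      exact ⟨⟨by omega, by omega⟩, by omega, by omega⟩

end Sums

/-! ### Sizes and edges of an instance -/

namespace Instance

variable (I : Instance)

theorem N_pos : 0 < I.N := by
  have := I.isTree.connected.nonempty
  exact Fin.pos_iff_nonempty.2 this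

theorem N_le_M : I.N ≤ I.M := by
  simpa using Fintype.card_le_of_surjective _ I.loc_surjective

/-- An uncertain point without locations would have total probability `0`. With `N_le_M` this bounds
the sort keys by `M * M`. -/
theorem n_le_M : I.n ≤ I.M := by
  have h : Function.Surjective I.owner := by
    intro i
    by_contra! h
    have := I.prob_sum i
    rw [Finset.sum_eq_zero fun k hk => absurd (Finset.mem_filter.1 hk).2 (h k)] at this
    exact zero_ne_one this
  simpa using Fintype.card_le_of_surjective _ h

theorem M_pos : 0 < I.M := I.N_pos.trans_le I.N_le_M

theorem adj_src_tgt (e : Fin I.E) : I.G.Adj (I.src e) (I.tgt e) :=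
  I.edges_bijOn.mapsTo (Set.mem_univ e)

theorem exists_edge {u v : Fin I.N} (h : I.G.Adj u v) :
    ∃ e, s(I.src e, I.tgt e) = s(u, v) := by
  obtain ⟨e, -, he⟩ := I.edges_bijOn.surjOn (show s(u, v) ∈ I.G.edgeSet from h)
  exact ⟨e, he⟩

theorem edge_inj {e e' : Fin I.E} (h : s(I.src e, I.tgt e) = s(I.src e', I.tgt e')) : e = e' :=
  I.edges_bijOn.injOn (Set.mem_univ _) (Set.mem_univ _) h

theorem E_add_one : I.E + 1 = I.N := by
  classical
  have h := I.isTree.card_edgeFinset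
  have h' : Nat.card (Set.univ : Set (Fin I.E)) = Nat.card I.G.edgeSet :=
    Nat.card_congr I.edges_bijOn.equiv
  rw [SimpleGraph.edgeFinset_card, ← Nat.card_eq_fintype_card, ← h'] at h
  simpa using h

/-! ### Distances and cuts -/

/-- `e` is the only edge between `A` and its complement, so a walk changes sides exactly when it
traverses `e`; count parities. -/
theorem odd_count_edges {A : Fin I.N → Prop} {e : Fin I.E}
    (hA : ∀ e', (A (I.src e') ↔ A (I.tgt e')) ↔ e' ≠ e) {u v : Fin I.N} (p : I.G.Walk u v) :
    Odd (p.edges.count s(I.src e, I.tgt e)) ↔ ¬ (A u ↔ A v) := by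
  induction p with
  | nil => simp
  | @cons u v w h p ih =>
    rw [SimpleGraph.Walk.edges_cons, List.count_cons]
    obtain ⟨e', he'⟩ := I.exists_edge h
    have huv : (A u ↔ A v) ↔ e' ≠ e := by
      rw [← hA e']
      rcases Sym2.eq_iff.1 he' with ⟨h₁, h₂⟩ | ⟨h₁, h₂⟩
      · rw [h₁, h₂]
      · rw [h₁, h₂]; exact Iff.comm
    by_cases hee : e' = e
    · subst hee
      rw [if_pos (by simp [he']), Nat.odd_add_one, ih]
      simp only [ne_eq, not_true_eq_false, iff_false] at huv
      tauto
    · rw [if_neg (by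
        simp only [beq_iff_eq]
        exact fun h' => hee (I.edge_inj (he'.trans h'))), add_zero, ih]
      have := huv.2 hee
      tauto

/-- A path uses an edge at most once, so the parity of `odd_count_edges` decides whether the edge is
used. It is applied with `A` the vertex set of a subtree, which turns distances into statements
about intervals. -/
theorem onPath_iff {A : Fin I.N → Prop} {e : Fin I.E}
    (hA : ∀ e', (A (I.src e') ↔ A (I.tgt e')) ↔ e' ≠ e) (u v : Fin I.N) :
    I.OnPath e u v ↔ ¬ (A u ↔ A v) := by
  have key : ∀ p : I.G.Walk u v, p.IsPath →
      (s(I.src e, I.tgt e) ∈ p.edges ↔ ¬ (A u ↔ A v)) := by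
    intro p hp
    rw [← I.odd_count_edges hA p, hp.isTrail.edges_nodup.count]
    split_ifs with h <;> simp [h]
  constructor
  · rintro ⟨p, hp, he⟩
    exact (key p hp).1 he
  · intro h
    obtain ⟨p, hp, -⟩ := I.isTree.existsUnique_path u v
    exact ⟨p, hp, (key p hp).2 h⟩

/-! ### The tree rooted at the vertex `0` -/

/-- Vertex `v` has parent `rp v`, to which it is connected by the edge `pe v`, for `0 < v < N`. -/
structure Rooted (rp pe rk : ℕ → ℕ) : Prop where
  rp_lt : ∀ v, 0 < v → v < I.N → rp v < I.N
  pe_lt : ∀ v, 0 < v → v < I.N → pe v < I.E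
  rk_lt : ∀ v, 0 < v → v < I.N → rk (rp v) < rk v
  ends : ∀ v, 0 < v → v < I.N →
    (arrayOf (fun e => (I.src e : ℕ)) (pe v) = v ∧ arrayOf (fun e => (I.tgt e : ℕ)) (pe v) = rp v) ∨
    (arrayOf (fun e => (I.src e : ℕ)) (pe v) = rp v ∧ arrayOf (fun e => (I.tgt e : ℕ)) (pe v) = v)
  pe_inj : ∀ v v', 0 < v → v < I.N → 0 < v' → v' < I.N → pe v = pe v' → v = v'
  pe_surj : ∀ e < I.E, ∃ v, 0 < v ∧ v < I.N ∧ pe v = e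

/-- The rank is the number of edges to the root, and the parent is some neighbour of smaller rank.
Two vertices with the same parent edge would each be nearer to the root than the other, so `pe` is
injective; as there are `N - 1` edges, it is also surjective. -/
theorem exists_rooted : ∃ rp pe rk, I.Rooted rp pe rk := by
  classical
  set r : Fin I.N := ⟨0, I.N_pos⟩ with hr
  have h₁ : ∀ v : Fin I.N, v ≠ r → ∃ (u : Fin I.N) (e : Fin I.E),
      I.G.dist u r < I.G.dist v r ∧ s(I.src e, I.tgt e) = s(v, u) := by
    intro v hv
    obtain ⟨p, hp⟩ := I.isTree.connected.exists_walk_length_eq_dist v r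
    cases p with
    | nil => exact absurd rfl hv
    | @cons _ u _ h p =>
      obtain ⟨e, he⟩ := I.exists_edge h
      refine ⟨u, e, ?_, he⟩
      have := SimpleGraph.dist_le p
      rw [SimpleGraph.Walk.length_cons] at hp
      omega
  choose rp pe hd he using h₁
  have hcard : Fintype.card {v : Fin I.N // v ≠ r} = Fintype.card (Fin I.E) := by
    rw [Fintype.card_subtype_compl]
    have := I.E_add_one
    simp
    omega
  have hinj : Function.Injective fun v : {v : Fin I.N // v ≠ r} => pe v v.2 := by
    rintro ⟨v, hv⟩ ⟨v', hv'⟩ h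
    simp only at h
    have h' := he v' hv'
    rw [← h, he v hv] at h'
    rcases Sym2.eq_iff.1 h' with ⟨h₁, -⟩ | ⟨h₁, h₂⟩
    · exact Subtype.ext h₁
    · have h₃ := hd v hv
      have h₄ := hd v' hv'
      rw [← h₁] at h₄
      rw [h₂] at h₃
      omega
  have hsurj := ((Fintype.bijective_iff_injective_and_card _).2 ⟨hinj, hcard⟩).2
  have hne : ∀ v, 0 < v → ∀ hv : v < I.N, (⟨v, hv⟩ : Fin I.N) ≠ r := by
    intro v h0 hv h
    simp only [hr, Fin.mk.injEq] at h
    omega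
  refine ⟨fun v => if h : 0 < v ∧ v < I.N then (rp ⟨v, h.2⟩ (hne v h.1 h.2) : ℕ) else 0,
    fun v => if h : 0 < v ∧ v < I.N then (pe ⟨v, h.2⟩ (hne v h.1 h.2) : ℕ) else 0,
    fun v => if h : v < I.N then I.G.dist ⟨v, h⟩ r else 0, ?_, ?_, ?_, ?_, ?_, ?_⟩
  · intro v h0 hv; simp [hv, h0]
  · intro v h0 hv; simp [hv, h0]
  · intro v h0 hv; simpa [hv, h0] using hd _ (hne v h0 hv)
  · intro v h0 hv
    simp only [hv, h0, and_self, arrayOf, dif_pos, Fin.is_lt, Fin.eta]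
    rcases Sym2.eq_iff.1 (he _ (hne v h0 hv)) with ⟨h₁, h₂⟩ | ⟨h₁, h₂⟩
    · left; rw [h₁, h₂]; exact ⟨rfl, rfl⟩
    · right; rw [h₁, h₂]; exact ⟨rfl, rfl⟩
  · intro v v' h0 hv h0' hv' h
    simp only [hv, hv', h0, h0', and_self, dif_pos] at h
    have := @hinj ⟨_, hne v h0 hv⟩ ⟨_, hne v' h0' hv'⟩ (Fin.ext h)
    simpa using this
  · intro e he'
    obtain ⟨⟨v, hv⟩, h⟩ := hsurj ⟨e, he'⟩
    have h0 : 0 < (v : ℕ) := Nat.pos_of_ne_zero fun h => hv (Fin.ext h)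
    refine ⟨v, h0, v.2, ?_⟩
    simp only [v.2, h0, and_self, dif_pos, Fin.eta]
    simp only at h
    rw [h]

/-- The vertices are numbered in preorder: vertex `v` has number `pre v`, and `z e` is the number of
the lower end of the edge `e`. -/
structure Numbered (pre par en : ℕ → ℕ) (z : Fin I.E → ℕ) : Prop where
  pre_lt : ∀ v, v < I.N → pre v < I.N
  tree : PreTree I.N par en
  z_pos : ∀ e, 0 < z e
  z_lt : ∀ e, z e < I.N
  z_inj : Function.Injective z
  ends : ∀ e, (pre (I.src e) = z e ∧ pre (I.tgt e) = par (z e)) ∨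
    (pre (I.src e) = par (z e) ∧ pre (I.tgt e) = z e)

namespace Numbered

variable {I} {pre par en : ℕ → ℕ} {z : Fin I.E → ℕ}

/-- The interval of the lower end of `e` has `e` as its only boundary edge: `cut` handles the other
edges, and `par_lt` separates the ends of `e`. This is the hypothesis of `Instance.onPath_iff`. -/
theorem below_tgt_iff (h : I.Numbered pre par en z) (e e' : Fin I.E) :
    ((z e ≤ pre (I.src e') ∧ pre (I.src e') < en (z e)) ↔
      (z e ≤ pre (I.tgt e') ∧ pre (I.tgt e') < en (z e))) ↔ e' ≠ e := by
  have h₁ : ((z e ≤ z e' ∧ z e' < en (z e)) ↔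
      (z e ≤ par (z e') ∧ par (z e') < en (z e))) ↔ e' ≠ e := by
    constructor
    · rintro hc rfl
      have h₂ := h.tree.par_lt _ (h.z_pos e') (h.z_lt e')
      have := hc.1 ⟨le_rfl, h.tree.lt_en _ (h.z_lt _)⟩
      omega
    · intro hne
      exact h.tree.cut _ _ (h.z_pos e') (h.z_lt e') (h.z_lt e) (h.z_inj.ne hne)
  rcases h.ends e' with ⟨h₂, h₃⟩ | ⟨h₂, h₃⟩
  · rw [h₂, h₃, h₁]
  · rw [h₂, h₃, ← h₁]; exact Iff.comm

theorem onPath_iff (h : I.Numbered pre par en z) (e : Fin I.E) (u v : Fin I.N) :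
    I.OnPath e u v ↔ ¬ ((z e ≤ pre u ∧ pre u < en (z e)) ↔ (z e ≤ pre v ∧ pre v < en (z e))) :=
  I.onPath_iff (A := fun x : Fin I.N => z e ≤ pre x ∧ pre x < en (z e)) (h.below_tgt_iff e) u v

/-- An edge is on the path exactly if it is above one of the two vertices but not above both, and p
+ q - 2pq is the indicator of "exactly one". -/
theorem vdist_eq (h : I.Numbered pre par en z) (u v : Fin I.N) :
    I.vdist u v = depth I.len z en (pre u) + depth I.len z en (pre v)
      - 2 * common I.len z en (pre u) (pre v) := by
  classical
  unfold vdist depth common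
  rw [Finset.sum_filter, ← Finset.sum_add_distrib, Finset.mul_sum, ← Finset.sum_sub_distrib]
  refine Finset.sum_congr rfl fun e _ => ?_
  rw [if_congr (h.onPath_iff e u v) rfl rfl]
  by_cases h₁ : z e ≤ pre u ∧ pre u < en (z e) <;>
    by_cases h₂ : z e ≤ pre v ∧ pre v < en (z e) <;>
    simp only [h₁, h₂, not_true_eq_false, not_false_eq_true, if_true, if_false, and_self,
      and_true, and_false, iff_true, iff_false] <;> ring

end Numbered

end Instance

/-! ## Subroutines: binary search and lowest common ancestors -/

attribute [simp] WExp.eval RExp.eval Test.Holds Prog.run write_apply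
attribute [simp] WExp.cost RExp.cost Test.cost Prog.stepBound

infixr:60 " ;; " => Prog.seq

/-- The word in cell `0` of the array `a`. -/
abbrev WExp.var (a : ℕ) : WExp := .cell a (.const 0)

/-- The real number in cell `0` of the array `a`. -/
abbrev RExp.var (a : ℕ) : RExp := .cell a (.const 0)

/-- Set cell `0` of the word array `a`. -/
abbrev Prog.set (a : ℕ) (x : WExp) : Prog := .setWord a (.const 0) x

/-- Set cell `0` of the real array `a`. -/
abbrev Prog.rset (a : ℕ) (x : RExp) : Prog := .setReal a (.const 0) x

/-- Words of `w` bits are large enough for `M` locations. -/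
def Big (w M : ℕ) : Prop := 1000 * ((M + 2) * (M + 2)) ≤ 2 ^ w

theorem Big.const {w M : ℕ} (h : Big w M) {c : ℕ} (hc : c < 1000) : c % 2 ^ w = c := by
  refine Nat.mod_eq_of_lt (hc.trans_le (le_trans ?_ h))
  exact Nat.le_mul_of_pos_right _ (by positivity)

theorem Big.mod {w M : ℕ} (h : Big w M) {c : ℕ} (hc : c < 1000 * (M + 2)) : c % 2 ^ w = c := by
  refine Nat.mod_eq_of_lt (hc.trans_le (le_trans ?_ h))
  rw [← mul_assoc]
  exact Nat.le_mul_of_pos_right _ (by positivity)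

theorem Big.mod_sq {w M : ℕ} (h : Big w M) {c : ℕ} (hc : c < 1000 * ((M + 2) * (M + 2))) :
    c % 2 ^ w = c :=
  Nat.mod_eq_of_lt (hc.trans_le h)

/-- Binary search: writes into `41` the position of the first entry of the sorted array `33` that is
at least the word in `40`. -/
def lowerBound : Prog :=
  (.set 41 (.const 0) ;;
    .set 42 (.cell 0 (.const 3))) ;;
  .loop (.not (.wle (.var 42) (.var 41)))
    (.set 43 (.div (.add (.var 41) (.var 42)) (.const 2)) ;;
     .ite (.wle (.var 40) (.cell 33 (.var 43)))
       (.set 42 (.var 43))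
       (.set 41 (.add (.var 43) (.const 1))))

/-- Invariant: entries before the window are less than `q`, entries from its end on are at least
`q`, and its length is less than `2 ^ m`. Each round lowers `m` by one, and the window is empty when
`m = 0`. -/
theorem lowerBound_runs {w M q lg : ℕ} {K : ℕ → ℕ} {s : Store} (hw : Big w M)
    (hM : s.word 0 3 = M) (hKs : s.word 33 = K) (hK : ∀ i j, i ≤ j → j < M → K i ≤ K j)
    (hq : s.word 40 0 = q) (hlg : M < 2 ^ lg) :
    Runs w lowerBound s (40 * lg + 40) fun s' => IsLowerBound M K q (s'.word 41 0) := by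
  have hc := @hw.const
  refine Runs.mono (Runs.seq
      (Runs.straight (Q := fun s' => s'.word 41 0 = 0 ∧ s'.word 42 0 = M) rfl ?_)
    fun s₂ hs₂ h₂ => Runs.loop (T := 22) (m := lg) (fun m s' => s'.word 41 0 ≤ s'.word 42 0 ∧
      s'.word 42 0 ≤ M ∧ s'.word 42 0 < s'.word 41 0 + 2 ^ m ∧ (∀ j < s'.word 41 0, K j < q) ∧
      ∀ j, s'.word 42 0 ≤ j → j < M → q ≤ K j) ?_ ?_) ?_ ?_
  · simp [hc, hM]
  · rintro m s' hs ⟨h₁, h₂, h₃, h₄, h₅⟩ hb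
    simp only [Test.Holds, WExp.eval, hc (c := 0) (by norm_num), not_le] at hb
    have e33 : s'.word 33 = K := by
      rw [hs.1 33 (by decide), hs₂.1 33 (by decide), hKs]
    have e40 : s'.word 40 0 = q := by
      rw [hs.1 40 (by decide), hs₂.1 40 (by decide), hq]
    generalize hlo : s'.word 41 0 = lo at *
    generalize hhi : s'.word 42 0 = hi at *
    have e1 : (lo + hi) % 2 ^ w = lo + hi := hw.mod (by omega)
    have e2 : ((lo + hi) / 2 + 1) % 2 ^ w = (lo + hi) / 2 + 1 := hw.mod (by omega)
    cases m with
    | zero => omega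
    | succ m =>
      rw [pow_succ] at h₃
      refine Runs.mono (Runs.straight rfl ?_) (by simp) fun s'' _ h => ⟨m, by omega, h⟩
      by_cases h : q ≤ K ((lo + hi) / 2)
      · simp [hc, hlo, hhi, e1, e33, e40, h]
        exact ⟨by omega, by omega, by omega, h₄, fun j hj hj' => h.trans (hK _ _ hj hj')⟩
      · simp [hc, hlo, hhi, e1, e2, e33, e40, h]
        rw [not_le] at h
        exact ⟨by omega, by omega, by omega,
          fun j hj => (hK j _ (by omega) (by omega)).trans_lt h, h₅⟩
  · refine ⟨by omega, h₂.2.le, by omega, by omega, fun j hj hj' => by omega⟩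
  · simp; omega
  · rintro s' - ⟨hb, m, h₁, h₂, h₃, h₄, h₅⟩
    simp [hc] at hb
    exact ⟨by omega, h₄, fun j hj hj' => h₅ j (by omega) hj'⟩

/-- The word expression `x` is odd. -/
abbrev Test.odd (x : WExp) : Test := .wle (.const 1) (.sub x (.mul (.div x (.const 2)) (.const 2)))

/-- Decrease the word in `46` to `T[j]` if that is smaller, where `T` is the array `19`. -/
def relax (j : WExp) : Prog :=
  .ite (.wle (.var 46) (.cell 19 j)) .skip (.set 46 (.cell 19 j))

/-- Lowest common ancestor of the vertices in `44` and `45`, as a range minimum over the array `19`,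
which holds a complete binary tree of minima. The result is written into `46`. -/
def meet : Prog :=
  (.set 46 (.var 44) ;;
    .set 47 (.add (.add (.cell 0 (.const 0)) (.var 44)) (.const 1)) ;;
    .set 48 (.add (.add (.cell 0 (.const 0)) (.var 45)) (.const 1))) ;;
  .loop (.not (.wle (.var 48) (.var 47)))
    (.ite (.odd (.var 47)) (relax (.var 47) ;; .set 47 (.add (.var 47) (.const 1))) .skip ;;
     .ite (.odd (.var 48)) (.set 48 (.sub (.var 48) (.const 1)) ;; relax (.var 48)) .skip ;;
     (.set 47 (.div (.var 47) (.const 2)) ;; .set 48 (.div (.var 48) (.const 2))))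

/-- The array `T` holds a tree of minima over `par 0, …, par (N - 1)`. -/
def IsMinTree (N : ℕ) (par T : ℕ → ℕ) : Prop :=
  (∀ x < N, T (N + x) = par x) ∧ ∀ i, 0 < i → i < N → T i = min (T (2 * i)) (T (2 * i + 1))

theorem Test.holds_odd {w M : ℕ} {s : Store} {x : WExp} (hw : Big w M) (hx : x.eval w s < 2 ^ w) :
    (Test.odd x).Holds w s ↔ x.eval w s % 2 = 1 := by
  have hc := @hw.const
  have : (x.eval w s / 2 * 2) % 2 ^ w = x.eval w s / 2 * 2 :=
    Nat.mod_eq_of_lt (by omega)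
  simp [hc, this]
  omega

theorem meet_runs {w M N u v lg : ℕ} {par T : ℕ → ℕ} {s : Store} (hw : Big w M) (hNM : N ≤ M)
    (hN : s.word 0 0 = N) (hTs : s.word 19 = T) (hT : IsMinTree N par T)
    (hu : s.word 44 0 = u) (hv : s.word 45 0 = v) (huv : u ≤ v) (hvN : v < N) (hlg : M < 2 ^ lg) :
    Runs w meet s (150 * lg + 300) fun s' => IsMeet par u v (s'.word 46 0) := by
  have hc := @hw.const
  have hpow : 1000 * (M + 2) ≤ 2 ^ w := le_trans
    (by rw [← mul_assoc]; exact Nat.le_mul_of_pos_right _ (by positivity)) hw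
  -- The invariant, in terms of lower bounds: the minimum sought is the minimum of the accumulator
  -- `a` and of the tree nodes in `[l, r)`. An odd `l`, or an odd `r` with its last node `r - 1`,
  -- leaves a node whose sibling is outside the range; such nodes are absorbed into `a`. The rest
  -- consists of complete pairs of siblings, which are replaced by their parents. Nothing requires
  -- `N` to be a power of 2.
  let P : ℕ → ℕ → ℕ → Prop := fun l r a => ∀ z, (z ≤ u ∧ ∀ x, u < x → x ≤ v → z ≤ par x) ↔
    (z ≤ a ∧ ∀ i, l ≤ i → i < r → z ≤ T i)
  refine Runs.mono (Runs.seq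
      (Runs.straight (Q := fun s' => s'.word 46 0 = u ∧ s'.word 47 0 = N + u + 1 ∧
        s'.word 48 0 = N + v + 1) rfl ?_)
    fun s₂ hs₂ h₂ => Runs.loop (T := 120) (m := lg + 1) (fun m s' => 0 < s'.word 47 0 ∧
      s'.word 48 0 ≤ 2 * N ∧ s'.word 48 0 < 2 ^ m ∧
      P (s'.word 47 0) (s'.word 48 0) (s'.word 46 0)) ?_ ?_) ?_ ?_
  · simp [hc, hN, hu, hv, hw.mod (c := N + u) (by omega), hw.mod (c := N + v) (by omega),
      hw.mod (c := N + u + 1) (by omega), hw.mod (c := N + v + 1) (by omega)]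
  · rintro m s' hs ⟨h₁, h₂, h₃, h₄⟩ hb
    simp only [Test.Holds, WExp.eval, hc (c := 0) (by norm_num), not_le] at hb
    have e19 : s'.word 19 = T := by
      rw [hs.1 19 (by decide), hs₂.1 19 (by decide), hTs]
    refine Runs.mono (Runs.seq (T₁ := 50) (Q := fun t => t.word 47 0 % 2 = 0 ∧ 0 < t.word 47 0 ∧
        t.word 47 0 ≤ t.word 48 0 ∧ t.word 48 0 = s'.word 48 0 ∧
        P (t.word 47 0) (t.word 48 0) (t.word 46 0)) ?_
      fun t ht h₅ => Runs.seq (T₁ := 50) (Q := fun t' => t'.word 47 0 % 2 = 0 ∧ 0 < t'.word 47 0 ∧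
        t'.word 48 0 % 2 = 0 ∧ t'.word 48 0 ≤ s'.word 48 0 ∧
        P (t'.word 47 0) (t'.word 48 0) (t'.word 46 0)) ?_
      fun t' ht' h₆ => Runs.straight rfl ?_) ?_ fun s'' _ h => h
    · generalize hl : s'.word 47 0 = l at *
      generalize hr : s'.word 48 0 = r at *
      have e1 : (l + 1) % 2 ^ w = l + 1 := hw.mod (by omega)
      refine Runs.mono (Runs.ite (T := 30) ?_ ?_) (by simp) fun _ _ h => h
      · intro ho
        rw [Test.holds_odd hw (by simp [hc, hl]; omega)] at ho
        simp only [WExp.eval, hc (c := 0) (by norm_num), hl] at ho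
        refine Runs.mono (Runs.straight rfl ?_) (by simp [relax]) fun s'' _ h => h
        by_cases ha : s'.word 46 0 ≤ T l
        · simp [relax, hc, hl, hr, e1, e19, ha]
          refine ⟨by omega, by omega, fun z => (h₄ z).trans (and_congr_right fun hz => ?_)⟩
          refine ⟨fun h i hi => h i (by omega), fun h i hi hi' => ?_⟩
          rcases hi.eq_or_lt with rfl | hi
          · omega
          · exact h i hi hi'
        · simp [relax, hc, hl, hr, e1, e19, ha]
          refine ⟨by omega, by omega, fun z => (h₄ z).trans ?_⟩
          refine ⟨fun ⟨_, h⟩ => ⟨h l le_rfl hb, fun i hi => h i (by omega)⟩,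
            fun ⟨hz, h⟩ => ⟨by omega, fun i hi hi' => ?_⟩⟩
          rcases hi.eq_or_lt with rfl | hi
          · omega
          · exact h i hi hi'
      · intro ho
        rw [Test.holds_odd hw (by simp [hc, hl]; omega)] at ho
        simp only [WExp.eval, hc (c := 0) (by norm_num), hl] at ho
        refine Runs.mono (Runs.straight rfl ?_) (by simp) fun s'' _ h => h
        simp [hl, hr]
        exact ⟨by omega, by omega, by omega, h₄⟩
    · obtain ⟨h₅, h₆, h₇, h₈, h₉⟩ := h₅
      have e19' : t.word 19 = T := by rw [ht.1 19 (by decide), e19]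
      rw [← h₈] at h₂ h₃ hb ⊢
      generalize hl : t.word 47 0 = l at *
      generalize hr : t.word 48 0 = r at *
      refine Runs.mono (Runs.ite (T := 30) ?_ ?_) (by simp) fun _ _ h => h
      · intro ho
        rw [Test.holds_odd hw (by simp [hc, hr]; omega)] at ho
        simp only [WExp.eval, hc (c := 0) (by norm_num), hr] at ho
        refine Runs.mono (Runs.straight rfl ?_) (by simp [relax]) fun s'' _ h => h
        -- `l` is even and `r` is odd, so `l < r` and the node `r - 1` belongs to the range.
        by_cases ha : t.word 46 0 ≤ T (r - 1)
        · simp [relax, hc, hl, hr, e19', ha]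
          refine ⟨by omega, by omega, by omega,
            fun z => (h₉ z).trans (and_congr_right fun hz => ?_)⟩
          refine ⟨fun h i hi hi' => h i hi (by omega), fun h i hi hi' => ?_⟩
          rcases (Nat.le_sub_one_of_lt hi').eq_or_lt with rfl | hi'
          · omega
          · exact h i hi hi'
        · simp [relax, hc, hl, hr, e19', ha]
          refine ⟨by omega, by omega, by omega, fun z => (h₉ z).trans ?_⟩
          refine ⟨fun ⟨_, h⟩ => ⟨h (r - 1) (by omega) (by omega),
            fun i hi hi' => h i hi (by omega)⟩, fun ⟨hz, h⟩ => ⟨by omega, fun i hi hi' => ?_⟩⟩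
          rcases (Nat.le_sub_one_of_lt hi').eq_or_lt with rfl | hi'
          · omega
          · exact h i hi hi'
      · intro ho
        rw [Test.holds_odd hw (by simp [hc, hr]; omega)] at ho
        simp only [WExp.eval, hc (c := 0) (by norm_num), hr] at ho
        refine Runs.mono (Runs.straight rfl ?_) (by simp) fun s'' _ h => h
        simp [hl, hr]
        exact ⟨by omega, by omega, by omega, h₉⟩
    · obtain ⟨h₅, h₆, h₇, h₈, h₉⟩ := h₆
      cases m with
      | zero => omega
      | succ m =>
        rw [pow_succ] at h₃
        refine ⟨m, by omega, ?_⟩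
        generalize hl : t'.word 47 0 = l at *
        generalize hr : t'.word 48 0 = r at *
        simp [hc, hl, hr]
        refine ⟨by omega, by omega, by omega,
          fun z => (h₉ z).trans (and_congr_right fun hz => ?_)⟩
        -- Node `i` now stands for the pair `2 * i`, `2 * i + 1`. Since `0 < l` and `r ≤ 2 * N`
        -- before halving, `0 < i < N`, where the recursion for the minima is valid.
        constructor
        · intro h i hi hi'
          rw [hT.2 i (by omega) (by omega)]
          exact le_min (h _ (by omega) (by omega)) (h _ (by omega) (by omega))
        · intro h i hi hi'
          have h' := h (i / 2) (by omega) (by omega)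
          rw [hT.2 (i / 2) (by omega) (by omega), le_min_iff] at h'
          rcases Nat.mod_two_eq_zero_or_one i with hi₂ | hi₂
          · rw [show i = 2 * (i / 2) by omega]; exact h'.1
          · rw [show i = 2 * (i / 2) + 1 by omega]; exact h'.2
    · simp
  · obtain ⟨h₃, h₄, h₅⟩ := h₂
    rw [h₃, h₄, h₅]
    refine ⟨by omega, by omega, by rw [pow_succ]; omega, fun z => and_congr_right fun hz => ?_⟩
    constructor
    · intro h i hi hi'
      rw [show i = N + (i - N) by omega, hT.1 _ (by omega)]
      exact h _ (by omega) (by omega)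
    · intro h x hx hx'
      rw [← hT.1 x (by omega)]
      exact h _ (by omega) (by omega)
  · simp; omega
  · rintro s' - ⟨hb, m, h₁, h₂, h₃, h₄⟩
    simp [hc] at hb
    intro z
    rw [h₄ z]
    exact ⟨fun h => ⟨h, fun i hi hi' => by omega⟩, fun h => h.1⟩

/-! ## The data structure and its main subroutines -/

/-- The contents of the data structure, apart from the prefix and suffix sums. -/
structure Index (I : Instance) where
  pre : ℕ → ℕ
  par : ℕ → ℕ
  en : ℕ → ℕ
  T : ℕ → ℕ
  K : ℕ → ℕ
  z : Fin I.E → ℕ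
  f : ℕ → ℝ
  F : ℕ → ℝ
  D : ℕ → ℝ
  numbered : I.Numbered pre par en z
  minTree : IsMinTree I.N par T
  K_mono : ∀ i j, i ≤ j → j < I.M → K i ≤ K j
  K_lt : ∀ j, j < I.M → K j < I.n * I.N
  F_eq : ∀ j, j ≤ I.M → F j = ∑ i ∈ Finset.range j, f i
  D_eq : ∀ x, x < I.N → D x = depth I.len z en x
  sum_eq : ∀ φ : ℕ → ℝ → ℝ, ∑ k, φ (I.owner k * I.N + pre (I.loc k)) (I.prob k) =
    ∑ t ∈ Finset.range I.M, φ (K t) (f t)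

namespace Index

variable {I : Instance} (g : Index I)

/-- The sum over the locations of the group `b` before position `l`. -/
noncomputable def left (b x l : ℕ) : ℝ := leftSum I.len g.z g.en g.K g.f b x l

/-- The sum over the locations of the group `b` from position `l` on. -/
noncomputable def right (b x l : ℕ) : ℝ := rightSum I.len g.z g.en I.N I.M g.K g.f b x l

/-- The index is stored in the memory. -/
structure Loaded (s : Store) : Prop where
  input : ∀ a, a < 5 → s.word a = I.input.word a
  inputR : ∀ a, a < 3 → s.real a = I.input.real a
  pre : s.word 15 = g.pre
  en : s.word 18 = g.en
  T : s.word 19 = g.T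
  K : s.word 33 = g.K
  D : s.real 10 = g.D
  F : s.real 11 = g.F

variable {g}

theorem Loaded.congr {s s' : Store} (h : g.Loaded s)
    (hw : ∀ a ∈ [0, 1, 2, 3, 4, 15, 18, 19, 33], s'.word a = s.word a)
    (hr : ∀ a ∈ [0, 1, 2, 10, 11], s'.real a = s.real a) : g.Loaded s' where
  input a ha := by rw [hw a (by interval_cases a <;> simp), h.input a ha]
  inputR a ha := by rw [hr a (by interval_cases a <;> simp), h.inputR a ha]
  pre := by rw [hw 15 (by simp), h.pre]
  en := by rw [hw 18 (by simp), h.en]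
  T := by rw [hw 19 (by simp), h.T]
  K := by rw [hw 33 (by simp), h.K]
  D := by rw [hr 10 (by simp), h.D]
  F := by rw [hr 11 (by simp), h.F]

theorem Loaded.same {s s' : Store} {p : Prog} (h : g.Loaded s) (hs : p.Same s s')
    (hw : ∀ a ∈ [0, 1, 2, 3, 4, 15, 18, 19, 33], a ∉ p.wordMods)
    (hr : ∀ a ∈ [0, 1, 2, 10, 11], a ∉ p.realMods) : g.Loaded s' :=
  h.congr (fun a ha => hs.1 a (hw a ha)) fun a ha => hs.2 a (hr a ha)

theorem Loaded.size_N {s : Store} (h : g.Loaded s) : s.word 0 0 = I.N := by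
  rw [h.input 0 (by norm_num)]; rfl

theorem Loaded.size_M {s : Store} (h : g.Loaded s) : s.word 0 3 = I.M := by
  rw [h.input 0 (by norm_num)]; rfl

end Index

/-- Computes in the real array `20` the sum over the locations before the position in `52` of the
group that starts at the word in `50`, for the vertex in `51`. -/
def leftQuery : Prog :=
  .ite (.and (.wle (.const 1) (.var 52))
      (.wle (.var 50) (.cell 33 (.sub (.var 52) (.const 1)))))
    ((.set 44 (.sub (.cell 33 (.sub (.var 52) (.const 1))) (.var 50)) ;;
      .set 45 (.var 51)) ;;
     meet ;;
     .set 40 (.add (.var 50) (.var 46)) ;;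
     lowerBound ;;
     .rset 20 (.add (.cell 13 (.var 41)) (.mul (.cell 10 (.var 46))
       (.sub (.cell 11 (.var 52)) (.cell 11 (.var 41))))))
    (.rset 20 (.const 0))

/-- Computes in the real array `21` the sum over the locations from the position in `52` on of the
group that starts at the word in `50`, for the vertex in `51`. -/
def rightQuery : Prog :=
  .ite (.and (.not (.wle (.cell 0 (.const 3)) (.var 52)))
      (.not (.wle (.add (.var 50) (.cell 0 (.const 0))) (.cell 33 (.var 52)))))
    ((.set 44 (.var 51) ;;
      .set 45 (.sub (.cell 33 (.var 52)) (.var 50))) ;;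
     meet ;;
     .set 40 (.add (.var 50) (.cell 18 (.var 46))) ;;
     lowerBound ;;
     .rset 21 (.add (.cell 14 (.sub (.var 41) (.const 1))) (.mul (.cell 10 (.var 46))
       (.sub (.cell 11 (.var 41)) (.cell 11 (.var 52))))))
    (.rset 21 (.const 0))

section

variable {I : Instance} {g : Index I} {w i b x l lg : ℕ} {s : Store}

theorem group_bounds (hi : i < I.n) (hb : b = i * I.N) : b + I.N ≤ I.M * I.M := by
  have h₁ : (i + 1) * I.N ≤ I.n * I.N := Nat.mul_le_mul_right _ hi
  have h₂ : I.n * I.N ≤ I.M * I.M := Nat.mul_le_mul I.n_le_M I.N_le_M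
  rw [Nat.add_mul] at h₁
  omega

/-- A table entry belongs to the query given by its own key `k`, with group `k / N * N` and vertex
`k % N`; this identifies both for a key in the block that starts at `b`. -/
theorem group_div_mod {k : ℕ} (hb : b = i * I.N) (h₁ : b ≤ k) (h₂ : k < b + I.N) :
    k / I.N * I.N = b ∧ k % I.N = k - b := by
  have h : k / I.N = i := by
    rw [Nat.div_eq_iff I.N_pos, ← hb]
    omega
  refine ⟨by rw [h, hb], ?_⟩
  have := Nat.div_add_mod k I.N
  rw [h, mul_comm, ← hb] at this
  omega

theorem Big.mod_group {c : ℕ} (hw : Big w I.M) (hc : c ≤ I.M * I.M + I.M) : c % 2 ^ w = c := by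
  refine hw.mod_sq (hc.trans_lt ?_)
  nlinarith

/-- The program evaluates the right side of `leftSum_step`. Only table entries before `l` are
assumed correct, so the same statement serves for filling the table and for answering queries. -/
theorem leftQuery_runs (hw : Big w I.M) (hlg : I.M < 2 ^ lg) (hg : g.Loaded s)
    (hs₁ : s.word 50 0 = b) (hs₂ : s.word 51 0 = x) (hs₃ : s.word 52 0 = l)
    (hi : i < I.n) (hb : b = i * I.N) (hx : x < I.N) (hl : l ≤ I.M)
    (hK : ∀ j, j < l → g.K j ≤ b + x)
    (hL : ∀ j, j < l → s.real 13 j = g.left (g.K j / I.N * I.N) (g.K j % I.N) j) :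
    Runs w leftQuery s (200 * lg + 500) fun s' => s'.real 20 0 = g.left b x l := by
  have hc := @hw.const
  have hbN := group_bounds hi hb
  refine Runs.mono (Runs.ite (T := 195 * lg + 450) ?_ ?_) (by simp; omega) fun _ _ h => h
  · rintro ⟨h₁, h₂⟩
    simp [hc, hs₁, hs₃, hg.K] at h₁ h₂
    have hKl := hK (l - 1) (by omega)
    refine Runs.mono (Runs.seq (Runs.straight (Q := fun t => t.word 44 0 = g.K (l - 1) - b ∧
        t.word 45 0 = x) rfl (by simp [hc, hs₁, hs₂, hs₃, hg.K]))
      fun t₁ ht₁ q₁ => Runs.seq (meet_runs hw I.N_le_M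
        (hg.same ht₁ (by decide) (by decide)).size_N
        (hg.same ht₁ (by decide) (by decide)).T g.minTree q₁.1 q₁.2 (by omega) hx hlg)
      fun t₂ ht₂ q₂ => Runs.seq (Runs.straight (Q := fun t => t.word 40 0 = b + t₂.word 46 0 ∧
        t.word 46 0 = t₂.word 46 0) rfl ?_)
      fun t₃ ht₃ q₃ => Runs.seq (lowerBound_runs hw
        (hg.same (((ht₁.mono (q := leftQuery) (by decide) (by decide)).trans
          (ht₂.mono (by decide) (by decide))).trans (ht₃.mono (by decide) (by decide)))
            (by decide) (by decide)).size_M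
        (hg.same (((ht₁.mono (q := leftQuery) (by decide) (by decide)).trans
          (ht₂.mono (by decide) (by decide))).trans (ht₃.mono (by decide) (by decide)))
            (by decide) (by decide)).K g.K_mono q₃.1 hlg)
      fun t₄ ht₄ q₄ => Runs.straight rfl ?_) ?_ fun _ _ h => h
    · have := q₂.le_left
      simp [hc, ht₁.1 50 (by decide), ht₂.1 50 (by decide), hs₁]
      exact hw.mod_group (by omega)
    · have e₁ := ((ht₁.mono (q := leftQuery) (by decide) (by decide)).trans
        (ht₂.mono (by decide) (by decide))).trans ((ht₃.mono (by decide) (by decide)).trans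
          (ht₄.mono (by decide) (by decide)))
      have hg' := hg.same e₁ (by decide) (by decide)
      obtain ⟨htl, hstep⟩ := leftSum_step (f := g.f) (ln := I.len) g.numbered.tree
        g.numbered.z_lt g.K_mono g.F_eq h₁ hl h₂ hKl hx q₂ q₄
      have hal := q₂.le_left
      have ha : t₂.word 46 0 < I.N := by omega
      have hKt := q₄.2.2 _ le_rfl (by omega)
      have hKt' := hK _ htl
      obtain ⟨hd, hm⟩ := group_div_mod (k := g.K (t₄.word 41 0)) hb (by omega) (by omega)
      have hLt := hL _ htl
      rw [hd, hm] at hLt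
      simp [hc, hg'.D, hg'.F, e₁.1 52 (by decide), hs₃, ht₄.1 46 (by decide), q₃.2,
        e₁.2 13 (by decide), hLt]
      rw [g.D_eq _ ha]
      exact hstep.symm
    · simp; omega
  · intro h
    refine Runs.mono (Runs.straight rfl ?_) (by simp) fun _ _ h => h
    simp [hc, hs₁, hs₃, hg.K] at h
    simp [hc, Index.left, leftSum]
    -- If the last key before `l` precedes the block, then by monotonicity so do all the earlier
    -- ones, and the sum is zero; for `l = 0` it is empty.
    refine (Finset.sum_eq_zero fun j hj => if_neg ?_).symm
    rw [Finset.mem_range] at hj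
    have := g.K_mono j (l - 1) (by omega) (by omega)
    have := h (by omega)
    omega

/-- As for `leftQuery_runs`, with `rightSum_step`. The recursion needs the sum from `t` on for the
vertex at position `t - 1`, so the table stores at `j` the sum from `j + 1` on. -/
theorem rightQuery_runs (hw : Big w I.M) (hlg : I.M < 2 ^ lg) (hg : g.Loaded s)
    (hs₁ : s.word 50 0 = b) (hs₂ : s.word 51 0 = x) (hs₃ : s.word 52 0 = l)
    (hi : i < I.n) (hb : b = i * I.N)
    (hK : ∀ j, l ≤ j → j < I.M → b + x ≤ g.K j)
    (hR : ∀ j, l ≤ j → j < I.M →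
      s.real 14 j = g.right (g.K j / I.N * I.N) (g.K j % I.N) (j + 1)) :
    Runs w rightQuery s (200 * lg + 500) fun s' => s'.real 21 0 = g.right b x l := by
  have hc := @hw.const
  have hbN := group_bounds hi hb
  have hbm : (b + I.N) % 2 ^ w = b + I.N := hw.mod_group (by omega)
  refine Runs.mono (Runs.ite (T := 195 * lg + 450) ?_ ?_) (by simp; omega) fun _ _ h => h
  · rintro ⟨h₁, h₂⟩
    simp [hc, hs₁, hs₃, hg.K, hg.size_M, hg.size_N, hbm] at h₁ h₂
    have hKl := hK l le_rfl h₁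
    refine Runs.mono (Runs.seq (Runs.straight (Q := fun t => t.word 44 0 = x ∧
        t.word 45 0 = g.K l - b) rfl (by simp [hc, hs₁, hs₂, hs₃, hg.K]))
      fun t₁ ht₁ q₁ => Runs.seq (meet_runs hw I.N_le_M
        (hg.same ht₁ (by decide) (by decide)).size_N
        (hg.same ht₁ (by decide) (by decide)).T g.minTree q₁.1 q₁.2 (by omega) (by omega) hlg)
      fun t₂ ht₂ q₂ => Runs.seq (Runs.straight (Q := fun t =>
        t.word 40 0 = b + g.en (t₂.word 46 0) ∧ t.word 46 0 = t₂.word 46 0) rfl ?_)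
      fun t₃ ht₃ q₃ => Runs.seq (lowerBound_runs hw
        (hg.same (((ht₁.mono (q := rightQuery) (by decide) (by decide)).trans
          (ht₂.mono (by decide) (by decide))).trans (ht₃.mono (by decide) (by decide)))
            (by decide) (by decide)).size_M
        (hg.same (((ht₁.mono (q := rightQuery) (by decide) (by decide)).trans
          (ht₂.mono (by decide) (by decide))).trans (ht₃.mono (by decide) (by decide)))
            (by decide) (by decide)).K g.K_mono q₃.1 hlg)
      fun t₄ ht₄ q₄ => Runs.straight rfl ?_) ?_ fun _ _ h => h
    · have := q₂.le_left
      have hen := g.numbered.tree.en_le (t₂.word 46 0) (by omega)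
      have e₁ := (ht₁.mono (q := rightQuery) (by decide) (by decide)).trans
        (ht₂.mono (by decide) (by decide))
      simp [hc, e₁.1 50 (by decide), (hg.same e₁ (by decide) (by decide)).en, hs₁]
      exact hw.mod_group (by omega)
    · have e₁ := ((ht₁.mono (q := rightQuery) (by decide) (by decide)).trans
        (ht₂.mono (by decide) (by decide))).trans ((ht₃.mono (by decide) (by decide)).trans
          (ht₄.mono (by decide) (by decide)))
      have hg' := hg.same e₁ (by decide) (by decide)
      obtain ⟨htl, hstep⟩ := rightSum_step (f := g.f) (ln := I.len) g.numbered.tree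
        g.numbered.z_lt g.K_mono g.F_eq h₁ h₂ hKl q₂ q₄
      have hal := q₂.le_left
      have ha : t₂.word 46 0 < I.N := by omega
      have hen := g.numbered.tree.en_le _ ha
      have htM := q₄.1
      have hKt := q₄.2.1 (t₄.word 41 0 - 1) (by omega)
      have hKt' := hK (t₄.word 41 0 - 1) (by omega) (by omega)
      obtain ⟨hd, hm⟩ := group_div_mod (k := g.K (t₄.word 41 0 - 1)) hb (by omega) (by omega)
      have hRt := hR (t₄.word 41 0 - 1) (by omega) (by omega)
      rw [hd, hm, Nat.sub_add_cancel (by omega)] at hRt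
      simp [hc, hg'.D, hg'.F, e₁.1 52 (by decide), hs₃, ht₄.1 46 (by decide), q₃.2,
        e₁.2 14 (by decide), hRt]
      rw [g.D_eq _ ha]
      exact hstep.symm
    · simp; omega
  · intro h
    refine Runs.mono (Runs.straight rfl ?_) (by simp) fun _ _ h => h
    simp [hc, hs₁, hs₃, hg.K, hg.size_M, hg.size_N, hbm] at h
    simp [hc, Index.right, rightSum]
    refine (Finset.sum_eq_zero fun j hj => if_neg ?_).symm
    rw [Finset.mem_Ico] at hj
    have := g.K_mono l j (by omega) (by omega)
    have := h (by omega)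
    omega

end

/-! ## Numbering the vertices in preorder -/

section Numbering

variable {N : ℕ} {rp rk sx pre : ℕ → ℕ}

/-- The intervals of numbers of the subtrees are nested as the subtrees are; `sx u + 1` is the number
of vertices of the subtree of `u`. -/
structure IsNumbering (N : ℕ) (rp rk sx pre : ℕ → ℕ) : Prop where
  rp_lt : ∀ v, 0 < v → v < N → rp v < N
  rk_lt : ∀ v, 0 < v → v < N → rk (rp v) < rk v
  pre_zero : pre 0 = 0
  sx_zero : sx 0 + 1 = N
  child : ∀ u, 0 < u → u < N → pre (rp u) < pre u ∧ pre u + sx u ≤ pre (rp u) + sx (rp u)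
  sibling : ∀ u v, 0 < u → u < N → 0 < v → v < N → u ≠ v → rp u = rp v →
    pre u + sx u < pre v ∨ pre v + sx v < pre u

namespace IsNumbering

/-- The vertex `u` is a child of `z`. -/
def Child (N : ℕ) (rp : ℕ → ℕ) (z u : ℕ) : Prop := 0 < u ∧ u < N ∧ rp u = z

theorem desc_bounds (h : IsNumbering N rp rk sx pre) {z u : ℕ}
    (hd : Relation.ReflTransGen (Child N rp) z u) :
    (z = u ∨ pre z < pre u) ∧ pre u + sx u ≤ pre z + sx z := by
  induction hd with
  | refl => simp
  | @tail b c _ hc ih =>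
    obtain ⟨h₁, h₂, rfl⟩ := hc
    have := h.child c h₁ h₂
    rcases ih with ⟨rfl | h₃, h₄⟩
    · exact ⟨Or.inr this.1, this.2⟩
    · exact ⟨Or.inr (by omega), by omega⟩

theorem desc_zero (h : IsNumbering N rp rk sx pre) :
    ∀ n u, rk u = n → u < N → Relation.ReflTransGen (Child N rp) 0 u := by
  intro n
  induction n using Nat.strong_induction_on with
  | _ n ih =>
    rintro u rfl hu
    rcases Nat.eq_zero_or_pos u with rfl | h0
    · exact .refl
    · exact (ih _ (h.rk_lt u h0 hu) _ rfl (h.rp_lt u h0 hu)).tail ⟨h0, hu, rfl⟩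

/-- Converse of `desc_bounds`, by induction on the rank of `z`. The interval of `z` is inside that
of its parent, so `u` descends from the parent; it cannot do so through a sibling of `z`, because
the intervals of siblings are disjoint. -/
theorem desc_of_mem (h : IsNumbering N rp rk sx pre) :
    ∀ n z u, rk z = n → z < N → u < N → pre z ≤ pre u → pre u ≤ pre z + sx z →
      Relation.ReflTransGen (Child N rp) z u := by
  intro n
  induction n using Nat.strong_induction_on with
  | _ n ih =>
    rintro z u rfl hz hu h₁ h₂
    rcases Nat.eq_zero_or_pos z with rfl | h0
    · exact h.desc_zero _ u rfl hu
    · have hc := h.child z h0 hz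
      have hd := ih _ (h.rk_lt z h0 hz) (rp z) u rfl (h.rp_lt z h0 hz) hu (by omega) (by omega)
      rcases hd.cases_head with heq | ⟨c, ⟨hc₁, hc₂, hc₃⟩, hcd⟩
      · rw [heq] at hc; omega
      · by_cases hcz : c = z
        · rwa [← hcz]
        · have h₃ := h.desc_bounds hcd
          have h₄ := h.sibling c z hc₁ hc₂ h0 hz hcz hc₃
          rcases h₃.1 with h₅ | h₅
          · subst h₅; omega
          · omega

theorem inj (h : IsNumbering N rp rk sx pre) {u v : ℕ} (hu : u < N) (hv : v < N)
    (huv : pre u = pre v) : u = v := by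
  have := (h.desc_bounds (h.desc_of_mem _ u v rfl hu hv huv.le (by omega))).1
  omega

theorem add_lt (h : IsNumbering N rp rk sx pre) {u : ℕ} (hu : u < N) : pre u + sx u < N := by
  have := (h.desc_bounds (h.desc_zero _ u rfl hu)).2
  have := h.pre_zero
  have := h.sx_zero
  omega

theorem surj (h : IsNumbering N rp rk sx pre) {x : ℕ} (hx : x < N) : ∃ u < N, pre u = x := by
  have hf : Function.Injective fun u : Fin N =>
      (⟨pre u, by have := h.add_lt u.2; omega⟩ : Fin N) := by
    intro u v huv
    exact Fin.ext (h.inj u.2 v.2 (by simpa using huv))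
  obtain ⟨u, hu⟩ := Finite.injective_iff_surjective.1 hf ⟨x, hx⟩
  exact ⟨u, u.2, by simpa using hu⟩

theorem cut (h : IsNumbering N rp rk sx pre) {u z : ℕ} (h0 : 0 < u) (hu : u < N) (hz : z < N)
    (huz : u ≠ z) : (pre z ≤ pre u ∧ pre u < pre z + sx z + 1) ↔
      (pre z ≤ pre (rp u) ∧ pre (rp u) < pre z + sx z + 1) := by
  constructor
  · rintro ⟨h₁, h₂⟩
    rcases (h.desc_of_mem _ z u rfl hz hu h₁ (by omega)).cases_tail with heq | ⟨b, hb, hc⟩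
    · exact absurd heq huz
    · rw [hc.2.2]
      have := h.desc_bounds hb
      rcases this.1 with h₅ | h₅
      · subst h₅; omega
      · omega
  · rintro ⟨h₁, h₂⟩
    have hd := (h.desc_of_mem _ z _ rfl hz (h.rp_lt u h0 hu) h₁ (by omega)).tail
      (show Child N rp (rp u) u from ⟨h0, hu, rfl⟩)
    have := h.desc_bounds hd
    omega

theorem preTree (h : IsNumbering N rp rk sx pre) {par en : ℕ → ℕ}
    (hpar : ∀ u, 0 < u → u < N → par (pre u) = pre (rp u))
    (hen : ∀ u, u < N → en (pre u) = pre u + sx u + 1) : PreTree N par en where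
  par_lt w h0 hw := by
    obtain ⟨u, hu, rfl⟩ := h.surj hw
    have h0' : 0 < u := Nat.pos_of_ne_zero fun h' => by rw [h', h.pre_zero] at h0; omega
    rw [hpar u h0' hu]
    exact (h.child u h0' hu).1
  lt_en z hz := by
    obtain ⟨u, hu, rfl⟩ := h.surj hz
    rw [hen u hu]; omega
  en_le z hz := by
    obtain ⟨u, hu, rfl⟩ := h.surj hz
    rw [hen u hu]
    have := h.add_lt hu
    omega
  cut w z h0 hw hz hwz := by
    obtain ⟨u, hu, rfl⟩ := h.surj hw
    obtain ⟨v, hv, rfl⟩ := h.surj hz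
    have h0' : 0 < u := Nat.pos_of_ne_zero fun h' => by rw [h', h.pre_zero] at h0; omega
    rw [hen v hv, hpar u h0' hu]
    exact h.cut h0' hu hv fun h' => hwz (by rw [h'])

end IsNumbering

end Numbering

namespace Instance.Rooted

variable {I : Instance} {rp pe rk sx pre par en : ℕ → ℕ}

/-- The lower end of an edge is the vertex of which it is the parent edge. The last clause makes it
possible to follow lengths along parent edges when the computed depths are verified. -/
theorem exists_numbered (hr : I.Rooted rp pe rk) (h : IsNumbering I.N rp rk sx pre)
    (hpar : ∀ u, 0 < u → u < I.N → par (pre u) = pre (rp u))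
    (hen : ∀ u, u < I.N → en (pre u) = pre u + sx u + 1) :
    ∃ z, I.Numbered pre par en z ∧
      ∀ v, ∀ h0 : 0 < v, ∀ hv : v < I.N, z ⟨pe v, hr.pe_lt v h0 hv⟩ = pre v := by
  choose! ch h₁ h₂ h₃ using hr.pe_surj
  refine ⟨fun e => pre (ch e), ⟨fun v hv => ?_, h.preTree hpar hen, fun e => ?_, fun e => ?_, ?_,
    fun e => ?_⟩, fun v h0 hv => ?_⟩
  · have := h.add_lt hv
    omega
  · have := h.child _ (h₁ e e.2) (h₂ e e.2)
    omega
  · have := h.add_lt (h₂ e e.2)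
    omega
  · intro e e' he
    have := h.inj (h₂ e e.2) (h₂ e' e'.2) he
    rw [Fin.ext_iff, ← h₃ e e.2, ← h₃ e' e'.2, this]
  · have he := hr.ends _ (h₁ e e.2) (h₂ e e.2)
    rw [h₃ e e.2] at he
    simp only [arrayOf, e.2, dif_pos, Fin.eta] at he
    simp only [hpar _ (h₁ e e.2) (h₂ e e.2)]
    rcases he with ⟨h₄, h₅⟩ | ⟨h₄, h₅⟩
    · left; rw [h₄, h₅]; exact ⟨rfl, rfl⟩
    · right; rw [h₄, h₅]; exact ⟨rfl, rfl⟩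
  · have hlt := hr.pe_lt v h0 hv
    simp only
    rw [hr.pe_inj _ _ (h₁ _ hlt) (h₂ _ hlt) h0 hv (h₃ _ hlt)]

end Instance.Rooted

/-- By `cut`, the intervals that contain `z e` and those that contain its parent are the same,
except for the interval of `e` itself. -/
theorem Instance.Numbered.depth_z {I : Instance} {pre par en : ℕ → ℕ} {z : Fin I.E → ℕ}
    (h : I.Numbered pre par en z) (e : Fin I.E) :
    depth I.len z en (z e) = depth I.len z en (par (z e)) + I.len e := by
  classical
  unfold depth
  have : I.len e = ∑ e', if e' = e then I.len e' else 0 := by simp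
  rw [this, ← Finset.sum_add_distrib]
  refine Finset.sum_congr rfl fun e' _ => ?_
  by_cases he : e' = e
  · subst he
    have h₁ := h.tree.par_lt _ (h.z_pos e') (h.z_lt e')
    have h₂ := h.tree.lt_en _ (h.z_lt e')
    rw [if_pos ⟨le_rfl, h₂⟩, if_neg (by omega), if_pos rfl, zero_add]
  · rw [if_congr (h.tree.cut (z e) (z e') (h.z_pos e) (h.z_lt e) (h.z_lt e')
      (h.z_inj.ne (Ne.symm he))) rfl rfl, if_neg he, add_zero]

theorem Instance.Numbered.depth_zero {I : Instance} {pre par en : ℕ → ℕ} {z : Fin I.E → ℕ}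
    (h : I.Numbered pre par en z) : depth I.len z en 0 = 0 := by
  refine Finset.sum_eq_zero fun e _ => if_neg fun h' => ?_
  have := h.z_pos e
  omega

/-! ## Rooting the tree -/

namespace Instance

/-- The input is intact. -/
structure Base (I : Instance) (s : Store) : Prop where
  word : ∀ a, a < 5 → s.word a = I.input.word a
  real : ∀ a, a < 3 → s.real a = I.input.real a

/-- The numbers of the ends of the edges. -/
def srcN (I : Instance) : ℕ → ℕ := arrayOf fun e => (I.src e : ℕ)

/-- The numbers of the other ends of the edges. -/
def tgtN (I : Instance) : ℕ → ℕ := arrayOf fun e => (I.tgt e : ℕ)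

variable {I : Instance}

theorem Base.same {s s' : Store} {p : Prog} (h : I.Base s) (hs : p.Same s s')
    (hw : ∀ a ∈ [0, 1, 2, 3, 4], a ∉ p.wordMods) (hr : ∀ a ∈ [0, 1, 2], a ∉ p.realMods) :
    I.Base s' where
  word a ha := by rw [hs.1 a (hw a (by interval_cases a <;> simp)), h.word a ha]
  real a ha := by rw [hs.2 a (hr a (by interval_cases a <;> simp)), h.real a ha]

theorem Base.size_N {s : Store} (h : I.Base s) : s.word 0 0 = I.N := by
  rw [h.word 0 (by norm_num)]; rfl

theorem Base.size_E {s : Store} (h : I.Base s) : s.word 0 1 = I.E := by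
  rw [h.word 0 (by norm_num)]; rfl

theorem Base.size_n {s : Store} (h : I.Base s) : s.word 0 2 = I.n := by
  rw [h.word 0 (by norm_num)]; rfl

theorem Base.size_M {s : Store} (h : I.Base s) : s.word 0 3 = I.M := by
  rw [h.word 0 (by norm_num)]; rfl

theorem Base.src {s : Store} (h : I.Base s) : s.word 1 = I.srcN := h.word 1 (by norm_num)

theorem Base.tgt {s : Store} (h : I.Base s) : s.word 2 = I.tgtN := h.word 2 (by norm_num)

theorem srcN_ne {e : ℕ} (he : e < I.E) : I.srcN e ≠ I.tgtN e := by
  simp only [srcN, tgtN, arrayOf, he, dif_pos]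
  exact fun h => (I.adj_src_tgt ⟨e, he⟩).ne (Fin.ext h)

theorem E_lt_M : I.E < I.M := by
  have := I.E_add_one
  have := I.N_le_M
  omega

/-- The sum of `g e` over the ends at `v` of the first `i` edges. -/
def ends (I : Instance) (g : ℕ → ℕ) (i v : ℕ) : ℕ :=
  ∑ e ∈ Finset.range i, ((if I.srcN e = v then g e else 0) + (if I.tgtN e = v then g e else 0))

/-- Index the edges by their lower ends: every edge is `pe c` for exactly one `c ≥ 1`, with ends `c`
and `rp c`. The edges at `v` are thus those of its children and its own parent edge. The case `g =
1` gives degrees, `g = id` the sums of edge numbers. -/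
theorem ends_eq {rp pe rk : ℕ → ℕ} (hr : I.Rooted rp pe rk) (g : ℕ → ℕ) {v : ℕ} (hv : v < I.N) :
    I.ends g I.E v = (∑ c ∈ Finset.Ico 1 I.N, if rp c = v then g (pe c) else 0) +
      if v = 0 then 0 else g (pe v) := by
  have h₁ : I.ends g I.E v = ∑ c ∈ Finset.Ico 1 I.N,
      ((if I.srcN (pe c) = v then g (pe c) else 0) +
        (if I.tgtN (pe c) = v then g (pe c) else 0)) := by
    symm
    refine Finset.sum_bij (fun c _ => pe c) ?_ ?_ ?_ ?_
    · intro c hc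
      rw [Finset.mem_Ico] at hc
      exact Finset.mem_range.2 (hr.pe_lt c hc.1 hc.2)
    · intro c hc c' hc' h
      rw [Finset.mem_Ico] at hc hc'
      exact hr.pe_inj c c' hc.1 hc.2 hc'.1 hc'.2 h
    · intro e he
      obtain ⟨c, h0, hc, h⟩ := hr.pe_surj e (Finset.mem_range.1 he)
      exact ⟨c, Finset.mem_Ico.2 ⟨h0, hc⟩, h⟩
    · intro c _; rfl
  have h₂ : (if v = 0 then 0 else g (pe v)) =
      ∑ c ∈ Finset.Ico 1 I.N, if c = v then g (pe c) else 0 := by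
    rw [Finset.sum_ite_eq' (Finset.Ico 1 I.N) v fun c => g (pe c)]
    by_cases h : v = 0
    · simp [h]
    · rw [if_neg h, if_pos (Finset.mem_Ico.2 ⟨by omega, hv⟩)]
  rw [h₁, h₂, ← Finset.sum_add_distrib]
  refine Finset.sum_congr rfl fun c hc => ?_
  rw [Finset.mem_Ico] at hc
  rcases hr.ends c hc.1 hc.2 with ⟨h₃, h₄⟩ | ⟨h₃, h₄⟩
  · rw [srcN, tgtN, h₃, h₄, add_comm]
  · rw [srcN, tgtN, h₃, h₄]

end Instance

/-- Increase a cell of a word array. -/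
abbrev Prog.inc (a : ℕ) (j x : WExp) : Prog := .setWord a j (.add (.cell a j) x)

/-- Computes the degrees of all vertices (plus 2 for the root) in the array `10`, and the sums of the
numbers of the incident edges in the array `11`. -/
def degrees : Prog :=
  (.set 20 (.const 0) ;; .setWord 10 (.const 0) (.const 2)) ;;
  .loop (.not (.wle (.cell 0 (.const 1)) (.var 20)))
    (.inc 10 (.cell 1 (.var 20)) (.const 1) ;;
     .inc 10 (.cell 2 (.var 20)) (.const 1) ;;
     .inc 11 (.cell 1 (.var 20)) (.var 20) ;;
     .inc 11 (.cell 2 (.var 20)) (.var 20) ;;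
     .inc 20 (.const 0) (.const 1))

/-- The bounds `2 + i` and `i * M` in the invariant only serve to exclude overflow. -/
theorem degrees_runs {I : Instance} {w : ℕ} {s : Store} (hw : Big w I.M) (hb : I.Base s)
    (h10 : s.word 10 = fun _ => 0) (h11 : s.word 11 = fun _ => 0) :
    Runs w degrees s (100 * I.M + 100) fun s' =>
      (∀ v, v < I.N → s'.word 10 v = (if v = 0 then 2 else 0) + I.ends (fun _ => 1) I.E v) ∧
      (∀ v, v < I.N → s'.word 11 v = I.ends (fun e => e) I.E v) := by
  have hc := @hw.const
  have hEM := I.E_lt_M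
  refine Runs.mono (Runs.seq
      (Runs.straight (Q := fun t => t.word 20 0 = 0 ∧
        (∀ v, t.word 10 v = if v = 0 then 2 else 0) ∧ ∀ v, t.word 11 v = 0) rfl ?_)
    fun s₁ hs₁ h₁ => Runs.forLoop (T := 60) (n := I.E) (fun i t => t.word 20 0 = i ∧
      (∀ v, t.word 10 v = (if v = 0 then 2 else 0) + I.ends (fun _ => 1) i v) ∧
      (∀ v, t.word 11 v = I.ends (fun e => e) i v) ∧
      (∀ v, t.word 10 v ≤ 2 + i) ∧ ∀ v, t.word 11 v ≤ i * I.M) ?_ ?_ ?_) ?_ ?_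
  · simp [hc, h10, h11, Function.update_apply]
  · refine ⟨h₁.1, by simpa [Instance.ends] using h₁.2.1, by simpa [Instance.ends] using h₁.2.2,
      fun v => ?_, by simpa using h₁.2.2⟩
    rw [h₁.2.1]
    split_ifs <;> omega
  · rintro i t hi hs ⟨h₂, -⟩
    have hb' := (hb.same hs₁ (by decide) (by decide)).same hs (by decide) (by decide)
    simp [hc, h₂, hb'.size_E]
  · rintro i t hi hs ⟨h₂, h₃, h₄, h₅, h₆⟩
    have hb' := (hb.same hs₁ (by decide) (by decide)).same hs (by decide) (by decide)
    refine Runs.mono (Runs.straight rfl ?_) (by simp) fun _ _ h => h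
    have hne := I.srcN_ne hi
    have hiM : i * I.M ≤ I.M * I.M := Nat.mul_le_mul_right _ (by omega)
    have e₁ : (t.word 10 (I.srcN i) + 1) % 2 ^ w = t.word 10 (I.srcN i) + 1 :=
      hw.mod (by have := h₅ (I.srcN i); omega)
    have e₂ : (t.word 10 (I.tgtN i) + 1) % 2 ^ w = t.word 10 (I.tgtN i) + 1 :=
      hw.mod (by have := h₅ (I.tgtN i); omega)
    have e₃ : (t.word 11 (I.srcN i) + i) % 2 ^ w = t.word 11 (I.srcN i) + i :=
      hw.mod_group (by have := h₆ (I.srcN i); omega)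
    have e₄ : (t.word 11 (I.tgtN i) + i) % 2 ^ w = t.word 11 (I.tgtN i) + i :=
      hw.mod_group (by have := h₆ (I.tgtN i); omega)
    have e₅ : (i + 1) % 2 ^ w = i + 1 := hw.mod (by omega)
    simp only [Prog.run, WExp.eval, write_apply, hc (c := 0) (by norm_num),
      hc (c := 1) (by norm_num)]
    simp [h₂, hb'.src, hb'.tgt, e₁, e₃, e₅, Function.update_of_ne hne.symm, e₂, e₄]
    refine ⟨fun v => ?_, fun v => ?_, fun v => ?_, fun v => ?_⟩
    · have h := h₃ v
      simp only [Instance.ends, Finset.sum_range_succ] at h ⊢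
      rcases eq_or_ne v (I.tgtN i) with rfl | h₁
      · rw [Function.update_self, h, if_neg hne, if_pos rfl]; omega
      · rw [Function.update_of_ne h₁, if_neg h₁.symm]
        rcases eq_or_ne v (I.srcN i) with rfl | h₂
        · rw [Function.update_self, h, if_pos rfl]; omega
        · rw [Function.update_of_ne h₂, h, if_neg h₂.symm]; omega
    · have h := h₄ v
      simp only [Instance.ends, Finset.sum_range_succ] at h ⊢
      rcases eq_or_ne v (I.tgtN i) with rfl | h₁
      · rw [Function.update_self, h, if_neg hne, if_pos rfl]; omega
      · rw [Function.update_of_ne h₁, if_neg h₁.symm]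
        rcases eq_or_ne v (I.srcN i) with rfl | h₂
        · rw [Function.update_self, h, if_pos rfl]; omega
        · rw [Function.update_of_ne h₂, h, if_neg h₂.symm]; omega
    · have := h₅ v
      rw [Function.update_apply, Function.update_apply]
      split_ifs with h₁ h₂ <;> subst_vars <;> omega
    · have := h₆ v
      rw [Function.update_apply, Function.update_apply, Nat.add_mul]
      split_ifs with h₁ h₂ <;> subst_vars <;> omega
  · simp; omega
  · rintro t - ⟨-, h₂, h₃, -⟩
    exact ⟨fun v _ => h₂ v, fun v _ => h₃ v⟩

/-! ## Removing leaves one after the other -/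

/-- The state while leaves are removed: `X` is the set of the removed vertices, listed in `ord`; `deg`
holds the numbers of remaining neighbours (plus 2 for the root), `ed` the sums of the numbers of
remaining incident edges, and `sx` the numbers of removed proper descendants. Only the vertex `u` and
the vertices after `v` can be leaves. -/
structure Peel (I : Instance) (rp pe : ℕ → ℕ) (X : Finset ℕ) (cnt v u : ℕ)
    (deg ed sx par ord : ℕ → ℕ) : Prop where
  img : X = (Finset.range cnt).image ord
  inj : ∀ i j, i < cnt → j < cnt → ord i = ord j → i = j
  sub : X ⊆ Finset.Ico 1 I.N
  kids : ∀ j < cnt, ∀ c ∈ Finset.Ico 1 I.N, rp c = ord j → ∃ i < j, ord i = c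
  par_eq : ∀ c ∈ X, par c = rp c
  par_zero : par 0 = 0
  deg_eq : ∀ x < I.N, x ∉ X → deg x =
    (∑ c ∈ Finset.Ico 1 I.N \ X, if rp c = x then 1 else 0) + if x = 0 then 2 else 1
  deg_zero : ∀ x ∈ X, deg x = 0
  ed_eq : ∀ x < I.N, ed x =
    (∑ c ∈ Finset.Ico 1 I.N \ X, if rp c = x then pe c else 0) + if x = 0 then 0 else pe x
  sx_eq : ∀ x < I.N, sx x = ∑ c ∈ X, if rp c = x then sx c + 1 else 0
  total : ∑ x ∈ Finset.range I.N \ X, (sx x + 1) = I.N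
  cur : (v < I.N ∧ u < I.N) ∨ (v = I.N ∧ u = I.N)
  done : ∀ x ≤ v, x < I.N → x ≠ u → deg x ≠ 1

namespace Peel

variable {I : Instance} {rp pe rk : ℕ → ℕ} {X : Finset ℕ} {cnt v u : ℕ}
  {deg ed sx par ord : ℕ → ℕ}

theorem card_eq (h : Peel I rp pe X cnt v u deg ed sx par ord) : X.card = cnt := by
  rw [h.img, Finset.card_image_of_injOn, Finset.card_range]
  intro i hi j hj hij
  exact h.inj i j (by simpa using hi) (by simpa using hj) hij

theorem cnt_lt (h : Peel I rp pe X cnt v u deg ed sx par ord) : cnt < I.N := by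
  have h₁ := Finset.card_le_card h.sub
  rw [h.card_eq, Nat.card_Ico] at h₁
  have := I.N_pos
  omega

theorem kids_mem (h : Peel I rp pe X cnt v u deg ed sx par ord) {c : ℕ}
    (hc : c ∈ Finset.Ico 1 I.N) (hX : rp c ∈ X) : c ∈ X := by
  rw [h.img, Finset.mem_image] at hX
  obtain ⟨j, hj, hjc⟩ := hX
  rw [Finset.mem_range] at hj
  obtain ⟨i, hi, hic⟩ := h.kids j hj c hc hjc.symm
  rw [h.img, Finset.mem_image]
  exact ⟨i, Finset.mem_range.2 (hi.trans hj), hic⟩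

/-- A remaining leaf. -/
theorem leaf (h : Peel I rp pe X cnt v u deg ed sx par ord) (hr : I.Rooted rp pe rk)
    (hu : u < I.N) (hd : deg u = 1) : 0 < u ∧ u ∉ X ∧ ed u = pe u ∧ rp u ∉ X ∧ rp u ≠ u ∧
      ∀ c ∈ Finset.Ico 1 I.N \ X, rp c ≠ u := by
  have hX : u ∉ X := fun hX => by simp [h.deg_zero u hX] at hd
  have h₁ := h.deg_eq u hu hX
  -- Because of its extra `2`, the root never has degree `1` and is never removed.
  have h0 : u ≠ 0 := by
    rintro rfl
    rw [if_pos rfl] at h₁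
    omega
  rw [if_neg h0] at h₁
  have h₂ : ∀ c ∈ Finset.Ico 1 I.N \ X, rp c ≠ u := by
    intro c hc hcu
    have h₃ : ∑ c ∈ Finset.Ico 1 I.N \ X, (if rp c = u then 1 else 0) = 0 := by omega
    have := Finset.sum_eq_zero_iff.1 h₃ c hc
    simp [hcu] at this
  have hpos : 0 < u := by omega
  refine ⟨hpos, hX, ?_, fun hp => hX (h.kids_mem (by simp; omega) hp), fun he => ?_, h₂⟩
  · rw [h.ed_eq u hu, if_neg h0, Finset.sum_eq_zero fun c hc => if_neg (h₂ c hc), zero_add]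
  · have := hr.rk_lt u hpos hu
    rw [he] at this
    omega

/-- Apart from `u`, only the parent changes its degree, so it is the only vertex that can newly
become a leaf behind the scan; this preserves `done` with `rp u` as the exceptional vertex. The
bound on the sizes, needed against overflow, follows from `total`. -/
theorem remove (h : Peel I rp pe X cnt v u deg ed sx par ord) (hr : I.Rooted rp pe rk)
    (hu : u < I.N) (hd : deg u = 1) : sx (rp u) + sx u + 1 < I.N ∧
      Peel I rp pe (insert u X) (cnt + 1) v (rp u)
        (Function.update (Function.update deg u 0) (rp u) (deg (rp u) - 1))
        (Function.update ed (rp u) (ed (rp u) - pe u))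
        (Function.update sx (rp u) (sx (rp u) + sx u + 1))
        (Function.update par u (rp u)) (Function.update ord cnt u) := by
  obtain ⟨h0, hX, -, hpX, hpu, hk⟩ := h.leaf hr hu hd
  have hp := hr.rp_lt u h0 hu
  have huA : u ∈ Finset.Ico 1 I.N \ X := by simp [hX]; omega
  have hord : ∀ i < cnt, Function.update ord cnt u i = ord i := fun i hi =>
    Function.update_of_ne (by omega) _ _
  have hsd : Finset.Ico 1 I.N \ insert u X = (Finset.Ico 1 I.N \ X).erase u := by
    ext c; simp; tauto
  have hsum : ∀ (g : ℕ → ℕ) (x : ℕ), (∑ c ∈ Finset.Ico 1 I.N \ X, if rp c = x then g c else 0) =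
      (if rp u = x then g u else 0) +
        ∑ c ∈ Finset.Ico 1 I.N \ insert u X, if rp c = x then g c else 0 := fun g x => by
    rw [hsd, Finset.add_sum_erase _ (fun c => if rp c = x then g c else 0) huA]
  -- Isolate the terms of `u` and `rp u` in `total`: the removal transfers the size `sx u + 1` from
  -- the first to the second.
  have hR : ∃ R, Finset.range I.N \ X = insert u (insert (rp u) R) ∧ u ∉ insert (rp u) R ∧
      rp u ∉ R := by
    refine ⟨((Finset.range I.N \ X).erase u).erase (rp u), ?_, ?_, by simp⟩
    · rw [Finset.insert_erase, Finset.insert_erase] <;> simp [*]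
    · simp [hpu.symm]
  obtain ⟨R, hR, huR, hpR⟩ := hR
  have hR' : Finset.range I.N \ insert u X = insert (rp u) R := by
    have : Finset.range I.N \ insert u X = (Finset.range I.N \ X).erase u := by
      ext c; simp; tauto
    rw [this, hR, Finset.erase_insert huR]
  have htot := h.total
  rw [hR, Finset.sum_insert huR, Finset.sum_insert hpR] at htot
  refine ⟨by omega, ?_, ?_, ?_, ?_, ?_, ?_, ?_, ?_, ?_, ?_, ?_, ?_, ?_⟩
  · rw [Finset.range_add_one, Finset.image_insert, Function.update_self, h.img]
    congr 1
    exact Finset.image_congr fun i hi => (hord i (by simpa using hi)).symm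
  · have hlt : ∀ i < cnt, ord i ≠ u := fun i hi he => hX (by
      rw [h.img, Finset.mem_image]; exact ⟨i, Finset.mem_range.2 hi, he⟩)
    intro i j hi hj hij
    rcases Nat.lt_succ_iff_lt_or_eq.1 hi with hi | rfl <;>
      rcases Nat.lt_succ_iff_lt_or_eq.1 hj with hj | rfl
    · rw [hord i hi, hord j hj] at hij
      exact h.inj i j hi hj hij
    · rw [hord i hi, Function.update_self] at hij
      exact absurd hij (hlt i hi)
    · rw [hord j hj, Function.update_self] at hij
      exact absurd hij.symm (hlt j hj)
    · rfl
  · refine Finset.insert_subset ?_ h.sub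
    simp; omega
  · intro j hj c hc hcj
    rcases Nat.lt_succ_iff_lt_or_eq.1 hj with hj | rfl
    · rw [hord j hj] at hcj
      obtain ⟨i, hi, hic⟩ := h.kids j hj c hc hcj
      exact ⟨i, hi, by rw [hord i (by omega), hic]⟩
    · rw [Function.update_self] at hcj
      have hcX : c ∈ X := by
        by_contra hcX
        exact hk c (Finset.mem_sdiff.2 ⟨hc, hcX⟩) hcj
      rw [h.img, Finset.mem_image] at hcX
      obtain ⟨i, hi, hic⟩ := hcX
      rw [Finset.mem_range] at hi
      exact ⟨i, hi, by rw [hord i hi, hic]⟩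
  · intro c hc
    rcases eq_or_ne c u with rfl | hcu
    · rw [Function.update_self]
    · rw [Function.update_of_ne hcu]
      exact h.par_eq c (Finset.mem_of_mem_insert_of_ne hc hcu)
  · rw [Function.update_of_ne (by omega), h.par_zero]
  · intro x hx hxX
    rw [Finset.mem_insert, not_or] at hxX
    have h₁ := h.deg_eq x hx hxX.2
    rw [hsum (fun _ => 1)] at h₁
    rcases eq_or_ne x (rp u) with rfl | hxp
    · rw [Function.update_self, h₁, if_pos rfl]; omega
    · rw [Function.update_of_ne hxp, Function.update_of_ne hxX.1, h₁, if_neg hxp.symm, zero_add]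
  · intro x hx
    rw [Finset.mem_insert] at hx
    rcases hx with rfl | hx
    · rw [Function.update_of_ne hpu.symm, Function.update_self]
    · rw [Function.update_of_ne (ne_of_mem_of_not_mem hx hpX),
        Function.update_of_ne (ne_of_mem_of_not_mem hx hX)]
      exact h.deg_zero x hx
  · intro x hx
    have h₁ := h.ed_eq x hx
    rw [hsum pe] at h₁
    rcases eq_or_ne x (rp u) with rfl | hxp
    · rw [Function.update_self, h₁, if_pos rfl]; omega
    · rw [Function.update_of_ne hxp, h₁, if_neg hxp.symm, zero_add]
  · intro x hx
    have h₁ : ∀ c ∈ X, Function.update sx (rp u) (sx (rp u) + sx u + 1) c = sx c := fun c hc =>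
      Function.update_of_ne (ne_of_mem_of_not_mem hc hpX) _ _
    rw [Finset.sum_insert hX, Function.update_of_ne hpu.symm,
      Finset.sum_congr rfl fun c hc => by rw [h₁ c hc], ← h.sx_eq x hx]
    rcases eq_or_ne x (rp u) with rfl | hxp
    · rw [Function.update_self, if_pos rfl]; omega
    · rw [Function.update_of_ne hxp, if_neg hxp.symm, zero_add]
  · rw [hR', Finset.sum_insert hpR, Function.update_self, Finset.sum_congr rfl fun x hx => by
      rw [Function.update_of_ne (ne_of_mem_of_not_mem hx hpR)]]
    omega
  · rcases h.cur with ⟨h₁, h₂⟩ | ⟨h₁, h₂⟩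
    · exact Or.inl ⟨h₁, hp⟩
    · omega
  · intro x hxv hx hxp
    rw [Function.update_of_ne hxp]
    rcases eq_or_ne x u with rfl | hxu
    · rw [Function.update_self]; omega
    · rw [Function.update_of_ne hxu]
      exact h.done x hxv hx hxu

theorem advance (h : Peel I rp pe X cnt v u deg ed sx par ord) (hv : v < I.N) (hd : deg u ≠ 1) :
    Peel I rp pe X cnt (v + 1) (v + 1) deg ed sx par ord :=
  { h with
    cur := by omega
    done := fun x hx hxN hxv => by
      rcases eq_or_ne x u with rfl | hxu
      · exact hd
      · exact h.done x (by omega) hxN hxu }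

/-- A remaining vertex of maximal rank other than the root has no remaining child, hence degree `1`;
this contradicts `done` at the end of the scan. -/
theorem complete (h : Peel I rp pe X cnt I.N u deg ed sx par ord) (hr : I.Rooted rp pe rk) :
    X = Finset.Ico 1 I.N := by
  refine Finset.Subset.antisymm h.sub ?_
  by_contra hcon
  obtain ⟨c₀, hc₀, hc₀X⟩ := Finset.not_subset.1 hcon
  obtain ⟨c, hc, hmax⟩ := Finset.exists_max_image (Finset.Ico 1 I.N \ X) rk
    ⟨c₀, Finset.mem_sdiff.2 ⟨hc₀, hc₀X⟩⟩
  rw [Finset.mem_sdiff, Finset.mem_Ico] at hc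
  have h₁ := h.deg_eq c hc.1.2 hc.2
  have hu : u = I.N := by rcases h.cur with h | h <;> omega
  rw [if_neg (by omega), Finset.sum_eq_zero, zero_add] at h₁
  · exact h.done c hc.1.2.le hc.1.2 (by omega) h₁
  · intro d hd
    refine if_neg fun hdc => ?_
    have h₂ := hmax d hd
    rw [Finset.mem_sdiff, Finset.mem_Ico] at hd
    have h₃ := hr.rk_lt d hd.1.1 hd.1.2
    rw [hdc] at h₃
    omega

end Peel

/-- Removes the leaves other than the root `0` one after the other. -/
def peel : Prog :=
  (.set 21 (.const 0) ;; .set 22 (.const 0) ;; .set 23 (.const 0)) ;;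
  .loop (.not (.wle (.cell 0 (.const 0)) (.var 22)))
    (.ite (.and (.wle (.cell 10 (.var 23)) (.const 1)) (.wle (.const 1) (.cell 10 (.var 23))))
      (.set 24 (.cell 11 (.var 23)) ;;
       .set 25 (.sub (.add (.cell 1 (.var 24)) (.cell 2 (.var 24))) (.var 23)) ;;
       .setWord 13 (.var 23) (.var 25) ;;
       .setWord 14 (.var 21) (.var 23) ;;
       .inc 21 (.const 0) (.const 1) ;;
       .setWord 10 (.var 23) (.const 0) ;;
       .setWord 10 (.var 25) (.sub (.cell 10 (.var 25)) (.const 1)) ;;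
       .setWord 11 (.var 25) (.sub (.cell 11 (.var 25)) (.var 24)) ;;
       .setWord 12 (.var 25) (.add (.add (.cell 12 (.var 25)) (.cell 12 (.var 23))) (.const 1)) ;;
       .set 23 (.var 25))
      (.inc 22 (.const 0) (.const 1) ;; .set 23 (.var 22)))

/-- Every round removes a leaf or advances the scan, and at most `N` rounds do either, so the number
of rounds left is bounded by `2 * N` minus the removed and the scanned vertices. After a removal the
parent is examined at once, which makes a single scan sufficient. The parent of a leaf is the sum of
the two ends of its last edge minus the leaf. -/
theorem peel_runs {I : Instance} {w : ℕ} {s : Store} {rp pe rk : ℕ → ℕ} (hr : I.Rooted rp pe rk)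
    (hw : Big w I.M) (hb : I.Base s)
    (h10 : ∀ v, v < I.N → s.word 10 v = (if v = 0 then 2 else 0) + I.ends (fun _ => 1) I.E v)
    (h11 : ∀ v, v < I.N → s.word 11 v = I.ends (fun e => e) I.E v)
    (h12 : s.word 12 = fun _ => 0) (h13 : s.word 13 = fun _ => 0) :
    Runs w peel s (300 * I.M + 100) fun s' => ∃ u, Peel I rp pe (Finset.Ico 1 I.N) (s'.word 21 0)
      I.N u (s'.word 10) (s'.word 11) (s'.word 12) (s'.word 13) (s'.word 14) := by
  have hc := @hw.const
  have hNM := I.N_le_M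
  have hN := I.N_pos
  refine Runs.mono (Runs.seq
      (Runs.straight (Q := fun t => t.word 21 0 = 0 ∧ t.word 22 0 = 0 ∧ t.word 23 0 = 0) rfl ?_)
    fun s₁ hs₁ h₁ => Runs.loop (T := 100) (m := 2 * I.N) (fun m t => m + t.word 21 0 + t.word 22 0
      = 2 * I.N ∧ ∃ X, Peel I rp pe X (t.word 21 0) (t.word 22 0) (t.word 23 0)
        (t.word 10) (t.word 11) (t.word 12) (t.word 13) (t.word 14)) ?_ ?_) ?_ ?_
  · simp [hc]
  · rintro m t hs ⟨h₂, X, h₃⟩ hbt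
    have hb' := (hb.same hs₁ (by decide) (by decide)).same hs (by decide) (by decide)
    simp [hc, hb'.size_N] at hbt
    generalize hcnt : t.word 21 0 = cnt at *
    generalize hv : t.word 22 0 = v at *
    generalize hu : t.word 23 0 = u at *
    have huN : u < I.N := by rcases h₃.cur with h | h <;> omega
    have hcn := h₃.cnt_lt
    refine Runs.mono (Runs.ite (T := 80) ?_ ?_) (by simp) fun _ _ h => h
    · intro hd
      have hd : t.word 10 u = 1 := by
        simp [hc, hu] at hd; omega
      refine Runs.mono (Runs.straight rfl ?_) (by simp) fun _ _ h => h
      obtain ⟨h0, hX, he, hpX, hpu, -⟩ := h₃.leaf hr huN hd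
      obtain ⟨hlt, h₄⟩ := h₃.remove hr huN hd
      have hp := hr.rp_lt u h0 huN
      have hst : I.srcN (pe u) + I.tgtN (pe u) = u + rp u := by
        rcases hr.ends u h0 huN with ⟨h₅, h₆⟩ | ⟨h₅, h₆⟩
        · rw [Instance.srcN, Instance.tgtN, h₅, h₆]
        · rw [Instance.srcN, Instance.tgtN, h₅, h₆, add_comm]
      have e₁ : (u + rp u) % 2 ^ w = u + rp u := hw.mod (by omega)
      have e₂ : (cnt + 1) % 2 ^ w = cnt + 1 := hw.mod (by omega)
      have e₃ : (t.word 12 (rp u) + t.word 12 u) % 2 ^ w = t.word 12 (rp u) + t.word 12 u :=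
        hw.mod (by omega)
      have e₄ : (t.word 12 (rp u) + t.word 12 u + 1) % 2 ^ w = t.word 12 (rp u) + t.word 12 u + 1 :=
        hw.mod (by omega)
      refine ⟨m - 1, by omega, ?_, insert u X, ?_⟩
      · simp [hc, hcnt, hv, e₂]; omega
      -- The program reads the degree of `rp u` after it has cleared that of `u`.
      · rw [Function.update_of_ne hpu (0 : ℕ) (t.word 10) |>.symm] at h₄
        simpa [hc, hcnt, hv, hu, e₂, he, hb'.src, hb'.tgt, hst, e₁, e₃, e₄, hpu] using h₄
    · intro hd
      have hd : t.word 10 u ≠ 1 := by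
        intro h
        simp [hc, hu, h] at hd
      refine Runs.mono (Runs.straight rfl ?_) (by simp) fun _ _ h => h
      have e₁ : (v + 1) % 2 ^ w = v + 1 := hw.mod (by omega)
      refine ⟨m - 1, by omega, ?_, X, ?_⟩
      · simp [hc, hcnt, hv, e₁]; omega
      · simpa [hc, hcnt, hv, e₁] using h₃.advance hbt hd
  · obtain ⟨e₁, e₂, e₃⟩ := h₁
    refine ⟨by omega, ∅, ?_⟩
    rw [e₁, e₂, e₃, hs₁.1 10 (by decide), hs₁.1 11 (by decide), hs₁.1 12 (by decide),
      hs₁.1 13 (by decide), h12, h13]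
    refine ⟨by simp, by simp, by simp, by simp, by simp, rfl, fun x hx _ => ?_, by simp,
      fun x hx => ?_, by simp, by simp, Or.inl ⟨hN, hN⟩, by omega⟩
    · rw [h10 x hx, Instance.ends_eq hr _ hx, Finset.sdiff_empty]
      split_ifs <;> omega
    · rw [h11 x hx, Instance.ends_eq hr _ hx, Finset.sdiff_empty]
  · simp; omega
  · rintro t hs ⟨hbt, m, h₂, X, h₃⟩
    have hb' := hb.same hs (by decide) (by decide)
    simp [hc, hb'.size_N] at hbt
    have hv : t.word 22 0 = I.N := by rcases h₃.cur with h | h <;> omega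
    rw [hv] at h₃
    have := h₃.complete hr
    subst this
    exact ⟨_, h₃⟩

/-! ### Preorder numbers and depths from the order of removal -/

/-- The state while the vertices in `Y` are numbered: `pos x` is the number of the vertices that
precede the next child of `x` in the subtree of `x`, without `x`; `dv` holds the depths. -/
structure Numbering (I : Instance) (rp pe sx : ℕ → ℕ) (Y : Finset ℕ) (pre pos : ℕ → ℕ)
    (dv : ℕ → ℝ) : Prop where
  pre_zero : pre 0 = 0
  dv_zero : dv 0 = 0
  sub : Y ⊆ Finset.Ico 1 I.N
  closed : ∀ c ∈ Y, rp c = 0 ∨ rp c ∈ Y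
  pos_eq : ∀ x < I.N, pos x = ∑ c ∈ Y, if rp c = x then sx c + 1 else 0
  bound : ∀ x, x = 0 ∨ x ∈ Y → pre x + sx x < I.N
  child : ∀ c ∈ Y, pre (rp c) < pre c ∧ pre c + sx c ≤ pre (rp c) + pos (rp c)
  sibling : ∀ c ∈ Y, ∀ d ∈ Y, c ≠ d → rp c = rp d →
    pre c + sx c < pre d ∨ pre d + sx d < pre c
  dv_eq : ∀ c ∈ Y, dv c = dv (rp c) + arrayOf I.len (pe c)

/-- The children of a vertex receive consecutive intervals after its own number, of lengths `sx c +
1`, in the order in which they are processed. The new interval fits into that of the parent because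
`pos (rp u) + sx u + 1` is a partial sum of `sx (rp u)`. No numbered vertex is a child of `u`, since
the numbered set is closed under parents. -/
theorem Numbering.step {I : Instance} {rp pe rk sx : ℕ → ℕ} {Y : Finset ℕ} {pre pos : ℕ → ℕ}
    {dv : ℕ → ℝ} (h : Numbering I rp pe sx Y pre pos dv) (hr : I.Rooted rp pe rk)
    (hsx : ∀ x < I.N, sx x = ∑ c ∈ Finset.Ico 1 I.N, if rp c = x then sx c + 1 else 0)
    {u : ℕ} (h0 : 0 < u) (hu : u < I.N) (huY : u ∉ Y) (hp : rp u = 0 ∨ rp u ∈ Y) :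
    pre (rp u) + pos (rp u) + sx u + 1 < I.N ∧
    Numbering I rp pe sx (insert u Y) (Function.update pre u (pre (rp u) + pos (rp u) + 1))
      (Function.update pos (rp u) (pos (rp u) + sx u + 1))
      (Function.update dv u (dv (rp u) + arrayOf I.len (pe u))) := by
  have hpN := hr.rp_lt u h0 hu
  have hpu : rp u ≠ u := fun he => by
    have := hr.rk_lt u h0 hu
    rw [he] at this
    omega
  have hsub : insert u Y ⊆ Finset.Ico 1 I.N :=
    Finset.insert_subset (Finset.mem_Ico.2 ⟨h0, hu⟩) h.sub
  have h₁ : pos (rp u) + sx u + 1 ≤ sx (rp u) := by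
    rw [hsx _ hpN]
    refine le_trans ?_ (Finset.sum_le_sum_of_subset hsub)
    rw [Finset.sum_insert huY, if_pos rfl, ← h.pos_eq _ hpN]
    omega
  have h₂ := h.bound _ hp
  have hcu : ∀ c ∈ Y, rp c ≠ u := fun c hc he => by
    rcases h.closed c hc with h₃ | h₃
    · omega
    · exact huY (he ▸ h₃)
  have hpre : ∀ x, x ≠ u → Function.update pre u (pre (rp u) + pos (rp u) + 1) x = pre x :=
    fun x hx => Function.update_of_ne hx _ _
  have hdv : ∀ x, x ≠ u → Function.update dv u (dv (rp u) + arrayOf I.len (pe u)) x = dv x :=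
    fun x hx => Function.update_of_ne hx _ _
  have hY : ∀ c ∈ Y, c ≠ u := fun c hc => ne_of_mem_of_not_mem hc huY
  have hsib : ∀ c ∈ Y, rp c = rp u → pre c + sx c < pre (rp u) + pos (rp u) + 1 := by
    intro c hc hcu
    have := (h.child c hc).2
    rw [hcu] at this
    omega
  refine ⟨by omega, ?_, ?_, hsub, ?_, ?_, ?_, ?_, ?_, ?_⟩
  · rw [hpre 0 (by omega), h.pre_zero]
  · rw [hdv 0 (by omega), h.dv_zero]
  · intro c hc
    rcases Finset.mem_insert.1 hc with rfl | hc
    · exact hp.imp_right fun h => Finset.mem_insert_of_mem h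
    · exact (h.closed c hc).imp_right fun h => Finset.mem_insert_of_mem h
  · intro x hx
    rw [Finset.sum_insert huY, ← h.pos_eq x hx]
    rcases eq_or_ne x (rp u) with rfl | hxp
    · rw [Function.update_self, if_pos rfl]; omega
    · rw [Function.update_of_ne hxp, if_neg hxp.symm, zero_add]
  · intro x hx
    rcases eq_or_ne x u with rfl | hxu
    · rw [Function.update_self]; omega
    · rw [hpre x hxu]
      exact h.bound x (hx.imp_right fun h => Finset.mem_of_mem_insert_of_ne h hxu)
  · intro c hc
    rcases Finset.mem_insert.1 hc with rfl | hc
    · rw [Function.update_self, hpre _ hpu, Function.update_self]; omega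
    · rw [hpre _ (hY c hc), hpre _ (hcu c hc)]
      have := h.child c hc
      rcases eq_or_ne (rp c) (rp u) with he | he
      · rw [he] at this ⊢
        rw [Function.update_self]; omega
      · rwa [Function.update_of_ne he]
  · intro c hc d hd hcd he
    rcases Finset.mem_insert.1 hc with rfl | hc' <;> rcases Finset.mem_insert.1 hd with rfl | hd'
    · exact absurd rfl hcd
    · rw [Function.update_self, hpre _ (hY d hd')]
      have := hsib d hd' he.symm
      omega
    · rw [Function.update_self, hpre _ (hY c hc')]
      have := hsib c hc' he
      omega
    · rw [hpre _ (hY c hc'), hpre _ (hY d hd')]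
      exact h.sibling c hc' d hd' hcd he
  · intro c hc
    rcases Finset.mem_insert.1 hc with rfl | hc
    · rw [Function.update_self, hdv _ hpu]
    · rw [hdv _ (hY c hc), hdv _ (hcu c hc), h.dv_eq c hc]

theorem Numbering.isNumbering {I : Instance} {rp pe rk sx : ℕ → ℕ} {pre pos : ℕ → ℕ}
    {dv : ℕ → ℝ} (h : Numbering I rp pe sx (Finset.Ico 1 I.N) pre pos dv) (hr : I.Rooted rp pe rk)
    (hsx : ∀ x < I.N, sx x = ∑ c ∈ Finset.Ico 1 I.N, if rp c = x then sx c + 1 else 0)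
    (hsx0 : sx 0 + 1 = I.N) : IsNumbering I.N rp rk sx pre where
  rp_lt := hr.rp_lt
  rk_lt := hr.rk_lt
  pre_zero := h.pre_zero
  sx_zero := hsx0
  child u h0 hu := by
    have h₁ := h.child u (Finset.mem_Ico.2 ⟨h0, hu⟩)
    rwa [h.pos_eq _ (hr.rp_lt u h0 hu), ← hsx _ (hr.rp_lt u h0 hu)] at h₁
  sibling u v h0 hu h0' hv huv he :=
    h.sibling u (Finset.mem_Ico.2 ⟨h0, hu⟩) v (Finset.mem_Ico.2 ⟨h0', hv⟩) huv he

theorem Peel.sx_zero {I : Instance} {rp pe : ℕ → ℕ} {cnt v u : ℕ} {deg ed sx par ord : ℕ → ℕ}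
    (h : Peel I rp pe (Finset.Ico 1 I.N) cnt v u deg ed sx par ord) : sx 0 + 1 = I.N := by
  have h₁ := h.total
  have h₂ : Finset.range I.N \ Finset.Ico 1 I.N = {0} := by
    have := I.N_pos
    ext x; simp; omega
  rwa [h₂, Finset.sum_singleton] at h₁

/-- Numbers the vertices in preorder and computes their depths. -/
def number : Prog :=
  .loop (.wle (.const 1) (.var 21))
    (.set 21 (.sub (.var 21) (.const 1)) ;;
     .set 23 (.cell 14 (.var 21)) ;;
     .set 25 (.cell 13 (.var 23)) ;;
     .setWord 15 (.var 23) (.add (.add (.cell 15 (.var 25)) (.cell 16 (.var 25))) (.const 1)) ;;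
     .setWord 16 (.var 25) (.add (.add (.cell 16 (.var 25)) (.cell 12 (.var 23))) (.const 1)) ;;
     .setReal 9 (.var 23) (.add (.cell 9 (.var 25)) (.cell 0 (.cell 11 (.var 23)))))

theorem number_runs {I : Instance} {w cnt v : ℕ} {s : Store} {rp pe rk : ℕ → ℕ}
    {deg ed sx par ord : ℕ → ℕ}
    (hr : I.Rooted rp pe rk) (hw : Big w I.M) (hb : I.Base s)
    (hp : Peel I rp pe (Finset.Ico 1 I.N) cnt I.N v deg ed sx par ord)
    (h21 : s.word 21 0 = cnt) (h11 : s.word 11 = ed) (h12 : s.word 12 = sx)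
    (h13 : s.word 13 = par) (h14 : s.word 14 = ord)
    (h15 : s.word 15 = fun _ => 0) (h16 : s.word 16 = fun _ => 0) (h9 : s.real 9 = fun _ => 0) :
    Runs w number s (100 * I.M + 100) fun s' => ∃ pos,
      Numbering I rp pe sx (Finset.Ico 1 I.N) (s'.word 15) pos (s'.real 9) := by
  have hc := @hw.const
  have hNM := I.N_le_M
  have hN := I.N_pos
  have hcn := hp.cnt_lt
  have hsx0 := hp.sx_zero
  refine Runs.mono (Runs.forLoop (T := 60) (n := cnt) (fun i t => t.word 21 0 = cnt - i ∧
      Numbering I rp pe sx ((Finset.Ico (cnt - i) cnt).image ord)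
        (t.word 15) (t.word 16) (t.real 9)) ?_ ?_ ?_) ?_ ?_
  · refine ⟨by rw [h21]; rfl, ?_⟩
    rw [h15, h16, h9]
    refine ⟨rfl, rfl, by simp, by simp, by simp, ?_, by simp, by simp, by simp⟩
    simp; omega
  · rintro i t hi hs ⟨h₁, -⟩
    simp [hc, h₁]; omega
  · rintro i t hi hs ⟨h₁, h₂⟩
    have hb' := hb.same hs (by decide) (by decide)
    refine Runs.mono (Runs.straight rfl ?_) (by simp) fun _ _ h => h
    have hj : cnt - i - 1 < cnt := by omega
    rw [show cnt - (i + 1) = cnt - i - 1 by omega]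
    generalize hjj : cnt - i - 1 = j at *
    rw [show cnt - i = j + 1 by omega] at h₁ h₂
    set u := ord j with hu
    have huI : u ∈ Finset.Ico 1 I.N := by
      rw [hp.img]; exact Finset.mem_image_of_mem _ (Finset.mem_range.2 hj)
    have huI' := Finset.mem_Ico.1 huI
    have huY : u ∉ (Finset.Ico (j + 1) cnt).image ord := by
      rw [Finset.mem_image]
      rintro ⟨k, hk, hk'⟩
      rw [Finset.mem_Ico] at hk
      have := hp.inj k j hk.2 hj hk'
      omega
    -- By `kids`, `u` was removed before its parent, so in the reversed order the parent has already
    -- been numbered.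
    have hpY : rp u = 0 ∨ rp u ∈ (Finset.Ico (j + 1) cnt).image ord := by
      rcases Nat.eq_zero_or_pos (rp u) with h | h
      · exact Or.inl h
      · right
        have h₃ : rp u ∈ Finset.Ico 1 I.N := Finset.mem_Ico.2 ⟨h, hr.rp_lt u huI'.1 huI'.2⟩
        rw [hp.img, Finset.mem_image] at h₃
        obtain ⟨k, hk, hk'⟩ := h₃
        rw [Finset.mem_range] at hk
        obtain ⟨l, hl, hl'⟩ := hp.kids k hk u huI hk'.symm
        have := hp.inj l j (by omega) hj hl'
        rw [Finset.mem_image]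
        exact ⟨k, Finset.mem_Ico.2 ⟨by omega, hk⟩, hk'⟩
    obtain ⟨hlt, h₃⟩ := h₂.step hr hp.sx_eq huI'.1 huI'.2 huY hpY
    have himg : (Finset.Ico j cnt).image ord = insert u ((Finset.Ico (j + 1) cnt).image ord) := by
      rw [← Finset.insert_Ico_succ_left_eq_Ico hj, Finset.image_insert]
      rfl
    have hed : ed u = pe u := by
      rw [hp.ed_eq u huI'.2, if_neg (by omega)]
      simp
    have e₁ : (t.word 15 (rp u) + t.word 16 (rp u)) % 2 ^ w = t.word 15 (rp u) + t.word 16 (rp u) :=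
      hw.mod (by omega)
    have e₂ : (t.word 15 (rp u) + t.word 16 (rp u) + 1) % 2 ^ w
      = t.word 15 (rp u) + t.word 16 (rp u) + 1 := hw.mod (by omega)
    have e₃ : (t.word 16 (rp u) + sx u) % 2 ^ w = t.word 16 (rp u) + sx u := hw.mod (by omega)
    have e₄ : (t.word 16 (rp u) + sx u + 1) % 2 ^ w = t.word 16 (rp u) + sx u + 1 :=
      hw.mod (by omega)
    have hlen : t.real 0 = arrayOf I.len := hb'.real 0 (by norm_num)
    rw [himg]
    simp [hc, h₁, hs.1 14 (by decide), hs.1 13 (by decide), hs.1 12 (by decide),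
      hs.1 11 (by decide), h11, h12, h13, h14, ← hu, hp.par_eq u huI, e₁, e₂, e₃, e₄, hed, hlen]
    exact h₃
  · simp; omega
  · rintro t hs ⟨-, h₁⟩
    refine ⟨t.word 16, ?_⟩
    rw [Nat.sub_self, ← Finset.range_eq_Ico, ← hp.img] at h₁
    exact h₁

/-- Copies the data of every vertex to the cell with its preorder number. -/
def relabel : Prog :=
  .set 22 (.const 0) ;;
  .loop (.not (.wle (.cell 0 (.const 0)) (.var 22)))
    (.setWord 18 (.cell 15 (.var 22))
      (.add (.add (.cell 15 (.var 22)) (.cell 12 (.var 22))) (.const 1)) ;;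
     .setWord 19 (.add (.cell 0 (.const 0)) (.cell 15 (.var 22))) (.cell 15 (.cell 13 (.var 22))) ;;
     .setReal 10 (.cell 15 (.var 22)) (.cell 9 (.var 22)) ;;
     .inc 22 (.const 0) (.const 1))

theorem relabel_runs {I : Instance} {w : ℕ} {s : Store} {rp rk sx pre par : ℕ → ℕ} {dv : ℕ → ℝ}
    (hw : Big w I.M) (hb : I.Base s) (hn : IsNumbering I.N rp rk sx pre)
    (h12 : s.word 12 = sx) (h13 : s.word 13 = par) (h15 : s.word 15 = pre) (h9 : s.real 9 = dv) :
    Runs w relabel s (100 * I.M + 100) fun s' => ∀ v, v < I.N →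
      s'.word 18 (pre v) = pre v + sx v + 1 ∧ s'.word 19 (I.N + pre v) = pre (par v) ∧
      s'.real 10 (pre v) = dv v := by
  have hc := @hw.const
  have hNM := I.N_le_M
  refine Runs.mono (Runs.seq
      (Runs.straight (Q := fun t => t.word 22 0 = 0) rfl ?_)
    fun s₁ hs₁ h₁ => Runs.forLoop (T := 60) (n := I.N) (fun i t => t.word 22 0 = i ∧ ∀ v, v < i →
      t.word 18 (pre v) = pre v + sx v + 1 ∧ t.word 19 (I.N + pre v) = pre (par v) ∧
      t.real 10 (pre v) = dv v) ?_ ?_ ?_) ?_ ?_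
  · simp [hc]
  · exact ⟨h₁, by simp⟩
  · rintro i t hi hs ⟨h₂, -⟩
    have hb' := (hb.same hs₁ (by decide) (by decide)).same hs (by decide) (by decide)
    simp [hc, h₂, hb'.size_N]
  · rintro i t hi hs ⟨h₂, h₃⟩
    have hb' := (hb.same hs₁ (by decide) (by decide)).same hs (by decide) (by decide)
    refine Runs.mono (Runs.straight rfl ?_) (by simp) fun _ _ h => h
    have hlt := hn.add_lt hi
    have e₁ : (pre i + sx i) % 2 ^ w = pre i + sx i := hw.mod (by omega)
    have e₂ : (pre i + sx i + 1) % 2 ^ w = pre i + sx i + 1 := hw.mod (by omega)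
    have e₃ : (I.N + pre i) % 2 ^ w = I.N + pre i := hw.mod (by omega)
    have e₄ : (i + 1) % 2 ^ w = i + 1 := hw.mod (by omega)
    simp [hc, h₂, hs.1 15 (by decide), hs.1 13 (by decide), hs.1 12 (by decide),
      hs.2 9 (by decide), hs₁.1 15 (by decide), hs₁.1 13 (by decide), hs₁.1 12 (by decide),
      hs₁.2 9 (by decide), h12, h13, h15, h9, hb'.size_N, e₁, e₂, e₃, e₄]
    intro v hv
    rcases hv.lt_or_eq with hv | rfl
    · have hne : pre v ≠ pre i := fun h => by
        have := hn.inj (by omega) hi h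
        omega
      rw [Function.update_of_ne hne, Function.update_of_ne (by omega), Function.update_of_ne hne]
      exact h₃ v hv
    · simp
  · simp; omega
  · rintro t hs ⟨-, h₂⟩
    exact h₂

/-- Builds the tree of minima over the array `19`. -/
def minTree : Prog :=
  .set 20 (.cell 0 (.const 0)) ;;
  .loop (.wle (.const 2) (.var 20))
    (.set 20 (.sub (.var 20) (.const 1)) ;;
     .ite (.wle (.cell 19 (.mul (.const 2) (.var 20)))
         (.cell 19 (.add (.mul (.const 2) (.var 20)) (.const 1))))
       (.setWord 19 (.var 20) (.cell 19 (.mul (.const 2) (.var 20))))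
       (.setWord 19 (.var 20) (.cell 19 (.add (.mul (.const 2) (.var 20)) (.const 1)))))

theorem minTree_runs {I : Instance} {w : ℕ} {s : Store} (hw : Big w I.M) (hb : I.Base s) :
    Runs w minTree s (100 * I.M + 100) fun s' =>
      IsMinTree I.N (fun x => s.word 19 (I.N + x)) (s'.word 19) := by
  have hc := @hw.const
  have hNM := I.N_le_M
  have hN := I.N_pos
  refine Runs.mono (Runs.seq
      (Runs.straight (Q := fun t => t.word 20 0 = I.N) rfl ?_)
    fun s₁ hs₁ h₁ => Runs.forLoop (T := 60) (n := I.N - 1) (fun i t => t.word 20 0 = I.N - i ∧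
      (∀ x, t.word 19 (I.N + x) = s.word 19 (I.N + x)) ∧ ∀ j, I.N - i ≤ j → j < I.N →
      t.word 19 j = min (t.word 19 (2 * j)) (t.word 19 (2 * j + 1))) ?_ ?_ ?_) ?_ ?_
  · simp [hc, hb.size_N]
  · refine ⟨h₁, fun x => by rw [hs₁.1 19 (by decide)], fun j hj hj' => by omega⟩
  · rintro i t hi hs ⟨h₂, -⟩
    simp [hc, h₂]; omega
  · rintro i t hi hs ⟨h₂, h₃, h₄⟩
    refine Runs.mono (Runs.straight rfl ?_) (by simp) fun _ _ h => h
    generalize hj : I.N - i = k at *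
    have e₁ : (2 * (k - 1)) % 2 ^ w = 2 * (k - 1) := hw.mod (by omega)
    have e₂ : (2 * (k - 1) + 1) % 2 ^ w = 2 * (k - 1) + 1 := hw.mod (by omega)
    rw [show I.N - (i + 1) = k - 1 by omega]
    -- The cells are filled downwards. For `j ≥ k - 1 ≥ 1` the cells `2 * j` and `2 * j + 1` are
    -- beyond `k - 1`, so writing the cell `k - 1` spoils no minimum already in place.
    have key : ∀ T : ℕ → ℕ, T = Function.update (t.word 19) (k - 1)
        (min (t.word 19 (2 * (k - 1))) (t.word 19 (2 * (k - 1) + 1))) →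
        (∀ x, T (I.N + x) = s.word 19 (I.N + x)) ∧ ∀ j, k - 1 ≤ j → j < I.N →
          T j = min (T (2 * j)) (T (2 * j + 1)) := by
      rintro T rfl
      refine ⟨fun x => by rw [Function.update_of_ne (by omega), h₃], fun j hj hj' => ?_⟩
      rw [Function.update_of_ne (a := 2 * j) (by omega),
        Function.update_of_ne (a := 2 * j + 1) (by omega)]
      rcases hj.eq_or_lt with rfl | hj
      · rw [Function.update_self]
      · rw [Function.update_of_ne (by omega)]
        exact h₄ j (by omega) hj'
    by_cases hle : t.word 19 (2 * (k - 1)) ≤ t.word 19 (2 * (k - 1) + 1)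
    · simp only [min_eq_left hle] at key
      simpa [hc, h₂, e₁, e₂, hle] using key
    · simp only [min_eq_right (not_le.1 hle).le] at key
      simpa [hc, h₂, e₁, e₂, hle] using key
  · simp; omega
  · rintro t hs ⟨-, h₂, h₃⟩
    exact ⟨fun x _ => h₂ x, fun j hj hj' => h₃ j (by omega) hj'⟩

/-- Roots the tree, numbers its vertices, and prepares the search for lowest common ancestors. -/
def buildTree : Prog := degrees ;; peel ;; number ;; relabel ;; minTree

theorem buildTree_runs {I : Instance} {w : ℕ} (hw : Big w I.M) :
    Runs w buildTree I.input (700 * I.M + 500) fun s => ∃ par z,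
      I.Numbered (s.word 15) par (s.word 18) z ∧ IsMinTree I.N par (s.word 19) ∧
      ∀ x, x < I.N → s.real 10 x = depth I.len z (s.word 18) x := by
  obtain ⟨rp, pe, rk, hr⟩ := I.exists_rooted
  have hb : I.Base I.input := ⟨fun _ _ => rfl, fun _ _ => rfl⟩
  refine Runs.mono (Runs.seq (T₂ := 600 * I.M + 400) (degrees_runs hw hb rfl rfl) fun s₁ hs₁ h₁ =>
    Runs.mono (Runs.seq (T₂ := 300 * I.M + 300) (peel_runs hr hw (hb.same hs₁ (by decide) (by decide))
      h₁.1 h₁.2 (hs₁.1 12 (by decide)) (hs₁.1 13 (by decide))) fun s₂ hs₂ h₂ => ?_)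
      (by omega) fun _ _ h => h) (by omega) fun _ _ h => h
  · have hb₂ := (hb.same hs₁ (by decide) (by decide)).same hs₂ (by decide) (by decide)
    obtain ⟨u, h₂⟩ := h₂
    refine Runs.mono (Runs.seq (T₂ := 200 * I.M + 200) (number_runs hr hw hb₂ h₂ rfl rfl rfl rfl rfl
        ((hs₂.1 15 (by decide)).trans (hs₁.1 15 (by decide)))
        ((hs₂.1 16 (by decide)).trans (hs₁.1 16 (by decide)))
        ((hs₂.2 9 (by decide)).trans (hs₁.2 9 (by decide)))) fun s₃ hs₃ h₃ => ?_)
      (by omega) fun _ _ h => h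
    obtain ⟨pos, h₃⟩ := h₃
    have hn := h₃.isNumbering hr h₂.sx_eq h₂.sx_zero
    refine Runs.mono (Runs.seq (relabel_runs hw (hb₂.same hs₃ (by decide) (by decide)) hn
      (hs₃.1 12 (by decide)) (hs₃.1 13 (by decide)) rfl rfl) fun s₄ hs₄ h₄ =>
      Runs.mono (minTree_runs hw ((hb₂.same hs₃ (by decide) (by decide)).same hs₄ (by decide)
        (by decide))) le_rfl fun s₅ hs₅ h₅ => ?_) (by omega) fun _ _ h => h
    have h15 : s₅.word 15 = s₃.word 15 := (hs₅.1 15 (by decide)).trans (hs₄.1 15 (by decide))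
    have h18 : s₅.word 18 = s₄.word 18 := hs₅.1 18 (by decide)
    obtain ⟨z, hz, hz'⟩ := hr.exists_numbered hn (par := fun x => s₄.word 19 (I.N + x))
      (en := s₄.word 18)
      (fun u h0 hu => by
        rw [(h₄ u hu).2.1, h₂.par_eq u (Finset.mem_Ico.2 ⟨h0, hu⟩)])
      (fun u hu => (h₄ u hu).1)
    refine ⟨_, z, by rw [h15, h18]; exact hz, h₅, ?_⟩
    -- The real array `9` accumulates lengths along parent edges; induction on the rank with
    -- `depth_z` identifies the result with the depth.
    have key : ∀ n u, rk u = n → u < I.N →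
        s₃.real 9 u = depth I.len z (s₄.word 18) (s₃.word 15 u) := by
      intro n
      induction n using Nat.strong_induction_on with
      | _ n ih =>
        rintro u rfl hu
        rcases Nat.eq_zero_or_pos u with rfl | h0
        · rw [h₃.dv_zero, h₃.pre_zero, hz.depth_zero]
        · have h₆ := hz.depth_z ⟨pe u, hr.pe_lt u h0 hu⟩
          rw [hz' u h0 hu] at h₆
          simp only [(h₄ u hu).2.1, h₂.par_eq u (Finset.mem_Ico.2 ⟨h0, hu⟩)] at h₆
          rw [h₆, ← ih _ (hr.rk_lt u h0 hu) _ rfl (hr.rp_lt u h0 hu),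
            h₃.dv_eq u (Finset.mem_Ico.2 ⟨h0, hu⟩), arrayOf, dif_pos (hr.pe_lt u h0 hu)]
    intro x hx
    obtain ⟨u, hu, rfl⟩ := hn.surj hx
    rw [h18, ← key _ u rfl hu, ← (h₄ u hu).2.2, hs₅.2 10 (by decide)]

/-! ## Sorting the locations -/

theorem map_range_update {α : Type} (f : ℕ → α) (m k : ℕ) (v : α) (h : m ≤ k) :
    (List.range m).map (Function.update f k v) = (List.range m).map f :=
  List.map_congr_left fun i hi => Function.update_of_ne (by rw [List.mem_range] at hi; omega) _ _

theorem map_range_succ_update {α : Type} (f : ℕ → α) (m : ℕ) (v : α) :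
    (List.range (m + 1)).map (Function.update f m v) = (List.range m).map f ++ [v] := by
  rw [List.range_succ, List.map_append, map_range_update _ _ _ _ le_rfl]
  simp

/-- One round of radix sort: a stable partition of the array `27` by one binary digit of the keys,
the one that belongs to the power of `2` in `29`. -/
def radixPass : Prog :=
  (.set 20 (.const 0) ;; .set 21 (.const 0) ;; .set 22 (.const 0)) ;;
  .loop (.not (.wle (.cell 0 (.const 3)) (.var 20)))
    (.ite (.odd (.div (.cell 26 (.cell 27 (.var 20))) (.var 29)))
      (.setWord 28 (.var 22) (.cell 27 (.var 20)) ;; .inc 22 (.const 0) (.const 1) ;;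
        .inc 20 (.const 0) (.const 1))
      (.setWord 27 (.var 21) (.cell 27 (.var 20)) ;; .inc 21 (.const 0) (.const 1) ;;
        .inc 20 (.const 0) (.const 1))) ;;
  .set 20 (.const 0) ;;
  .loop (.not (.wle (.var 22) (.var 20)))
    (.setWord 27 (.add (.var 21) (.var 20)) (.cell 28 (.var 20)) ;; .inc 20 (.const 0) (.const 1))

/-- Entries with digit `0` are packed in place, at positions that never overtake the reading
position, so the unread part stays intact; entries with digit `1` are set aside in the array `28`
and appended at the end. Stability is expressed by the two filters, which keep the order of the
list. -/
theorem radixPass_runs {w M p : ℕ} {s : Store} {key A : ℕ → ℕ} (hw : Big w M)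
    (hM : s.word 0 3 = M) (hkey : s.word 26 = key) (hA : s.word 27 = A) (hp : s.word 29 0 = p)
    (hlt : ∀ t, t < M → key (A t) < 2 ^ w) :
    Runs w radixPass s (200 * M + 100) fun s' => (List.range M).map (s'.word 27) =
      ((List.range M).map A).filter (fun k => key k / p % 2 = 0) ++
      ((List.range M).map A).filter (fun k => ¬ key k / p % 2 = 0) := by
  have hc := @hw.const
  refine Runs.mono (Runs.seq
      (Runs.straight (Q := fun t => t.word 20 0 = 0 ∧ t.word 21 0 = 0 ∧ t.word 22 0 = 0) rfl ?_)
    fun s₁ hs₁ h₁ => Runs.seq (Runs.forLoop (T := 60) (n := M) (fun i t => t.word 20 0 = i ∧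
        t.word 21 0 + t.word 22 0 = i ∧ (∀ j, i ≤ j → t.word 27 j = A j) ∧
        (List.range (t.word 21 0)).map (t.word 27) =
          ((List.range i).map A).filter (fun k => key k / p % 2 = 0) ∧
        (List.range (t.word 22 0)).map (t.word 28) =
          ((List.range i).map A).filter (fun k => ¬ key k / p % 2 = 0)) ?_ ?_ ?_)
    fun s₂ hs₂ h₂ => Runs.seq
      (Runs.straight (Q := fun t => t.word 20 0 = 0 ∧ t.word 21 0 = s₂.word 21 0) rfl ?_)
    fun s₃ hs₃ h₃ => Runs.mono (Runs.forLoop (T := 30) (n := s₂.word 22 0) (fun i t =>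
      t.word 20 0 = i ∧ (List.range (s₂.word 21 0 + i)).map (t.word 27) =
          ((List.range M).map A).filter (fun k => key k / p % 2 = 0) ++
          (List.range i).map (s₂.word 28)) ?_ ?_ ?_) (T' := M * 37 + 7) ?_ ?_) ?_ fun _ _ h => h
  · simp [hc]
  · obtain ⟨h₁, h₂, h₃⟩ := h₁
    simp [h₁, h₂, h₃, hs₁.1 27 (by decide), hA]
  · rintro i t hi hs ⟨h₂, -⟩
    simp [hc, h₂, hs.1 0 (by decide), hs₁.1 0 (by decide), hM]
  · rintro i t hi hs ⟨h₂, h₃, h₄, h₅, h₆⟩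
    have e26 : t.word 26 = key := by rw [hs.1 26 (by decide), hs₁.1 26 (by decide), hkey]
    have e29 : t.word 29 0 = p := by rw [hs.1 29 (by decide), hs₁.1 29 (by decide), hp]
    have eA := h₄ i le_rfl
    have e₁ : (i + 1) % 2 ^ w = i + 1 := hw.mod (by omega)
    generalize h21 : t.word 21 0 = j at *
    generalize h22 : t.word 22 0 = c at *
    have e₂ : (j + 1) % 2 ^ w = j + 1 := hw.mod (by omega)
    have e₃ : (c + 1) % 2 ^ w = c + 1 := hw.mod (by omega)
    have hodd := Test.holds_odd (w := w) (s := t)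
      (x := .div (.cell 26 (.cell 27 (.var 20))) (.var 29)) hw (by
        simp [hc, h₂, eA, e26, e29]
        exact (Nat.div_le_self _ _).trans_lt (hlt i hi))
    rw [show (WExp.div (.cell 26 (.cell 27 (.var 20))) (.var 29)).eval w t = key (A i) / p by
      simp [hc, h₂, eA, e26, e29]] at hodd
    rw [List.range_succ, List.map_append, List.filter_append, List.filter_append]
    refine Runs.mono (Runs.ite (T := 30) ?_ ?_) (by simp) fun _ _ h => h
    · intro hd
      rw [hodd] at hd
      refine Runs.mono (Runs.straight rfl ?_) (by simp) fun _ _ h => h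
      simp [hc, h₂, h21, h22, eA, e₁, e₃, hd, map_range_succ_update]
      simp at h₅ h₆
      exact ⟨by omega, fun k hk => h₄ k (by omega), h₅, h₆⟩
    · intro hd
      rw [hodd] at hd
      have hd : key (A i) / p % 2 = 0 := by omega
      refine Runs.mono (Runs.straight rfl ?_) (by simp) fun _ _ h => h
      simp [hc, h₂, h21, h22, eA, e₁, e₂, hd, map_range_succ_update]
      simp at h₅ h₆
      refine ⟨by omega, fun k hk => ?_, h₅, h₆⟩
      rw [Function.update_of_ne (by omega)]
      exact h₄ k (by omega)
  · simp [hc]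
  · obtain ⟨h₄, h₅⟩ := h₃
    refine ⟨h₄, ?_⟩
    rw [Nat.add_zero, hs₃.1 27 (by decide), h₂.2.2.2.1]
    simp
  · rintro i t hi hs ⟨h₄, -⟩
    simp [hc, h₄, hs.1 22 (by decide), hs₃.1 22 (by decide)]
  · rintro i t hi hs ⟨h₄, h₅⟩
    have h₆ := h₂.2.1
    refine Runs.mono (Runs.straight rfl ?_) (by simp) fun _ _ h => h
    have e21 : t.word 21 0 = s₂.word 21 0 := by rw [hs.1 21 (by decide), h₃.2]
    have e28 : t.word 28 = s₂.word 28 := by rw [hs.1 28 (by decide), hs₃.1 28 (by decide)]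
    have e₁ : (i + 1) % 2 ^ w = i + 1 := hw.mod (by omega)
    have e₂ : (s₂.word 21 0 + i) % 2 ^ w = s₂.word 21 0 + i := hw.mod (by omega)
    rw [← Nat.add_assoc, List.range_succ (n := i), List.map_append, ← List.append_assoc, ← h₅]
    simp [hc, h₄, e21, e28, e₁, e₂, map_range_succ_update]
  · have := Nat.mul_le_mul_right 37 (show s₂.word 22 0 ≤ M by have := h₂.2.1; omega)
    simp; omega
  · rintro t - ⟨-, h₄⟩
    rw [h₂.2.1, h₂.2.2.2.2] at h₄
    exact h₄
  · simp; omega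

/-- Sorts the array `27` by the keys in the array `26`. -/
def radixSort : Prog :=
  .set 29 (.const 1) ;;
  .loop (.wle (.var 29) (.mul (.cell 0 (.const 2)) (.cell 0 (.const 0))))
    (radixPass ;; .set 29 (.add (.var 29) (.var 29)))

theorem mod_two_mul (k p : ℕ) : k % (2 * p) = k % p + p * (k / p % 2) := by
  rw [mul_comm 2 p, Nat.mod_mul]

/-- The residue modulo `2 * p` is the residue modulo `p`, plus `p` if the next binary digit is `1`.
Within each part the old order persists, and across the parts residues below `p` precede those that
are at least `p`. -/
theorem radix_pairwise {key : ℕ → ℕ} {p : ℕ} {l : List ℕ} (hp : 0 < p)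
    (h : l.Pairwise fun a b => key a % p ≤ key b % p) :
    (l.filter (fun k => key k / p % 2 = 0) ++ l.filter (fun k => ¬ key k / p % 2 = 0)).Pairwise
      fun a b => key a % (2 * p) ≤ key b % (2 * p) := by
  have h₁ : ∀ a, key a / p % 2 = 0 → key a % (2 * p) = key a % p := fun a ha => by
    rw [mod_two_mul, ha]; simp
  have h₂ : ∀ a, ¬ key a / p % 2 = 0 → key a % (2 * p) = key a % p + p := fun a ha => by
    rw [mod_two_mul, show key a / p % 2 = 1 by omega]; simp
  rw [List.pairwise_append]
  refine ⟨?_, ?_, ?_⟩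
  · refine (List.Pairwise.filter _ h).imp_of_mem fun {a b} ha hb hab => ?_
    rw [List.mem_filter] at ha hb
    rwa [h₁ a (by simpa using ha.2), h₁ b (by simpa using hb.2)]
  · refine (List.Pairwise.filter _ h).imp_of_mem fun {a b} ha hb hab => ?_
    rw [List.mem_filter] at ha hb
    rw [h₂ a (by simpa using ha.2), h₂ b (by simpa using hb.2)]
    omega
  · intro a ha b hb
    rw [List.mem_filter] at ha hb
    rw [h₁ a (by simpa using ha.2), h₂ b (by simpa using hb.2)]
    have := Nat.mod_lt (key a) hp
    omega

/-- Since n * N ≤ M ^ 2 < 2 ^ (2 * lg), at most `2 * lg` passes occur. The loop ends with a power of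
2 above all the keys, and modulo that power the keys are unchanged. -/
theorem radixSort_runs {I : Instance} {w lg : ℕ} {s : Store} {key : ℕ → ℕ} (hw : Big w I.M)
    (hlg : I.M < 2 ^ lg) (hb : I.Base s) (hkey : s.word 26 = key)
    (hA : ∀ k, k < I.M → s.word 27 k = k) (hlt : ∀ k, k < I.M → key k < I.n * I.N) :
    Runs w radixSort s (1000 * (I.M * lg) + 100) fun s' =>
      ((List.range I.M).map (s'.word 27)).Perm (List.range I.M) ∧
      ((List.range I.M).map (s'.word 27)).Pairwise fun a b => key a ≤ key b := by
  have hc := @hw.const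
  have hnN : I.n * I.N ≤ I.M * I.M := Nat.mul_le_mul I.n_le_M I.N_le_M
  have hM := I.M_pos
  have hmul : (I.n * I.N) % 2 ^ w = I.n * I.N := hw.mod_group (by omega)
  have hbig : 1000 * ((I.M + 2) * (I.M + 2)) ≤ 2 ^ w := hw
  have hbig' : I.M * I.M ≤ (I.M + 2) * (I.M + 2) := Nat.mul_le_mul (by omega) (by omega)
  refine Runs.mono (Runs.seq
      (Runs.straight (Q := fun t => t.word 29 0 = 1) rfl ?_)
    fun s₁ hs₁ h₁ => Runs.loop (T := 200 * I.M + 110) (m := 2 * lg) (fun m t =>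
      0 < t.word 29 0 ∧ I.n * I.N < t.word 29 0 * 2 ^ m ∧
      ((List.range I.M).map (t.word 27)).Perm (List.range I.M) ∧
      ((List.range I.M).map (t.word 27)).Pairwise fun a b =>
        key a % t.word 29 0 ≤ key b % t.word 29 0) ?_ ?_) ?_ ?_
  · simp [hc]
  · rintro m t hs ⟨h₂, h₃, h₄, h₅⟩ hbt
    have hb' := (hb.same hs₁ (by decide) (by decide)).same hs (by decide) (by decide)
    simp [hc, hb'.size_n, hb'.size_N, hmul] at hbt
    have hpw : (t.word 29 0 + t.word 29 0) % 2 ^ w = 2 * t.word 29 0 := by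
      rw [← two_mul]
      exact hw.mod_sq (by omega)
    refine Runs.mono (Runs.seq (radixPass_runs hw hb'.size_M
      (by rw [hs.1 26 (by decide), hs₁.1 26 (by decide), hkey]) rfl rfl (fun k hk => ?_))
      fun t' ht' h₆ => Runs.straight rfl ?_) (by simp) fun _ _ h => h
    · have h₇ : t.word 27 k ∈ (List.range I.M).map (t.word 27) :=
        List.mem_map.2 ⟨k, List.mem_range.2 hk, rfl⟩
      have h₈ := hlt _ (List.mem_range.1 (h₄.mem_iff.1 h₇))
      omega
    · cases m with
      | zero => omega
      | succ m =>
        refine ⟨m, by omega, ?_⟩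
        simp [hc, ht'.1 29 (by decide), hpw]
        rw [h₆]
        refine ⟨h₂, by rw [pow_succ] at h₃; linarith, ?_, ?_⟩
        · refine List.Perm.trans ?_ h₄
          simp only [decide_not]
          exact List.filter_append_perm (fun k => decide (key k / t.word 29 0 % 2 = 0)) _
        · exact radix_pairwise h₂ h₅
  · have h27 : (List.range I.M).map (s₁.word 27) = List.range I.M := by
      conv_rhs => rw [← List.map_id (List.range I.M)]
      refine List.map_congr_left fun k hk => ?_
      rw [hs₁.1 27 (by decide), hA k (List.mem_range.1 hk)]
      rfl
    rw [h27, h₁]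
    refine ⟨one_pos, ?_, .refl _, ?_⟩
    · have : I.M * I.M < 2 ^ lg * 2 ^ lg := Nat.mul_lt_mul'' hlg hlg
      rw [one_mul, two_mul, pow_add]
      omega
    · exact List.pairwise_iff_forall_sublist.2 fun _ => by simp [Nat.mod_one]
  · simp
    have : lg ≤ I.M * lg := Nat.le_mul_of_pos_left _ hM
    have e : 2 * lg * (10 + (200 * I.M + 110)) = 400 * (I.M * lg) + 240 * lg := by ring
    nlinarith
  · rintro t hs ⟨hbt, m, h₂, h₃, h₄, h₅⟩
    have hb' := hb.same hs (by decide) (by decide)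
    simp [hc, hb'.size_n, hb'.size_N, hmul] at hbt
    refine ⟨h₄, h₅.imp_of_mem fun {a b} ha hb' hab => ?_⟩
    have ha := hlt _ (List.mem_range.1 (h₄.mem_iff.1 ha))
    have hb' := hlt _ (List.mem_range.1 (h₄.mem_iff.1 hb'))
    rwa [Nat.mod_eq_of_lt (by omega), Nat.mod_eq_of_lt (by omega)] at hab

namespace Instance

/-- The number of the vertex of every location. -/
def locN (I : Instance) : ℕ → ℕ := arrayOf fun k => (I.loc k : ℕ)

/-- The number of the uncertain point of every location. -/
def ownerN (I : Instance) : ℕ → ℕ := arrayOf fun k => (I.owner k : ℕ)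

/-- The probabilities. -/
noncomputable def probN (I : Instance) : ℕ → ℝ := arrayOf I.prob

variable {I : Instance}

theorem locN_lt {k : ℕ} (hk : k < I.M) : I.locN k < I.N := by
  simp [locN, arrayOf, hk]

theorem ownerN_lt {k : ℕ} (hk : k < I.M) : I.ownerN k < I.n := by
  simp [ownerN, arrayOf, hk]

theorem Base.loc {s : Store} (h : I.Base s) : s.word 3 = I.locN := h.word 3 (by norm_num)

theorem Base.owner {s : Store} (h : I.Base s) : s.word 4 = I.ownerN := h.word 4 (by norm_num)

theorem Base.prob {s : Store} (h : I.Base s) : s.real 1 = I.probN := h.real 1 (by norm_num)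

end Instance

/-- Computes the sort keys of the locations. -/
def sortKeys : Prog :=
  .set 20 (.const 0) ;;
  .loop (.not (.wle (.cell 0 (.const 3)) (.var 20)))
    (.setWord 26 (.var 20) (.add (.mul (.cell 4 (.var 20)) (.cell 0 (.const 0)))
      (.cell 15 (.cell 3 (.var 20)))) ;;
     .setWord 27 (.var 20) (.var 20) ;;
     .inc 20 (.const 0) (.const 1))

theorem sortKeys_runs {I : Instance} {w : ℕ} {s : Store} {pre : ℕ → ℕ} (hw : Big w I.M)
    (hb : I.Base s) (h15 : s.word 15 = pre) (hpre : ∀ v, v < I.N → pre v < I.N) :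
    Runs w sortKeys s (100 * I.M + 100) fun s' => ∀ k, k < I.M →
      s'.word 26 k = I.ownerN k * I.N + pre (I.locN k) ∧ s'.word 27 k = k := by
  have hc := @hw.const
  refine Runs.mono (Runs.seq
      (Runs.straight (Q := fun t => t.word 20 0 = 0) rfl ?_)
    fun s₁ hs₁ h₁ => Runs.forLoop (T := 60) (n := I.M) (fun i t => t.word 20 0 = i ∧ ∀ k, k < i →
      t.word 26 k = I.ownerN k * I.N + pre (I.locN k) ∧ t.word 27 k = k) ?_ ?_ ?_) ?_ ?_
  · simp [hc]
  · exact ⟨h₁, by simp⟩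
  · rintro i t hi hs ⟨h₂, -⟩
    have hb' := (hb.same hs₁ (by decide) (by decide)).same hs (by decide) (by decide)
    simp [hc, h₂, hb'.size_M]
  · rintro i t hi hs ⟨h₂, h₃⟩
    have hb' := (hb.same hs₁ (by decide) (by decide)).same hs (by decide) (by decide)
    refine Runs.mono (Runs.straight rfl ?_) (by simp) fun _ _ h => h
    have hlt := hpre _ (Instance.locN_lt hi)
    have hbd := group_bounds (I := I) (Instance.ownerN_lt hi) rfl
    have e₁ : (I.ownerN i * I.N) % 2 ^ w = I.ownerN i * I.N := hw.mod_group (by omega)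
    have e₂ : (I.ownerN i * I.N + pre (I.locN i)) % 2 ^ w = I.ownerN i * I.N + pre (I.locN i) :=
      hw.mod_group (by omega)
    have e₃ : (i + 1) % 2 ^ w = i + 1 := hw.mod (by omega)
    simp [hc, h₂, hs.1 15 (by decide), hs₁.1 15 (by decide), h15, hb'.size_N, hb'.owner, hb'.loc,
      e₁, e₂, e₃]
    intro k hk
    rcases hk.lt_or_eq with hk | rfl
    · rw [Function.update_of_ne (by omega), Function.update_of_ne (by omega)]
      exact h₃ k hk
    · simp
  · simp; omega
  · exact fun t _ h => h.2

/-- Computes the sorted keys and the prefix sums of the probabilities and of the products of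
probabilities and depths. -/
def prefixes : Prog :=
  (.set 20 (.const 0) ;; .rset 11 (.const 0) ;; .rset 12 (.const 0)) ;;
  .loop (.not (.wle (.cell 0 (.const 3)) (.var 20)))
    (.setWord 33 (.var 20) (.cell 26 (.cell 27 (.var 20))) ;;
     .setReal 11 (.add (.var 20) (.const 1))
       (.add (.cell 11 (.var 20)) (.cell 1 (.cell 27 (.var 20)))) ;;
     .setReal 12 (.add (.var 20) (.const 1)) (.add (.cell 12 (.var 20))
       (.mul (.cell 1 (.cell 27 (.var 20))) (.cell 10 (.cell 15 (.cell 3 (.cell 27 (.var 20))))))) ;;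
     .inc 20 (.const 0) (.const 1))

theorem prefixes_runs {I : Instance} {w : ℕ} {s : Store} {pre key A : ℕ → ℕ} {D : ℕ → ℝ}
    (hw : Big w I.M) (hb : I.Base s) (h15 : s.word 15 = pre) (h26 : s.word 26 = key)
    (h27 : s.word 27 = A) (h10 : s.real 10 = D) :
    Runs w prefixes s (100 * I.M + 100) fun s' => (∀ t, t < I.M → s'.word 33 t = key (A t)) ∧
      (∀ t, t ≤ I.M → s'.real 11 t = ∑ i ∈ Finset.range t, I.probN (A i)) ∧
      (∀ t, t ≤ I.M → s'.real 12 t =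
        ∑ i ∈ Finset.range t, I.probN (A i) * D (pre (I.locN (A i)))) := by
  have hc := @hw.const
  refine Runs.mono (Runs.seq
      (Runs.straight (Q := fun t => t.word 20 0 = 0 ∧ t.real 11 0 = 0 ∧ t.real 12 0 = 0) rfl ?_)
    fun s₁ hs₁ h₁ => Runs.forLoop (T := 70) (n := I.M) (fun i t => t.word 20 0 = i ∧
      (∀ t', t' < i → t.word 33 t' = key (A t')) ∧
      (∀ t', t' ≤ i → t.real 11 t' = ∑ i ∈ Finset.range t', I.probN (A i)) ∧
      (∀ t', t' ≤ i → t.real 12 t' =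
        ∑ i ∈ Finset.range t', I.probN (A i) * D (pre (I.locN (A i))))) ?_ ?_ ?_) ?_ ?_
  · simp [hc]
  · obtain ⟨h₁, h₂, h₃⟩ := h₁
    exact ⟨h₁, by simp, by simpa using h₂, by simpa using h₃⟩
  · rintro i t hi hs ⟨h₂, -⟩
    have hb' := (hb.same hs₁ (by decide) (by decide)).same hs (by decide) (by decide)
    simp [hc, h₂, hb'.size_M]
  · rintro i t hi hs ⟨h₂, h₃, h₄, h₅⟩
    have hb' := (hb.same hs₁ (by decide) (by decide)).same hs (by decide) (by decide)
    refine Runs.mono (Runs.straight rfl ?_) (by simp) fun _ _ h => h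
    have e₃ : (i + 1) % 2 ^ w = i + 1 := hw.mod (by omega)
    simp [hc, h₂, hs.1 15 (by decide), hs₁.1 15 (by decide), hs.1 26 (by decide),
      hs₁.1 26 (by decide), hs.1 27 (by decide), hs₁.1 27 (by decide), hs.2 10 (by decide),
      hs₁.2 10 (by decide), h15, h26, h27, h10, hb'.loc, hb'.prob, e₃]
    refine ⟨fun k hk => ?_, fun k hk => ?_, fun k hk => ?_⟩
    · rcases hk.lt_or_eq with hk | rfl
      · rw [Function.update_of_ne (by omega)]
        exact h₃ k hk
      · simp
    · rcases hk.lt_or_eq with hk | rfl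
      · rw [Function.update_of_ne (by omega)]
        exact h₄ k (by omega)
      · rw [Function.update_self, h₄ i le_rfl, Finset.sum_range_succ]
    · rcases hk.lt_or_eq with hk | rfl
      · rw [Function.update_of_ne (by omega)]
        exact h₅ k (by omega)
      · rw [Function.update_self, h₅ i le_rfl, Finset.sum_range_succ]
  · simp; omega
  · exact fun t _ h => h.2

/-! ### Tables of left and right sums -/

/-- Puts the location at the position in `30` into the place of a query. -/
def poseLocation : Prog :=
  .set 50 (.mul (.div (.cell 33 (.var 30)) (.cell 0 (.const 0))) (.cell 0 (.const 0))) ;;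
  .set 51 (.sub (.cell 33 (.var 30)) (.var 50))

/-- Computes the sums over the preceding locations of the same uncertain point. -/
def leftSums : Prog :=
  .set 30 (.const 0) ;;
  .loop (.not (.wle (.cell 0 (.const 3)) (.var 30)))
    ((poseLocation ;; .set 52 (.var 30)) ;;
     leftQuery ;;
     (.setReal 13 (.var 30) (.var 20) ;; .inc 30 (.const 0) (.const 1)))

/-- Computes the sums over the following locations of the same uncertain point. -/
def rightSums : Prog :=
  .set 30 (.cell 0 (.const 3)) ;;
  .loop (.wle (.const 1) (.var 30))
    ((.set 30 (.sub (.var 30) (.const 1)) ;; poseLocation ;;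
      .set 52 (.add (.var 30) (.const 1))) ;;
     rightQuery ;;
     .setReal 14 (.var 30) (.var 21))

section

variable {I : Instance} {g : Index I} {w lg : ℕ} {s : Store}

theorem Index.div_lt (g : Index I) {t : ℕ} (ht : t < I.M) : g.K t / I.N < I.n :=
  Nat.div_lt_of_lt_mul (by rw [mul_comm]; exact g.K_lt t ht)

/-- Every location is treated as a query at its own vertex and position, which uses only earlier
entries of the table. The sums are split by position rather than by vertex, so equal keys, which
come from several locations of an uncertain point at one vertex, need no separate treatment. -/
theorem leftSums_runs (hw : Big w I.M) (hlg : I.M < 2 ^ lg) (hg : g.Loaded s) :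
    Runs w leftSums s (I.M * (200 * lg + 600) + 100) fun s' => ∀ j, j < I.M →
      s'.real 13 j = g.left (g.K j / I.N * I.N) (g.K j % I.N) j := by
  have hc := @hw.const
  refine Runs.mono (Runs.seq
      (Runs.straight (Q := fun t => t.word 30 0 = 0) rfl ?_)
    fun s₁ hs₁ h₁ => Runs.forLoop (T := 200 * lg + 560) (n := I.M) (fun i t => t.word 30 0 = i ∧
      ∀ j, j < i → t.real 13 j = g.left (g.K j / I.N * I.N) (g.K j % I.N) j) ?_ ?_ ?_) ?_ ?_
  · simp [hc]
  · exact ⟨h₁, by simp⟩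
  · rintro i t hi hs ⟨h₂, -⟩
    have hg' := (hg.same hs₁ (by decide) (by decide)).same hs (by decide) (by decide)
    simp [hc, h₂, hg'.size_M]
  · rintro i t hi hs ⟨h₂, h₃⟩
    have hg' := (hg.same hs₁ (by decide) (by decide)).same hs (by decide) (by decide)
    have hbd := group_bounds (g.div_lt hi) rfl
    have hdm := Nat.div_add_mod' (g.K i) I.N
    have hml := Nat.mod_lt (g.K i) I.N_pos
    have e₁ : (g.K i / I.N * I.N) % 2 ^ w = g.K i / I.N * I.N := hw.mod_group (by omega)
    have e₂ : (i + 1) % 2 ^ w = i + 1 := hw.mod (by omega)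
    refine Runs.mono (Runs.seq (Runs.straight (Q := fun t' => t'.word 50 0 = g.K i / I.N * I.N ∧
        t'.word 51 0 = g.K i % I.N ∧ t'.word 52 0 = i) rfl ?_)
      fun t₁ ht₁ q₁ => Runs.seq (leftQuery_runs hw hlg (hg'.same ht₁ (by decide) (by decide))
        q₁.1 q₁.2.1 q₁.2.2 (g.div_lt hi) rfl hml hi.le (fun j hj => ?_) (fun j hj => ?_))
      fun t₂ ht₂ q₂ => Runs.straight rfl ?_) ?_ fun _ _ h => h
    · simp [poseLocation, hc, h₂, hg'.K, hg'.size_N, e₁]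
      omega
    · have := g.K_mono j i hj.le hi
      omega
    · rw [ht₁.2 13 (by decide), h₃ j hj]
    · simp [hc, ht₂.1 30 (by decide), ht₁.1 30 (by decide), h₂, e₂, q₂]
      intro j hj
      rcases hj.lt_or_eq with hj | rfl
      · rw [Function.update_of_ne (by omega), ht₂.2 13 (by decide), ht₁.2 13 (by decide)]
        exact h₃ j hj
      · simp
    · simp [poseLocation]; omega
  · simp; nlinarith
  · exact fun t _ h => h.2

/-- The table is filled from its end, because an entry depends only on entries at later positions.
-/
theorem rightSums_runs (hw : Big w I.M) (hlg : I.M < 2 ^ lg) (hg : g.Loaded s) :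
    Runs w rightSums s (I.M * (200 * lg + 600) + 100) fun s' => ∀ j, j < I.M →
      s'.real 14 j = g.right (g.K j / I.N * I.N) (g.K j % I.N) (j + 1) := by
  have hc := @hw.const
  refine Runs.mono (Runs.seq
      (Runs.straight (Q := fun t => t.word 30 0 = I.M) rfl ?_)
    fun s₁ hs₁ h₁ => Runs.forLoop (T := 200 * lg + 560) (n := I.M) (fun i t =>
      t.word 30 0 = I.M - i ∧ ∀ j, I.M - i ≤ j → j < I.M →
        t.real 14 j = g.right (g.K j / I.N * I.N) (g.K j % I.N) (j + 1)) ?_ ?_ ?_) ?_ ?_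
  · simp [hc, hg.size_M]
  · exact ⟨h₁, fun j hj hj' => by omega⟩
  · rintro i t hi hs ⟨h₂, -⟩
    simp [hc, h₂]; omega
  · rintro i' t hi' hs ⟨h₂, h₃⟩
    have hg' := (hg.same hs₁ (by decide) (by decide)).same hs (by decide) (by decide)
    obtain ⟨i, hi⟩ : ∃ i, I.M - (i' + 1) = i := ⟨_, rfl⟩
    rw [show I.M - i' = i + 1 by omega] at h₂ h₃
    rw [hi]
    replace hi : i < I.M := by omega
    have hbd := group_bounds (g.div_lt hi) rfl
    have hdm := Nat.div_add_mod' (g.K i) I.N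
    have hml := Nat.mod_lt (g.K i) I.N_pos
    have e₁ : (g.K i / I.N * I.N) % 2 ^ w = g.K i / I.N * I.N := hw.mod_group (by omega)
    have e₂ : (i + 1) % 2 ^ w = i + 1 := hw.mod (by omega)
    refine Runs.mono (Runs.seq (Runs.straight (Q := fun t' => t'.word 50 0 = g.K i / I.N * I.N ∧
        t'.word 51 0 = g.K i % I.N ∧ t'.word 52 0 = i + 1 ∧ t'.word 30 0 = i) rfl ?_)
      fun t₁ ht₁ q₁ => Runs.seq (rightQuery_runs hw hlg (hg'.same ht₁ (by decide) (by decide))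
        q₁.1 q₁.2.1 q₁.2.2.1 (g.div_lt hi) rfl (fun j hj hj' => ?_) (fun j hj hj' => ?_))
      fun t₂ ht₂ q₂ => Runs.straight rfl ?_) ?_ fun _ _ h => h
    · simp [poseLocation, hc, h₂, hg'.K, hg'.size_N, e₁, e₂]
      omega
    · have := g.K_mono i j (by omega) hj'
      omega
    · rw [ht₁.2 14 (by decide), h₃ j hj hj']
    · simp [hc, ht₂.1 30 (by decide), q₁.2.2.2, q₂]
      intro j hj hj'
      rcases hj.lt_or_eq with hj | rfl
      · rw [Function.update_of_ne (by omega), ht₂.2 14 (by decide), ht₁.2 14 (by decide)]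
        exact h₃ j hj hj'
      · simp
    · simp [poseLocation]; omega
  · simp; nlinarith
  · exact fun t _ h => fun j hj => h.2 j (by omega) hj

end

/-! ### Assembling the data structure -/

/-- Builds the data structure. -/
def buildIndex : Prog :=
  buildTree ;; sortKeys ;; radixSort ;; prefixes ;; leftSums ;; rightSums

/-- The data structure with the prefix and suffix sums is stored in the memory. -/
structure Index.Complete {I : Instance} (g : Index I) (s : Store) : Prop where
  loaded : g.Loaded s
  left : ∀ j, j < I.M → s.real 13 j = g.left (g.K j / I.N * I.N) (g.K j % I.N) j
  right : ∀ j, j < I.M → s.real 14 j = g.right (g.K j / I.N * I.N) (g.K j % I.N) (j + 1)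
  G : ∀ j, j ≤ I.M → s.real 12 j = ∑ i ∈ Finset.range j, g.f i * g.D (g.K i % I.N)

section

variable {I : Instance} {w lg : ℕ} {s : Store}

theorem Instance.sum_sorted {A pre : ℕ → ℕ}
    (hA : ((List.range I.M).map A).Perm (List.range I.M)) (φ : ℕ → ℝ → ℝ) :
    ∑ k, φ (I.owner k * I.N + pre (I.loc k)) (I.prob k) = ∑ t ∈ Finset.range I.M,
      φ (I.ownerN (A t) * I.N + pre (I.locN (A t))) (I.probN (A t)) := by
  have h := (hA.map fun k => φ (I.ownerN k * I.N + pre (I.locN k)) (I.probN k)).sum_eq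
  rw [List.map_map] at h
  refine Eq.trans ?_ h.symm
  refine Eq.trans ?_ (Finset.sum_range
    fun k => φ (I.ownerN k * I.N + pre (I.locN k)) (I.probN k)).symm
  exact Finset.sum_congr rfl fun k _ => by
    simp [Instance.ownerN, Instance.locN, Instance.probN, arrayOf]

theorem Instance.base_input (I : Instance) : I.Base I.input := ⟨fun _ _ => rfl, fun _ _ => rfl⟩

theorem buildIndex_runs (hw : Big w I.M) (hlg : I.M < 2 ^ lg) :
    Runs w buildIndex I.input (6000 * (I.M * lg)) fun s' => ∃ g : Index I, g.Complete s' := by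
  have hlg0 : 1 ≤ lg := by
    by_contra! h
    have := I.M_pos
    interval_cases lg
    omega
  have hM := I.M_pos
  -- Since `lg ≥ 1`, the linear and constant terms of the time bound are absorbed into the multiple
  -- of `M * lg`.
  have hMl : I.M ≤ I.M * lg := Nat.le_mul_of_pos_right _ hlg0
  refine Runs.mono (Runs.seq (buildTree_runs hw) fun s₁ hs₁ h₁ => ?_)
    (T := 700 * I.M + 500 + (100 * I.M + 100 + (1000 * (I.M * lg) + 100 + (100 * I.M + 100 +
      (I.M * (200 * lg + 600) + 100 + (I.M * (200 * lg + 600) + 100))))))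
    (by nlinarith) fun _ _ h => h
  obtain ⟨par, z, hnum, hmin, hD⟩ := h₁
  have b₁ := I.base_input.same hs₁ (by decide) (by decide)
  refine Runs.seq (sortKeys_runs hw b₁ rfl hnum.pre_lt) fun s₂ hs₂ h₂ => ?_
  have b₂ := b₁.same hs₂ (by decide) (by decide)
  refine Runs.seq (radixSort_runs hw hlg b₂ rfl (fun k hk => (h₂ k hk).2) fun k hk => ?_)
    fun s₃ hs₃ h₃ => ?_
  · rw [(h₂ k hk).1]
    have h₄ := hnum.pre_lt _ (I.locN_lt hk)
    have h₅ := Nat.mul_le_mul_right I.N (I.ownerN_lt hk)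
    rw [Nat.succ_mul] at h₅
    omega
  have b₃ := b₂.same hs₃ (by decide) (by decide)
  have hs₁₃ := fun a (h : a ∉ sortKeys.wordMods) (h' : a ∉ radixSort.wordMods) =>
    (hs₃.1 a h').trans (hs₂.1 a h)
  refine Runs.seq (prefixes_runs hw b₃ rfl rfl rfl rfl) fun s₄ hs₄ h₄ => ?_
  have b₄ := b₃.same hs₄ (by decide) (by decide)
  obtain ⟨hperm, hsort⟩ := h₃
  obtain ⟨hK, hF, hG⟩ := h₄
  have e15 : s₃.word 15 = s₁.word 15 := hs₁₃ 15 (by decide) (by decide)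
  have e10 : s₃.real 10 = s₁.real 10 := (hs₃.2 10 (by decide)).trans (hs₂.2 10 (by decide))
  have hAlt : ∀ t, t < I.M → s₃.word 27 t < I.M := fun t ht => by
    have := hperm.mem_iff.1 (List.mem_map_of_mem (List.mem_range.2 ht))
    exact List.mem_range.1 this
  have hKt : ∀ t, t < I.M → s₄.word 33 t =
      I.ownerN (s₃.word 27 t) * I.N + s₁.word 15 (I.locN (s₃.word 27 t)) := fun t ht => by
    rw [hK t ht, hs₃.1 26 (by decide), (h₂ _ (hAlt t ht)).1]
  let g : Index I :=
    { pre := s₁.word 15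
      par := par
      en := s₁.word 18
      T := s₁.word 19
      K := s₄.word 33
      z := z
      f := fun t => I.probN (s₃.word 27 t)
      F := s₄.real 11
      D := s₁.real 10
      numbered := hnum
      minTree := hmin
      K_mono := by
        intro i j hij hj
        rcases hij.eq_or_lt with rfl | hij
        · rfl
        rw [hK i (by omega), hK j hj, hs₃.1 26 (by decide)]
        have := List.pairwise_iff_getElem.1 hsort i j (by simp; omega) (by simpa) hij
        simpa using this
      K_lt := by
        intro t ht
        rw [hKt t ht]
        have h₄ := hnum.pre_lt _ (I.locN_lt (hAlt t ht))
        have h₅ := Nat.mul_le_mul_right I.N (I.ownerN_lt (hAlt t ht))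
        rw [Nat.succ_mul] at h₅
        omega
      F_eq := hF
      D_eq := hD
      sum_eq := fun φ => (I.sum_sorted hperm φ).trans
        (Finset.sum_congr rfl fun t ht => by rw [hKt t (Finset.mem_range.1 ht)]) }
  have hg : g.Loaded s₄ :=
    { input := b₄.word
      inputR := b₄.real
      pre := (hs₄.1 15 (by decide)).trans e15
      en := (hs₄.1 18 (by decide)).trans (hs₁₃ 18 (by decide) (by decide))
      T := (hs₄.1 19 (by decide)).trans (hs₁₃ 19 (by decide) (by decide))
      K := rfl
      D := (hs₄.2 10 (by decide)).trans e10
      F := rfl }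
  refine Runs.seq (leftSums_runs hw hlg hg) fun s₅ hs₅ h₅ => ?_
  have hg₅ := hg.same hs₅ (by decide) (by decide)
  refine Runs.mono (rightSums_runs hw hlg hg₅) le_rfl fun s₆ hs₆ h₆ => ⟨g, ?_⟩
  refine ⟨hg₅.same hs₆ (by decide) (by decide), fun j hj => ?_, h₆, fun j hj => ?_⟩
  · rw [hs₆.2 13 (by decide), h₅ j hj]
  · rw [hs₆.2 12 (by decide), hs₅.2 12 (by decide), hG j hj, e15, e10]
    refine Finset.sum_congr rfl fun i hi => ?_
    have hi' : i < I.M := (Finset.mem_range.1 hi).trans_le hj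
    have h₇ := hnum.pre_lt _ (I.locN_lt (hAlt i hi'))
    show _ = I.probN (s₃.word 27 i) * s₁.real 10 (s₄.word 33 i % I.N)
    rw [hKt i hi', Nat.mul_add_mod', Nat.mod_eq_of_lt h₇]

end

/-! ## Expected distances in terms of the data structure -/

theorem common_comm {ι : Type} [Fintype ι] (ln : ι → ℝ) (z : ι → ℕ) (en : ℕ → ℕ) (x y : ℕ) :
    common ln z en x y = common ln z en y x :=
  Finset.sum_congr rfl fun _ _ => if_congr and_comm rfl rfl

theorem IsLowerBound.sum_sub {M lo hi q q' : ℕ} {K : ℕ → ℕ} (h : IsLowerBound M K q lo)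
    (h' : IsLowerBound M K q' hi) (hq : q ≤ q') (f : ℕ → ℝ) :
    ∑ t ∈ Finset.range hi, f t - ∑ t ∈ Finset.range lo, f t =
      ∑ t ∈ Finset.range M, if q ≤ K t ∧ K t < q' then f t else 0 := by
  obtain ⟨h₁, h₂, h₃⟩ := h
  obtain ⟨h₁', h₂', h₃'⟩ := h'
  have hle : lo ≤ hi := by
    by_contra! hlt
    have := h₂ hi hlt
    have := h₃' hi le_rfl (by omega)
    omega
  rw [← Finset.sum_Ico_eq_sub _ hle, ← Finset.sum_filter]
  refine Finset.sum_congr (Finset.ext fun t => ?_) fun _ _ => rfl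
  rw [Finset.mem_Ico, Finset.mem_filter, Finset.mem_range]
  constructor
  · rintro ⟨h₄, h₅⟩
    exact ⟨by omega, h₃ t h₄ (by omega), h₂' t h₅⟩
  · rintro ⟨h₄, h₅, h₆⟩
    constructor
    · by_contra! hlt
      have := h₂ t hlt
      omega
    · by_contra! hlt
      have := h₃' t hlt h₄
      omega

namespace Index

variable {I : Instance} (g : Index I)

/-- The probability that the uncertain point `i` is among the descendants of `y`. -/
noncomputable def below (i : Fin I.n) (y : ℕ) : ℝ :=
  ∑ k with I.owner k = i,
    I.prob k * if y ≤ g.pre (I.loc k) ∧ g.pre (I.loc k) < g.en y then 1 else 0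

/-- Preorder numbers are less than `N`, so a key lies in `[i * N, i * N + N)` exactly if its owner
is `i`. Hence a sum over the locations of `i` is an instance of `sum_eq` with a function of the key
and the probability. -/
theorem group_sum (i : Fin I.n) (ψ : ℕ → ℝ) :
    ∑ k with I.owner k = i, I.prob k * ψ (g.pre (I.loc k)) =
      ∑ t ∈ Finset.range I.M, if i * I.N ≤ g.K t ∧ g.K t < i * I.N + I.N then
        g.f t * ψ (g.K t - i * I.N) else 0 := by
  rw [← g.sum_eq fun c p => if i * I.N ≤ c ∧ c < i * I.N + I.N then p * ψ (c - i * I.N) else 0,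
    Finset.sum_filter]
  refine Finset.sum_congr rfl fun k _ => ?_
  have hp := g.numbered.pre_lt _ (I.loc k).2
  by_cases h : I.owner k = i
  · rw [if_pos h, h, if_pos ⟨by omega, by omega⟩, Nat.add_sub_cancel_left]
  · rw [if_neg h, if_neg]
    rintro ⟨h₁, h₂⟩
    apply h
    rcases lt_trichotomy (I.owner k : ℕ) i with h₃ | h₃ | h₃
    · have := Nat.mul_le_mul_right I.N h₃
      rw [Nat.succ_mul] at this
      omega
    · exact Fin.ext h₃
    · have := Nat.mul_le_mul_right I.N h₃
      rw [Nat.succ_mul] at this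
      omega

theorem left_add_right {b x l : ℕ} (hx : x < I.N) (hl : IsLowerBound I.M g.K (b + x) l) :
    g.left b x l + g.right b x l = ∑ t ∈ Finset.range I.M,
      if b ≤ g.K t ∧ g.K t < b + I.N then g.f t * common I.len g.z g.en x (g.K t - b) else 0 := by
  obtain ⟨h₁, h₂, h₃⟩ := hl
  rw [← Finset.sum_range_add_sum_Ico _ h₁]
  unfold left right leftSum rightSum
  congr 1
  · refine Finset.sum_congr rfl fun t ht => ?_
    have := h₂ t (Finset.mem_range.1 ht)
    rw [common_comm]
    exact if_congr (by omega) rfl rfl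
  · refine Finset.sum_congr rfl fun t ht => ?_
    have := h₃ t (Finset.mem_Ico.1 ht).1 (Finset.mem_Ico.1 ht).2
    exact if_congr (by omega) rfl rfl

theorem below_eq {i : Fin I.n} {y lo hi : ℕ} (hy : y < I.N)
    (hlo : IsLowerBound I.M g.K (i * I.N + y) lo)
    (hhi : IsLowerBound I.M g.K (i * I.N + g.en y) hi) : g.below i y = g.F hi - g.F lo := by
  have h₁ := g.numbered.tree.lt_en y hy
  have h₂ := g.numbered.tree.en_le y hy
  rw [g.F_eq hi hhi.1, g.F_eq lo hlo.1, hlo.sum_sub hhi (by omega)]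
  refine (g.group_sum i fun c => if y ≤ c ∧ c < g.en y then 1 else 0).trans
    (Finset.sum_congr rfl fun t _ => ?_)
  by_cases h : i * I.N + y ≤ g.K t ∧ g.K t < i * I.N + g.en y
  · rw [if_pos (by omega), if_pos (by omega), if_pos h, mul_one]
  · rw [if_neg h]
    split_ifs with h₃ h₄
    · omega
    · rw [mul_zero]
    · rfl

variable {g} {s : Store}

theorem Complete.Ed_vertex (hg : g.Complete s) (v : Fin I.N) (i : Fin I.n) {lo hi l : ℕ}
    (hlo : IsLowerBound I.M g.K (i * I.N) lo) (hhi : IsLowerBound I.M g.K (i * I.N + I.N) hi)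
    (hl : IsLowerBound I.M g.K (i * I.N + g.pre v) l) :
    I.Ed (.vertex v) i = I.weight i * (s.real 12 hi - s.real 12 lo + g.D (g.pre v) -
      2 * (g.left (i * I.N) (g.pre v) l + g.right (i * I.N) (g.pre v) l)) := by
  have hv := g.numbered.pre_lt v v.2
  have h₁ : s.real 12 hi - s.real 12 lo =
      ∑ k with I.owner k = i, I.prob k * depth I.len g.z g.en (g.pre (I.loc k)) := by
    rw [hg.G hi hhi.1, hg.G lo hlo.1, hlo.sum_sub hhi (by omega), g.group_sum]
    refine Finset.sum_congr rfl fun t _ => ?_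
    split_ifs with h
    · rw [(group_div_mod rfl h.1 h.2).2, g.D_eq _ (by omega)]
    · rfl
  rw [h₁, g.left_add_right hv hl, ← g.group_sum, g.D_eq _ hv]
  -- As the probabilities sum to `1`, the depth of `v` can be distributed over the locations; the
  -- rest is `vdist_eq` term by term.
  have h₂ : depth I.len g.z g.en (g.pre v) =
      ∑ k with I.owner k = i, I.prob k * depth I.len g.z g.en (g.pre v) := by
    rw [← Finset.sum_mul, I.prob_sum, one_mul]
  rw [h₂, Instance.Ed]
  congr 1
  rw [← Finset.sum_add_distrib, Finset.mul_sum, ← Finset.sum_sub_distrib]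
  refine Finset.sum_congr rfl fun k _ => ?_
  rw [Instance.dist, g.numbered.vdist_eq]
  ring

-- The end with the larger preorder number is the lower end of the edge, and the locations on its
-- side are those in its interval. Moving away from `src e` by `δ` changes the distance to a
-- location by `-δ` if the path from `src e` uses `e`, and by `δ` otherwise. If `src e` is the lower
-- end, the locations in its subtree recede; if `tgt e` is, those in its subtree approach. This
-- accounts for the two signs.
variable (g) in
theorem Ed_onEdge (e : Fin I.E) (i : Fin I.n) (δ : ℝ) (hδ : δ ∈ Set.Icc 0 (I.len e)) :
    I.Ed (.onEdge e δ hδ) i = I.Ed (.vertex (I.src e)) i +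
      I.weight i * (if g.pre (I.tgt e) ≤ g.pre (I.src e) then
        2 * g.below i (g.pre (I.src e)) - 1 else 1 - 2 * g.below i (g.pre (I.tgt e))) * δ := by
  have hone : (1 : ℝ) = ∑ k with I.owner k = i, I.prob k := (I.prob_sum i).symm
  have hz := g.numbered.tree.par_lt _ (g.numbered.z_pos e) (g.numbered.z_lt e)
  have hen := g.numbered.tree.lt_en _ (g.numbered.z_lt e)
  rw [Instance.Ed, Instance.Ed, mul_assoc, ← mul_add]
  congr 1
  rcases g.numbered.ends e with ⟨h₁, h₂⟩ | ⟨h₁, h₂⟩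
  · rw [if_pos (by omega), below, hone, Finset.mul_sum, ← Finset.sum_sub_distrib, Finset.sum_mul,
      ← Finset.sum_add_distrib]
    refine Finset.sum_congr rfl fun k _ => ?_
    simp only [Instance.dist, g.numbered.onPath_iff, h₁]
    by_cases h : g.z e ≤ g.pre (I.loc k) ∧ g.pre (I.loc k) < g.en (g.z e)
    · rw [if_neg (by omega), if_pos h, ← hone]
      ring
    · rw [if_pos (by omega), if_neg h]
      ring
  · rw [if_neg (by omega), below, hone, Finset.mul_sum, ← Finset.sum_sub_distrib, Finset.sum_mul,
      ← Finset.sum_add_distrib]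
    refine Finset.sum_congr rfl fun k _ => ?_
    simp only [Instance.dist, g.numbered.onPath_iff, h₁, h₂]
    by_cases h : g.z e ≤ g.pre (I.loc k) ∧ g.pre (I.loc k) < g.en (g.z e)
    · rw [if_pos (by omega), if_pos h, ← hone]
      ring
    · rw [if_neg (by omega), if_neg h]
      ring

theorem Complete.congr {s' : Store} (h : g.Complete s)
    (hw : ∀ a ∈ [0, 1, 2, 3, 4, 15, 18, 19, 33], s'.word a = s.word a)
    (hr : ∀ a ∈ [0, 1, 2, 10, 11, 12, 13, 14], s'.real a = s.real a) : g.Complete s' where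
  loaded := h.loaded.congr hw fun a ha => hr a (by fin_cases ha <;> simp)
  left := by rw [hr 13 (by simp)]; exact h.left
  right := by rw [hr 14 (by simp)]; exact h.right
  G := by rw [hr 12 (by simp)]; exact h.G

theorem Complete.same {s' : Store} {p : Prog} (h : g.Complete s) (hs : p.Same s s')
    (hw : ∀ a ∈ [0, 1, 2, 3, 4, 15, 18, 19, 33], a ∉ p.wordMods)
    (hr : ∀ a ∈ [0, 1, 2, 10, 11, 12, 13, 14], a ∉ p.realMods) : g.Complete s' :=
  h.congr (fun a ha => hs.1 a (hw a ha)) fun a ha => hs.2 a (hr a ha)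

theorem Complete.ask (h : g.Complete s) (x : I.Point) (i : Fin I.n) : g.Complete (I.ask x i s) := by
  cases x with
  | vertex v =>
    refine h.congr (fun a ha => ?_) fun a ha => rfl
    fin_cases ha <;> funext j <;> simp [Instance.ask]
  | onEdge e δ hδ =>
    refine h.congr (fun a ha => ?_) fun a ha => ?_ <;>
    fin_cases ha <;> funext j <;> simp [Instance.ask]

end Index

/-! ## Queries -/

/-- Writes into the word array `a` the position of the first key that is at least `q`. -/
def position (a : ℕ) (q : WExp) : Prog :=
  .set 40 q ;; lowerBound ;; .set a (.var 41)

/-- Computes the expected distance from the vertex in `54` to the uncertain point of the query. -/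
def vertexQuery : Prog :=
  (.set 50 (.mul (.cell 5 (.const 2)) (.cell 0 (.const 0))) ;; .set 51 (.cell 15 (.var 54))) ;;
  position 55 (.var 50) ;;
  position 56 (.add (.var 50) (.cell 0 (.const 0))) ;;
  position 52 (.add (.var 50) (.var 51)) ;;
  leftQuery ;;
  rightQuery ;;
  .setReal 4 (.const 1) (.mul (.cell 2 (.cell 5 (.const 2)))
    (.sub (.add (.sub (.cell 12 (.var 56)) (.cell 12 (.var 55))) (.cell 10 (.var 51)))
      (.mul (.const 2) (.add (.var 20) (.var 21)))))

/-- Computes the slope along the edge of the query, and then the expected distance. -/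
def edgeQuery : Prog :=
  (.set 58 (.cell 15 (.cell 2 (.cell 5 (.const 1)))) ;;
    .ite (.wle (.var 58) (.var 51)) (.set 57 (.var 51)) (.set 57 (.var 58))) ;;
  position 55 (.add (.var 50) (.var 57)) ;;
  position 56 (.add (.var 50) (.cell 18 (.var 57))) ;;
  (.rset 22 (.mul (.const 2) (.sub (.cell 11 (.var 56)) (.cell 11 (.var 55)))) ;;
    .ite (.wle (.var 58) (.var 51))
      (.setReal 4 (.const 2) (.mul (.cell 2 (.cell 5 (.const 2))) (.sub (.var 22) (.const 1))))
      (.setReal 4 (.const 2) (.mul (.cell 2 (.cell 5 (.const 2))) (.sub (.const 1) (.var 22)))) ;;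
    .rset 4 (.add (.cell 4 (.const 1)) (.mul (.cell 4 (.const 2)) (.var 3))))

/-- Answers a query. -/
def answerQuery : Prog :=
  .ite (.wle (.var 5) (.const 0))
    (.set 54 (.cell 5 (.const 1)) ;; vertexQuery ;; .rset 4 (.cell 4 (.const 1)))
    (.set 54 (.cell 1 (.cell 5 (.const 1))) ;; vertexQuery ;; edgeQuery)

section

variable {I : Instance} {g : Index I} {w lg : ℕ} {s : Store}

theorem position_runs {a v : ℕ} {q : WExp} (hw : Big w I.M) (hlg : I.M < 2 ^ lg) (hg : g.Loaded s)
    (hq : q.eval w s = v) : Runs w (position a q) s (40 * lg + 50 + q.cost) fun s' =>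
      IsLowerBound I.M g.K v (s'.word a 0) := by
  have hc := @hw.const
  refine Runs.mono (Runs.seq (Runs.straight (Q := fun t => t.word 40 0 = v) rfl ?_)
    fun t₁ ht₁ q₁ => Runs.seq (lowerBound_runs hw
      (hg.same ht₁ (by simp [Prog.wordMods]) (by simp [Prog.realMods])).size_M
      (hg.same ht₁ (by simp [Prog.wordMods]) (by simp [Prog.realMods])).K g.K_mono q₁ hlg)
    fun t₂ ht₂ q₂ => Runs.straight rfl ?_) ?_ fun _ _ h => h
  · simp [hc, hq]
  · simpa [hc] using q₂
  · simp; omega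

theorem Index.Loaded.weight (hg : g.Loaded s) (i : Fin I.n) : s.real 2 i = I.weight i := by
  rw [hg.inputR 2 (by norm_num)]
  simp [Instance.input, arrayOf]

theorem Index.Loaded.src (hg : g.Loaded s) (e : Fin I.E) : s.word 1 e = I.src e := by
  rw [hg.input 1 (by norm_num)]
  simp [Instance.input, arrayOf]

theorem Index.Loaded.tgt (hg : g.Loaded s) (e : Fin I.E) : s.word 2 e = I.tgt e := by
  rw [hg.input 2 (by norm_num)]
  simp [Instance.input, arrayOf]

theorem vertexQuery_runs {v : Fin I.N} {i : Fin I.n} (hw : Big w I.M) (hlg : I.M < 2 ^ lg)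
    (hg : g.Complete s) (hi : s.word 5 2 = i) (hv : s.word 54 0 = v) :
    Runs w vertexQuery s (600 * lg + 1500) fun s' => s'.real 4 1 = I.Ed (.vertex v) i ∧
      s'.word 50 0 = i * I.N ∧ s'.word 51 0 = g.pre v := by
  have hc := @hw.const
  have hbd := group_bounds i.2 rfl
  have hx := g.numbered.pre_lt v v.2
  have e₁ : ((i : ℕ) * I.N) % 2 ^ w = i * I.N := hw.mod_group (by omega)
  have e₂ : ((i : ℕ) * I.N + I.N) % 2 ^ w = i * I.N + I.N := hw.mod_group (by omega)
  have e₃ : ((i : ℕ) * I.N + g.pre v) % 2 ^ w = i * I.N + g.pre v := hw.mod_group (by omega)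
  refine Runs.mono (Runs.seq (Runs.straight
      (Q := fun t => t.word 50 0 = i * I.N ∧ t.word 51 0 = g.pre v) rfl ?_)
    fun s₁ hs₁ h₁ => ?_)
    (T := _ + (40 * lg + 50 + 10 + (40 * lg + 50 + 10 + (40 * lg + 50 + 10 +
      ((200 * lg + 500) + ((200 * lg + 500) + 50)))))) (by simp; omega) fun _ _ h => h
  · simp [hc, hi, hv, hg.loaded.size_N, hg.loaded.pre, e₁]
  have g₁ := hg.same hs₁ (by decide) (by decide)
  refine Runs.seq (Runs.mono (position_runs hw hlg g₁.loaded (v := i * I.N) ?_) (by simp)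
    fun _ _ h => h) fun s₂ hs₂ h₂ => ?_
  · simp [hc, h₁.1]
  have g₂ := g₁.same hs₂ (by decide) (by decide)
  have h₁' : s₂.word 50 0 = i * I.N ∧ s₂.word 51 0 = g.pre v := by
    rw [hs₂.1 50 (by decide), hs₂.1 51 (by decide)]; exact h₁
  refine Runs.seq (Runs.mono (position_runs hw hlg g₂.loaded (v := i * I.N + I.N) ?_) (by simp)
    fun _ _ h => h) fun s₃ hs₃ h₃ => ?_
  · simp [hc, h₁'.1, g₂.loaded.size_N, e₂]
  have g₃ := g₂.same hs₃ (by decide) (by decide)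
  rw [← hs₃.1 50 (by decide), ← hs₃.1 51 (by decide)] at h₁'
  rw [← hs₃.1 55 (by decide)] at h₂
  refine Runs.seq (Runs.mono (position_runs hw hlg g₃.loaded (v := i * I.N + g.pre v) ?_) (by simp)
    fun _ _ h => h) fun s₄ hs₄ h₄ => ?_
  · simp [hc, h₁', e₃]
  have g₄ := g₃.same hs₄ (by decide) (by decide)
  rw [← hs₄.1 50 (by decide), ← hs₄.1 51 (by decide)] at h₁'
  rw [← hs₄.1 55 (by decide)] at h₂
  rw [← hs₄.1 56 (by decide)] at h₃
  have hK₁ : ∀ j, j < s₄.word 52 0 → g.K j ≤ i * I.N + g.pre v := fun j hj => (h₄.2.1 j hj).le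
  refine Runs.seq (leftQuery_runs hw hlg g₄.loaded h₁'.1 h₁'.2 rfl i.2 rfl hx h₄.1 hK₁
    fun j hj => g₄.left j (hj.trans_le h₄.1)) fun s₅ hs₅ h₅ => ?_
  have g₅ := g₄.same hs₅ (by decide) (by decide)
  rw [← hs₅.1 50 (by decide), ← hs₅.1 51 (by decide)] at h₁'
  refine Runs.seq (rightQuery_runs hw hlg g₅.loaded h₁'.1 h₁'.2 (congrFun (hs₅.1 52 (by decide)) 0) i.2 rfl
    h₄.2.2 fun j _ hj => g₅.right j hj) fun s₆ hs₆ h₆ => ?_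
  have g₆ := g₅.same hs₆ (by decide) (by decide)
  rw [← hs₆.1 50 (by decide), ← hs₆.1 51 (by decide)] at h₁'
  rw [← hs₅.1 55 (by decide), ← hs₆.1 55 (by decide)] at h₂
  rw [← hs₅.1 56 (by decide), ← hs₆.1 56 (by decide)] at h₃
  rw [← hs₆.2 20 (by decide)] at h₅
  have hi₆ : s₆.word 5 2 = i := by
    rw [hs₆.1 5 (by decide), hs₅.1 5 (by decide), hs₄.1 5 (by decide), hs₃.1 5 (by decide),
      hs₂.1 5 (by decide), hs₁.1 5 (by decide), hi]
  refine Runs.mono (Runs.straight rfl ?_) (by simp) fun _ _ h => h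
  have hw₆ := g₆.loaded.weight i
  simp [hc, hi₆, h₁', h₅, h₆, hw₆, g₆.loaded.D]
  exact (g₆.Ed_vertex v i h₂ h₃ h₄).symm

theorem edgeQuery_runs {e : Fin I.E} {i : Fin I.n} {δ : ℝ} (hw : Big w I.M) (hlg : I.M < 2 ^ lg)
    (hg : g.Complete s) (hi : s.word 5 2 = i) (he : s.word 5 1 = e) (hδ : s.real 3 0 = δ)
    (h50 : s.word 50 0 = i * I.N) (h51 : s.word 51 0 = g.pre (I.src e)) :
    Runs w edgeQuery s (80 * lg + 300) fun s' => s'.real 4 1 = s.real 4 1 ∧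
      s'.real 4 2 = I.weight i * (if g.pre (I.tgt e) ≤ g.pre (I.src e) then
        2 * g.below i (g.pre (I.src e)) - 1 else 1 - 2 * g.below i (g.pre (I.tgt e))) ∧
      s'.real 4 0 = s'.real 4 1 + s'.real 4 2 * δ := by
  have hc := @hw.const
  have hbd := group_bounds i.2 rfl
  obtain ⟨y, hy⟩ : ∃ y, y = if g.pre (I.tgt e) ≤ g.pre (I.src e) then g.pre (I.src e)
    else g.pre (I.tgt e) := ⟨_, rfl⟩
  have hyN : y < I.N := by
    rw [hy]
    split_ifs
    · exact g.numbered.pre_lt _ (I.src e).2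
    · exact g.numbered.pre_lt _ (I.tgt e).2
  have hen := g.numbered.tree.en_le y hyN
  have e₁ : ((i : ℕ) * I.N + y) % 2 ^ w = i * I.N + y := hw.mod_group (by omega)
  have e₂ : ((i : ℕ) * I.N + g.en y) % 2 ^ w = i * I.N + g.en y := hw.mod_group (by omega)
  refine Runs.mono (Runs.seq (Runs.straight
      (Q := fun t => t.word 58 0 = g.pre (I.tgt e) ∧ t.word 57 0 = y) rfl ?_)
    fun s₁ hs₁ h₁ => ?_)
    (T := _ + (40 * lg + 50 + 10 + (40 * lg + 50 + 10 + 100))) (by simp; omega) fun _ _ h => h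
  · have := hg.loaded.tgt e
    by_cases h : g.pre (I.tgt e) ≤ g.pre (I.src e) <;>
      simp [hc, he, hg.loaded.pre, this, h51, h, hy]
  have g₁ := hg.same hs₁ (by decide) (by decide)
  refine Runs.seq (Runs.mono (position_runs hw hlg g₁.loaded (v := i * I.N + y) ?_) (by simp)
    fun _ _ h => h) fun s₂ hs₂ h₂ => ?_
  · simp [hc, h₁.2, hs₁.1 50 (by decide), h50, e₁]
  have g₂ := g₁.same hs₂ (by decide) (by decide)
  rw [← hs₂.1 57 (by decide), ← hs₂.1 58 (by decide)] at h₁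
  refine Runs.seq (Runs.mono (position_runs hw hlg g₂.loaded (v := i * I.N + g.en y) ?_) (by simp)
    fun _ _ h => h) fun s₃ hs₃ h₃ => ?_
  · simp [hc, h₁.2, hs₂.1 50 (by decide), hs₁.1 50 (by decide), h50, e₂, g₂.loaded.en]
  have g₃ := g₂.same hs₃ (by decide) (by decide)
  rw [← hs₃.1 58 (by decide)] at h₁
  rw [← hs₃.1 55 (by decide)] at h₂
  have hb := g.below_eq hyN h₂ h₃
  refine Runs.mono (Runs.straight rfl ?_) (by simp) fun _ _ h => h
  have hw₃ := g₃.loaded.weight i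
  have h51' : s₃.word 51 0 = g.pre (I.src e) := by
    rw [hs₃.1 51 (by decide), hs₂.1 51 (by decide), hs₁.1 51 (by decide), h51]
  have h5' : s₃.word 5 2 = i := by
    rw [hs₃.1 5 (by decide), hs₂.1 5 (by decide), hs₁.1 5 (by decide), hi]
  have h3' : s₃.real 3 0 = δ := by
    rw [hs₃.2 3 (by decide), hs₂.2 3 (by decide), hs₁.2 3 (by decide), hδ]
  have h4' : s₃.real 4 1 = s.real 4 1 := by
    rw [hs₃.2 4 (by decide), hs₂.2 4 (by decide), hs₁.2 4 (by decide)]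
  by_cases h : g.pre (I.tgt e) ≤ g.pre (I.src e)
  · rw [if_pos h] at hy ⊢
    rw [← hy, hb]
    simp [hc, h₁.1, h51', h, h5', hw₃, h3', h4', g₃.loaded.F]
  · rw [if_neg h] at hy ⊢
    rw [← hy, hb]
    simp [hc, h₁.1, h51', h, h5', hw₃, h3', h4', g₃.loaded.F]

theorem answerQuery_runs (x : I.Point) (i : Fin I.n) (hw : Big w I.M) (hlg : I.M < 2 ^ lg)
    (hg : g.Complete s) : Runs w answerQuery (I.ask x i s) (700 * lg + 2000) fun s' =>
      I.Answered x i s' ∧ g.Complete s' := by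
  have hc := @hw.const
  have hg' := hg.ask x i
  refine Runs.mono (Runs.ite (T := 680 * lg + 1900) (Q := I.Answered x i) ?_ ?_)
    (by simp; omega) fun s' hs' h => ⟨h, hg'.same hs' ?_ ?_⟩
  · intro hb
    cases x with
    | onEdge e δ hδ => simp [hc, Instance.ask] at hb
    | vertex v =>
      refine Runs.mono (Runs.seq (Runs.straight
          (Q := fun t => t.word 54 0 = v ∧ t.word 5 2 = i) rfl ?_)
        fun t₁ ht₁ q₁ => Runs.seq (vertexQuery_runs hw hlg
          (hg'.same ht₁ (by decide) (by decide)) q₁.2 q₁.1)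
        fun t₂ ht₂ q₂ => Runs.straight rfl ?_) (by simp; omega) fun _ _ h => h
      · simp [hc, Instance.ask]
      · simp [hc, Instance.Answered, q₂.1]
  · intro hb
    cases x with
    | vertex v => simp [hc, Instance.ask] at hb
    | onEdge e δ hδ =>
      refine Runs.mono (Runs.seq (Runs.straight
          (Q := fun t => t.word 54 0 = I.src e ∧ t.word 5 2 = i ∧ t.word 5 1 = e ∧ t.real 3 0 = δ)
          rfl ?_)
        fun t₁ ht₁ q₁ => Runs.seq (vertexQuery_runs hw hlg
          (hg'.same ht₁ (by decide) (by decide)) q₁.2.1 q₁.1)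
        fun t₂ ht₂ q₂ => Runs.mono (edgeQuery_runs hw hlg
          ((hg'.same ht₁ (by decide) (by decide)).same ht₂ (by decide) (by decide))
          ((congrFun (ht₂.1 5 (by decide)) 2).trans q₁.2.1)
          ((congrFun (ht₂.1 5 (by decide)) 1).trans q₁.2.2.1)
          ((congrFun (ht₂.2 3 (by decide)) 0).trans q₁.2.2.2) q₂.2.1 q₂.2.2) le_rfl
          fun t₃ ht₃ q₃ => ?_) (by simp; omega) fun _ _ h => h
      · have := hg'.loaded.src e
        simp [hc, Instance.ask] at this ⊢
        exact this
      · obtain ⟨h₁, h₂, h₃⟩ := q₃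
        rw [q₂.1] at h₁
        -- The coefficients are valid on the whole edge; the requested distance is the special case
        -- of the `δ` in the query.
        have hlin : ∀ (δ : ℝ) (hδ : δ ∈ Set.Icc 0 (I.len e)),
            I.Ed (.onEdge e δ hδ) i = t₃.real 4 1 + t₃.real 4 2 * δ := fun δ hδ => by
          rw [g.Ed_onEdge, h₁, h₂]
        exact ⟨by rw [h₃, hlin], hlin⟩
  · decide
  · decide

end

/-! ### Constants, and all reachable memory states -/

theorem Big.of_pow_le {w M : ℕ} (hM : 0 < M) (h : (M + 2) ^ 9 ≤ 2 ^ w) : Big w M := by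
  refine le_trans ?_ h
  -- The exponent is 9 = 7 + 2: as `M ≥ 1`, seven factors give at least 3 ^ 7 = 2187 > 1000, and two
  -- remain for the square.
  have h₁ : 3 ^ 7 ≤ (M + 2) ^ 7 := Nat.pow_le_pow_left (by omega) 7
  calc 1000 * ((M + 2) * (M + 2)) ≤ (M + 2) ^ 7 * ((M + 2) * (M + 2)) :=
        Nat.mul_le_mul_right _ (le_trans (by norm_num) h₁)
    _ = (M + 2) ^ 9 := by ring

/-- Both `log 2` and `Nat.log 2 M * log 2` are at most `log (M + 1)`, and 2 / log 2 < 3. -/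
theorem log_two_add_one_le {M : ℕ} (hM : 0 < M) :
    ((Nat.log 2 M + 1 : ℕ) : ℝ) ≤ 3 * Real.log (M + 1) := by
  have hM' : (1 : ℝ) ≤ M := by exact_mod_cast hM
  have h₁ : (Nat.log 2 M : ℝ) * Real.log 2 ≤ Real.log (M + 1) := by
    rw [← Real.log_pow]
    refine Real.log_le_log (by positivity) ?_
    have : ((2 ^ Nat.log 2 M : ℕ) : ℝ) ≤ M := by exact_mod_cast Nat.pow_log_le_self 2 hM.ne'
    push_cast at this
    linarith
  have h₂ : Real.log 2 ≤ Real.log (M + 1) := Real.log_le_log (by norm_num) (by linarith)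
  have h₃ := Real.log_two_gt_d9
  have h₄ : (0 : ℝ) ≤ Nat.log 2 M := Nat.cast_nonneg _
  push_cast
  nlinarith

/-- Posing and answering a query leave the stored index intact, so completeness is an invariant of
all sequences of queries. -/
theorem Index.exists_complete {I : Instance} {w lg : ℕ} {s : Store} (hw : Big w I.M)
    (hlg : I.M < 2 ^ lg) (h : I.Ready w buildIndex answerQuery s) :
    ∃ g : Index I, g.Complete s := by
  induction h with
  | built h =>
    obtain ⟨t, s', h', -, -, hg⟩ := buildIndex_runs hw hlg
    rwa [h.deterministic h']
  | @step x i t s s' _ h ih =>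
    obtain ⟨g, hg⟩ := ih
    obtain ⟨t, s', h', -, -, -, hg⟩ := answerQuery_runs x i hw hlg hg
    exact ⟨g, by rwa [h.deterministic h']⟩

end UncertainTree

theorem mainTheorem5 :
    ∃ (build query : UncertainTree.Prog) (C : ℝ) (c : ℕ),
      ∀ (I : UncertainTree.Instance) (w : ℕ), (I.M + 2) ^ c ≤ 2 ^ w →
        (∃ (t : ℕ) (s : UncertainTree.Store),
          UncertainTree.Exec w build I.input t s ∧
          (t : ℝ) ≤ C * (I.M * Real.log (I.M + 1))) ∧
        ∀ s : UncertainTree.Store, I.Ready w build query s →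
          ∀ (x : I.Point) (i : Fin I.n),
            ∃ (t : ℕ) (s' : UncertainTree.Store),
              UncertainTree.Exec w query (I.ask x i s) t s' ∧
              (t : ℝ) ≤ C * Real.log (I.M + 1) ∧
              I.Answered x i s' := by
  -- With `lg = Nat.log 2 M + 1 ≤ 3 * log (M + 1)`, building costs at most 6000 * M * lg, which
  -- gives 3 * 6000 = 18000. A query costs at most 700 * lg + 2000 ≤ 2700 * lg, well within the same
  -- constant.
  refine ⟨UncertainTree.buildIndex, UncertainTree.answerQuery, 18000, 9, fun I w h => ?_⟩
  have hw := UncertainTree.Big.of_pow_le I.M_pos h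
  have hlg : I.M < 2 ^ (Nat.log 2 I.M + 1) := Nat.lt_pow_succ_log_self (by norm_num) _
  have hlog := UncertainTree.log_two_add_one_le I.M_pos
  have hM : (0 : ℝ) ≤ I.M := Nat.cast_nonneg _
  constructor
  · obtain ⟨t, s, he, ht, -⟩ := UncertainTree.buildIndex_runs hw hlg
    refine ⟨t, s, he, ?_⟩
    have ht' : (t : ℝ) ≤ 6000 * (I.M * ((Nat.log 2 I.M + 1 : ℕ) : ℝ)) := by exact_mod_cast ht
    have := mul_le_mul_of_nonneg_left hlog hM
    linarith
  · intro s hs x i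
    obtain ⟨g, hg⟩ := UncertainTree.Index.exists_complete hw hlg hs
    obtain ⟨t, s', he, ht, -, hans, -⟩ := UncertainTree.answerQuery_runs x i hw hlg hg
    refine ⟨t, s', he, ?_, hans⟩
    have ht' : (t : ℝ) ≤ 2700 * ((Nat.log 2 I.M + 1 : ℕ) : ℝ) := by
      exact_mod_cast ht.trans (by omega)
    have : (0 : ℝ) ≤ ((Nat.log 2 I.M + 1 : ℕ) : ℝ) := Nat.cast_nonneg _
    linarith
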